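/- Let $p\ge 1$ be an integer, let $\Delta=\{(u,v): 0<u<1,\ 0<v<u\}$, let $\mathbf u:\,]0,1[^2\to\Delta$ be given by $\mathbf u(s,t)=(s,st)$, let $\mathbf F:\Delta\to\mathbb R^2$, and put $\Omega=\mathbf F(\Delta)$. For $n\ge 0$ let $\mathcal S_n$ be the tensor-product space spanned by the products $b_i(s)\,b_j(t)$ of the univariate B-splines of degree $p$ on $]0,1[$ with open knot vector and uniform simple interior knots of mesh size $2^{-n}$. Suppose that $\mathbf G=\mathbf F\circ\mathbf u$ is a NURBS parameterization, i.e. for some $n\ge 0$ there are $w,v_1,v_2\in\mathcal S_n$, with $w$ bounded below by a positive constant on $]0,1[^2$, such that $\mathbf G=(v_1/w,\,v_2/w)$ on $]0,1[^2$. Suppose that $\mathbf F\in(\mathscr C^{p}(\overline\Delta))^2$, i.e. both components of $\mathbf F$ are $p$ times continuously differentiable on $\Delta$ and all their partial derivatives of order at most $p$ have a limit at every point of $\partial\Delta$; and suppose that $\det\nabla\mathbf F>\underline c$ on $\Delta$ for some constant $\underline c>0$. Then there is a constant $C_F>0$, depending only on $\mathbf F$ and $p$, such that for every $\varphi\in H^{p+1}(\Omega)$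 we have $\varphi\circ\mathbf F\in H^{p+1}(\Delta)$ and, for all $0\le k\le p+1$, $$\frac1{C_F}\,\|\varphi\|_{H^k(\Omega)}\ \le\ \|\varphi\circ\mathbf F\|_{H^k(\Delta)}\ \le\ C_F\,\|\varphi\|_{H^k(\Omega)}.$$ Here $\|f\|_{H^k(D)}^2=\sum_{|\alpha|\le k}\|\partial^\alpha f\|_{L^2(D)}^2$ with weak derivatives $\partial^\alpha f$. -/

import Mathlib

open Set Filter Topology MeasureTheory
open scoped ContDiff

namespace IGA

noncomputable section

/-- The Euclidean plane. A function or map "on a domain `D`" is represented by a function on the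
whole plane of which only the values on `D` are ever used. -/
abbrev Plane := EuclideanSpace ℝ (Fin 2)

/-- The open unit square `]0,1[²`. -/
def unitSquare : Set Plane := {x | 0 < x 0 ∧ x 0 < 1 ∧ 0 < x 1 ∧ x 1 < 1}

/-- The open triangle `Δ = {(u,v) : 0 < u < 1, 0 < v < u}`. -/
def triangle : Set Plane := {x | 0 < x 0 ∧ x 0 < 1 ∧ 0 < x 1 ∧ x 1 < x 0}

/-- The map `(s,t) ↦ (s, s t)` from the unit square onto the triangle. -/
def collapse (x : Plane) : Plane := !₂[x 0, x 0 * x 1]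

/-! ### B-splines and NURBS -/

/-- Cox - de Boor recursion: the `i`-th B-spline of the given degree for the knot sequence `τ`.
Fractions with denominator `0` count as `0`, as usual, which is Lean's convention for division. -/
def coxDeBoor (τ : ℕ → ℝ) : ℕ → ℕ → ℝ → ℝ
  | 0, i, s => if τ i ≤ s ∧ s < τ (i + 1) then 1 else 0
  | q + 1, i, s =>
      (s - τ i) / (τ (i + q + 1) - τ i) * coxDeBoor τ q i s +
      (τ (i + q + 2) - s) / (τ (i + q + 2) - τ (i + 1)) * coxDeBoor τ q (i + 1) s

/-- The open knot vector of degree `p` on `[0,1]` with uniform interior knots of mesh size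
`1 / 2 ^ n`: the knots are `0` for `j ≤ p`, `l / 2 ^ n` for `j = p + l` with `0 ≤ l ≤ 2 ^ n`, and
`1` for `j ≥ p + 2 ^ n`. -/
def knot (p n j : ℕ) : ℝ := max 0 (min 1 (((j : ℝ) - (p : ℝ)) / 2 ^ n))

/-- The univariate B-splines of degree `p` at level `n`; there are `2 ^ n + p` of them
(numbered from `0`). -/
def bspline (p n : ℕ) (i : Fin (2 ^ n + p)) : ℝ → ℝ := coxDeBoor (knot p n) p i

/-- The tensor-product B-spline space of degree `p` at level `n`. -/
def splineSpace (p n : ℕ) : Submodule ℝ (Plane → ℝ) :=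
  Submodule.span ℝ (Set.range fun (ij : Fin (2 ^ n + p) × Fin (2 ^ n + p)) (x : Plane) =>
    bspline p n ij.1 (x 0) * bspline p n ij.2 (x 1))

/-- `G` is a NURBS map of degree `p` and level `n` on the unit square: there is one weight
function in the spline space, uniformly positive on the unit square, such that every component of
`G` is a quotient of a spline by the weight. -/
def IsNurbsMap (p n : ℕ) (G : Plane → Plane) : Prop :=
  ∃ w ∈ splineSpace p n, (∃ ε : ℝ, 0 < ε ∧ ∀ x ∈ unitSquare, ε ≤ w x) ∧
    ∀ i : Fin 2, ∃ v ∈ splineSpace p n, ∀ x ∈ unitSquare, G x i = v x / w x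

/-! ### Derivatives and smoothness up to the boundary -/

/-- The (classical) partial derivative in the `i`-th coordinate direction. -/
def partialDeriv (i : Fin 2) (f : Plane → ℝ) (x : Plane) : ℝ :=
  fderiv ℝ f x (EuclideanSpace.single i 1)

/-- The (classical) partial derivative `∂^α f` for a multi-index `α = (α₁, α₂)`. -/
def multiDeriv (α : ℕ × ℕ) (f : Plane → ℝ) : Plane → ℝ :=
  (partialDeriv 0)^[α.1] ((partialDeriv 1)^[α.2] f)

/-- The space `𝒞^k` of the closure of the open set `D`: functions that are `k` times continuously
differentiable on `D` all of whose partial derivatives of order at most `k` have a limit at every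
boundary point of `D`. -/
def ContDiffOnClosure (k : ℕ) (D : Set Plane) (f : Plane → ℝ) : Prop :=
  ContDiffOn ℝ k f D ∧
    ∀ α : ℕ × ℕ, α.1 + α.2 ≤ k → ∀ x ∈ frontier D,
      ∃ l : ℝ, Tendsto (multiDeriv α f) (𝓝[D] x) (𝓝 l)

/-! ### Sobolev spaces -/

/-- `g` is the weak derivative `∂^α f` on the open set `D`. -/
def HasWeakDeriv (D : Set Plane) (α : ℕ × ℕ) (f g : Plane → ℝ) : Prop :=
  LocallyIntegrableOn f D ∧ LocallyIntegrableOn g D ∧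
    ∀ η : Plane → ℝ, ContDiff ℝ ∞ η → HasCompactSupport η → tsupport η ⊆ D →
      ∫ x in D, f x * multiDeriv α η x = (-1) ^ (α.1 + α.2) * ∫ x in D, g x * η x

/-- Membership in `H^k(D)`: all weak derivatives of order at most `k` exist and lie in `L²(D)`. -/
def MemSobolev (k : ℕ) (D : Set Plane) (f : Plane → ℝ) : Prop :=
  ∀ α : ℕ × ℕ, α.1 + α.2 ≤ k →
    ∃ g : Plane → ℝ, HasWeakDeriv D α f g ∧ MemLp g 2 (volume.restrict D)

open Classical in
/-- The weak derivative `∂^α f` on `D` (unique up to null sets; `0` if there is none). -/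
def weakDeriv (D : Set Plane) (α : ℕ × ℕ) (f : Plane → ℝ) : Plane → ℝ :=
  if h : ∃ g, HasWeakDeriv D α f g then h.choose else 0

/-- The norm of `H^k(D)`: the square root of the sum of `‖∂^α f‖²` in `L²(D)` over `|α| ≤ k`.
Meaningful for members of `H^k(D)`. -/
def sobolevNorm (k : ℕ) (D : Set Plane) (f : Plane → ℝ) : ℝ :=
  Real.sqrt (∑ α ∈ (Finset.range (k + 1) ×ˢ Finset.range (k + 1)).filter (fun α => α.1 + α.2 ≤ k),
    ∫ x in D, (weakDeriv D α f x) ^ 2)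

end

end IGA

/-!
Composition with a `W^{p+1,∞}` map whose inverse is locally of the same class preserves `H^k` for
`k ≤ p + 1`. The hypotheses on `F` only speak of derivatives up to order `p`; the missing order
comes from the NURBS structure.

*Regularity of `F`.* On the image of a mesh cell under `collapse` every component of `F` is a
rational function of `(s, t) = (u, v / u)`, and so are all its derivatives. A derivative `∂^α F_i`
with `|α| = k ≤ p` has the form `N (s, t) / (s ^ k w (s, t) ^ (k + 1))` with polynomials `N` and
`w`, where the power of `s` comes from the singularity of `v / u` at the collapsed corner. Since it
has a limit `l` at the corner, on the cells touching the corner the polynomial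
`N - l s ^ k w ^ (k + 1)` is divisible by `s ^ (k + 1)`: for fixed `t` it is `o (s ^ k)` as `s → 0`
(`X_pow_dvd_of_tendsto_evalEval`). Hence there
`∂^α F_i = l + u · M (s, t) / w (s, t) ^ (k + 1)`, and the factor `u` compensates for the
singularity of `v / u` in one further differentiation, so the gradient of `∂^α F_i` is bounded on
each cell (`exists_bound_partialDeriv_cell`). As `∂^α F_i` is continuous on the triangle, it is
Lipschitz there: integrate along axis-parallel paths in the triangle, which meet the mesh lines in
only countably many points, except for vertical segments on a mesh line, which are limits of
other vertical segments (`exists_lipschitzOnWith_multiDeriv`). So the entries of the Jacobian of `F`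
belong to `W^{p,∞}` (`IsMultiplier`), and because the determinant is bounded below, so do the
entries of its inverse (`isMultiplier_inverseJacobian`).

*Change of variables.* `F` need not be injective. It has a Lipschitz derivative with uniformly
bounded inverse, so it is injective on the parts of the triangle of diameter below a fixed bound
(`exists_injective_scale`), finitely many of which cover it. Integrals over `F '' triangle` and
over `triangle` are therefore comparable (`exists_isTransport`).

*Composition.* The chain rule `∂_i (φ ∘ F) = ∑ j, (∂_j φ ∘ F) ∂_i F_j` for weak derivatives follows
from that for smooth functions by mollification (`IsTransport.hasWeakDeriv_comp`). Multiplication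
by a function in `W^{k,∞}` preserves having weak derivatives of order `k`, with a pointwise bound
(`IsMultiplier.hasWeakDerivs_mul`). By induction on the order, the sum of the absolute values of
the weak derivatives of `φ ∘ F` up to order `k` is bounded by a constant times that for `φ`,
evaluated at `F`; the converse bound follows in the same way from
`∂_j φ ∘ F = ∑ i, K_{ji} ∂_i (φ ∘ F)`, where `K` is the inverse Jacobian
(`IsTransport.exists_derivSum_comp_le`). Squaring and integrating gives the claim.
-/

namespace IGA

/-! ### Partial derivatives and multi-indices -/

/-- The multi-index of the single derivative in the `i`-th coordinate direction. -/
def unitIndex (i : Fin 2) : ℕ × ℕ := if i = 0 then (1, 0) else (0, 1)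

lemma unitIndex_zero : unitIndex 0 = (1, 0) := rfl

lemma unitIndex_one : unitIndex 1 = (0, 1) := rfl

lemma unitIndex_order (i : Fin 2) : (unitIndex i).1 + (unitIndex i).2 = 1 := by
  fin_cases i <;> rfl

lemma exists_eq_add_unitIndex {α : ℕ × ℕ} {k : ℕ} (h : α.1 + α.2 = k + 1) :
    ∃ (i : Fin 2) (β : ℕ × ℕ), α = β + unitIndex i ∧ β.1 + β.2 = k := by
  obtain ⟨a, b⟩ := α
  rcases a with _ | a
  · refine ⟨1, (0, k), ?_, by simp⟩
    simpa [unitIndex_one] using h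
  · refine ⟨0, (a, b), ?_, ?_⟩
    · simp [unitIndex_zero]
    · simp at h ⊢
      omega

section PartialDeriv

variable {D : Set Plane} {f g : Plane → ℝ} {x : Plane} {i : Fin 2}

lemma multiDeriv_zero (f : Plane → ℝ) : multiDeriv 0 f = f := rfl

lemma multiDeriv_unitIndex (i : Fin 2) (f : Plane → ℝ) :
    multiDeriv (unitIndex i) f = partialDeriv i f := by
  fin_cases i <;> rfl

lemma partialDeriv_congr (hD : IsOpen D) (h : EqOn f g D) :
    EqOn (partialDeriv i f) (partialDeriv i g) D := fun x hx => by
  have : f =ᶠ[𝓝 x] g := h.eventuallyEq_of_mem (hD.mem_nhds hx)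
  simp [partialDeriv, this.fderiv_eq]

lemma contDiffOn_partialDeriv {m n : ℕ∞ω} (hD : IsOpen D) (hf : ContDiffOn ℝ n f D)
    (h : m + 1 ≤ n) : ContDiffOn ℝ m (partialDeriv i f) D :=
  (hf.fderiv_of_isOpen hD h).clm_apply contDiffOn_const

lemma contDiffOn_multiDeriv {k n : ℕ} {α : ℕ × ℕ} (hD : IsOpen D) (hf : ContDiffOn ℝ n f D)
    (h : k + α.1 + α.2 ≤ n) : ContDiffOn ℝ k (multiDeriv α f) D := by
  have iter : ∀ (i : Fin 2) (a k : ℕ) (g : Plane → ℝ), ContDiffOn ℝ ((k + a : ℕ) : ℕ∞ω) g D →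
      ContDiffOn ℝ k ((partialDeriv i)^[a] g) D := by
    intro i a
    induction a with
    | zero => intro k g hg; simpa using hg
    | succ a ih =>
      intro k g hg
      rw [Function.iterate_succ_apply]
      exact ih k _ (contDiffOn_partialDeriv hD hg (by push_cast; rw [add_assoc]))
  refine iter 0 _ _ _ (iter 1 _ _ _ (hf.of_le ?_))
  exact_mod_cast h

lemma contDiff_partialDeriv (hf : ContDiff ℝ ∞ f) : ContDiff ℝ ∞ (partialDeriv i f) :=
  contDiffOn_univ.1 (contDiffOn_partialDeriv isOpen_univ (contDiffOn_univ.2 hf) (by simp))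

lemma partialDeriv_comm (hD : IsOpen D) (hf : ContDiffOn ℝ 2 f D) :
    EqOn (partialDeriv 0 (partialDeriv 1 f)) (partialDeriv 1 (partialDeriv 0 f)) D := fun x hx => by
  have hfx : ContDiffAt ℝ 2 f x := hf.contDiffAt (hD.mem_nhds hx)
  have hd : DifferentiableAt ℝ (fderiv ℝ f) x :=
    (hfx.fderiv_right (m := 1) (by norm_num)).differentiableAt (by norm_num)
  have key : ∀ i j : Fin 2, partialDeriv i (partialDeriv j f) x =
      fderiv ℝ (fderiv ℝ f) x (EuclideanSpace.single i 1) (EuclideanSpace.single j 1) := by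
    intro i j
    unfold partialDeriv
    rw [fderiv_clm_apply hd (differentiableAt_const _)]
    simp
  rw [key, key]
  exact (hfx.isSymmSndFDerivAt (by simp)) _ _

lemma multiDeriv_add_unitIndex {n : ℕ} {α : ℕ × ℕ} (hD : IsOpen D) (hf : ContDiffOn ℝ n f D)
    (h : α.1 + α.2 + 1 ≤ n) (i : Fin 2) :
    EqOn (multiDeriv (α + unitIndex i) f) (partialDeriv i (multiDeriv α f)) D := by
  have comm : ∀ (a : ℕ) (g : Plane → ℝ), ContDiffOn ℝ ((a + 1 : ℕ) : ℕ∞ω) g D →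
      EqOn ((partialDeriv 0)^[a] (partialDeriv 1 g))
        (partialDeriv 1 ((partialDeriv 0)^[a] g)) D := by
    intro a g hg
    induction a with
    | zero => exact fun _ _ => rfl
    | succ a ih =>
      rw [Function.iterate_succ_apply', Function.iterate_succ_apply']
      have h1 := ih (hg.of_le (by exact_mod_cast Nat.le_succ _))
      refine (partialDeriv_congr hD h1).trans (partialDeriv_comm hD ?_)
      exact contDiffOn_multiDeriv (k := 2) (α := (a, 0)) hD hg (by simp; omega)
  obtain ⟨a, b⟩ := α
  fin_cases i
  · intro x _
    simp [multiDeriv, unitIndex, Function.iterate_succ_apply']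
  · have := comm a ((partialDeriv 1)^[b] f)
      (contDiffOn_multiDeriv (k := a + 1) (α := (0, b)) hD hf (by simp at h ⊢; omega))
    simpa [multiDeriv, unitIndex, Function.iterate_succ_apply'] using this

lemma multiDeriv_add_unitIndex_of_contDiff {α : ℕ × ℕ} (hf : ContDiff ℝ ∞ f) (i : Fin 2) :
    multiDeriv (α + unitIndex i) f = partialDeriv i (multiDeriv α f) := by
  have := multiDeriv_add_unitIndex (n := α.1 + α.2 + 1) (f := f) (α := α) isOpen_univ
    (contDiffOn_univ.2 (hf.of_le (by exact_mod_cast le_top))) le_rfl i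
  exact funext fun x => this (mem_univ x)

/-- The differential of a differentiable function in terms of its partial derivatives. -/
lemma fderiv_apply_eq_sum (f : Plane → ℝ) (x v : Plane) :
    fderiv ℝ f x v = ∑ i, v i * partialDeriv i f x := by
  have hv : v = ∑ i, v i • (EuclideanSpace.single i (1 : ℝ) : Plane) := by
    ext j
    fin_cases j <;> simp
  conv_lhs => rw [hv]
  simp [partialDeriv]

lemma partialDeriv_mul (hf : DifferentiableAt ℝ f x) (hg : DifferentiableAt ℝ g x) :
    partialDeriv i (fun y => f y * g y) x =
      f x * partialDeriv i g x + partialDeriv i f x * g x := by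
  unfold partialDeriv
  rw [fderiv_fun_mul hf hg]
  simp [mul_comm]

lemma partialDeriv_add (hf : DifferentiableAt ℝ f x) (hg : DifferentiableAt ℝ g x) :
    partialDeriv i (fun y => f y + g y) x = partialDeriv i f x + partialDeriv i g x := by
  unfold partialDeriv
  rw [fderiv_fun_add hf hg]
  simp

lemma tsupport_partialDeriv_subset : tsupport (partialDeriv i f) ⊆ tsupport f := by
  refine (closure_mono ?_).trans (tsupport_fderiv_subset ℝ (f := f))
  intro x hx
  simp only [Function.mem_support, partialDeriv] at hx ⊢
  exact fun h => hx (by simp [h])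

/-- A test function on the open set `D`. -/
structure IsTestFunction (D : Set Plane) (η : Plane → ℝ) : Prop where
  contDiff : ContDiff ℝ ∞ η
  hasCompactSupport : HasCompactSupport η
  tsupport_subset : tsupport η ⊆ D

namespace IsTestFunction

variable {η : Plane → ℝ}

lemma partialDeriv (h : IsTestFunction D η) (i : Fin 2) :
    IsTestFunction D (partialDeriv i η) where
  contDiff := contDiff_partialDeriv h.contDiff
  hasCompactSupport := h.hasCompactSupport.mono' (subset_closure.trans tsupport_partialDeriv_subset)
  tsupport_subset := tsupport_partialDeriv_subset.trans h.tsupport_subset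

lemma multiDeriv (h : IsTestFunction D η) (α : ℕ × ℕ) : IsTestFunction D (multiDeriv α η) := by
  have iter : ∀ (i : Fin 2) (a : ℕ) (g : Plane → ℝ), IsTestFunction D g →
      IsTestFunction D ((IGA.partialDeriv i)^[a] g) := by
    intro i a
    induction a with
    | zero => intro g hg; simpa using hg
    | succ a ih =>
      intro g hg
      rw [Function.iterate_succ_apply]
      exact ih _ (hg.partialDeriv i)
  exact iter 0 _ _ (iter 1 _ _ h)

end IsTestFunction

end PartialDeriv

/-! ### Weak derivatives -/

section WeakDeriv

variable {D : Set Plane} {f g h : Plane → ℝ} {α : ℕ × ℕ}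

lemma integrable_mul_of_isTestFunction {η : Plane → ℝ}
    (hf : LocallyIntegrableOn f D) (hη : IsTestFunction D η) :
    Integrable (fun x => f x * η x) (volume.restrict D) := by
  have hK : IntegrableOn f (tsupport η) :=
    hf.integrableOn_compact_subset hη.tsupport_subset hη.hasCompactSupport
  have hcont : Continuous η := hη.contDiff.continuous
  have h1 : IntegrableOn (fun x => f x * η x) (tsupport η) :=
    hK.mul_continuousOn hcont.continuousOn hη.hasCompactSupport
  have : Integrable (fun x => f x * η x) := by
    refine (integrableOn_iff_integrable_of_support_subset ?_).1 h1
    intro x hx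
    exact subset_tsupport _ (right_ne_zero_of_mul hx)
  exact this.restrict

lemma HasWeakDeriv.unique (hD : IsOpen D) (hg : HasWeakDeriv D α f g) (hh : HasWeakDeriv D α f h) :
    g =ᵐ[volume.restrict D] h := by
  have : ∀ᵐ x, x ∈ D → (g - h) x = 0 := by
    refine hD.ae_eq_zero_of_integral_contDiff_smul_eq_zero (hg.2.1.sub hh.2.1) ?_
    intro η h1 h2 h3
    have hη : IsTestFunction D η := ⟨h1, h2, h3⟩
    have e1 := hg.2.2 η h1 h2 h3
    have e2 := hh.2.2 η h1 h2 h3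
    have e3 : ∫ x in D, g x * η x = ∫ x in D, h x * η x := by
      have := e1.symm.trans e2
      exact mul_left_cancel₀ (pow_ne_zero _ (by norm_num)) this
    have e4 : ∫ x, η x • (g - h) x = ∫ x in D, η x • (g - h) x := by
      refine (setIntegral_eq_integral_of_forall_compl_eq_zero fun x hx => ?_).symm
      rw [image_eq_zero_of_notMem_tsupport (fun h => hx (h3 h)), zero_smul]
    rw [e4]
    have e5 : ∀ x, η x • (g - h) x = g x * η x - h x * η x := fun x => by
      simp only [Pi.sub_apply, smul_eq_mul]; ring
    simp_rw [e5]
    rw [integral_sub (integrable_mul_of_isTestFunction hg.2.1 hη)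
      (integrable_mul_of_isTestFunction hh.2.1 hη), e3, sub_self]
  rw [EventuallyEq, ae_restrict_iff' hD.measurableSet]
  filter_upwards [this] with x hx hxD
  simpa [sub_eq_zero] using hx hxD

lemma locallyIntegrableOn_congr_ae (hD : IsOpen D) (hf : LocallyIntegrableOn f D)
    (h : f =ᵐ[volume.restrict D] g) : LocallyIntegrableOn g D := by
  rw [locallyIntegrableOn_iff hD.isLocallyClosed] at hf ⊢
  intro K hK hKc
  exact (hf K hK hKc).congr (ae_restrict_of_ae_restrict_of_subset hK h)

lemma HasWeakDeriv.congr {f' g' : Plane → ℝ} (hD : IsOpen D) (h : HasWeakDeriv D α f g)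
    (hf : f =ᵐ[volume.restrict D] f') (hg : g =ᵐ[volume.restrict D] g') :
    HasWeakDeriv D α f' g' := by
  refine ⟨locallyIntegrableOn_congr_ae hD h.1 hf, locallyIntegrableOn_congr_ae hD h.2.1 hg,
    fun η h1 h2 h3 => ?_⟩
  have e1 : ∫ x in D, f' x * multiDeriv α η x = ∫ x in D, f x * multiDeriv α η x :=
    integral_congr_ae (by filter_upwards [hf] with x hx; rw [hx])
  have e2 : ∫ x in D, g' x * η x = ∫ x in D, g x * η x :=
    integral_congr_ae (by filter_upwards [hg] with x hx; rw [hx])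
  rw [e1, e2, h.2.2 η h1 h2 h3]

lemma HasWeakDeriv.add {f' g' : Plane → ℝ} (h : HasWeakDeriv D α f g)
    (h' : HasWeakDeriv D α f' g') :
    HasWeakDeriv D α (fun x => f x + f' x) (fun x => g x + g' x) := by
  refine ⟨h.1.add h'.1, h.2.1.add h'.2.1, fun η h1 h2 h3 => ?_⟩
  have hη : IsTestFunction D η := ⟨h1, h2, h3⟩
  simp_rw [add_mul]
  rw [integral_add (integrable_mul_of_isTestFunction h.1 (hη.multiDeriv α))
    (integrable_mul_of_isTestFunction h'.1 (hη.multiDeriv α)),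
    integral_add (integrable_mul_of_isTestFunction h.2.1 hη)
    (integrable_mul_of_isTestFunction h'.2.1 hη), h.2.2 η h1 h2 h3, h'.2.2 η h1 h2 h3, mul_add]

lemma hasWeakDeriv_zero (hf : LocallyIntegrableOn f D) : HasWeakDeriv D 0 f f :=
  ⟨hf, hf, fun η _ _ _ => by simp [multiDeriv_zero]⟩

/-- It suffices to test a first weak derivative against the partial derivative. -/
lemma hasWeakDeriv_unitIndex_iff {i : Fin 2} : HasWeakDeriv D (unitIndex i) f g ↔
    LocallyIntegrableOn f D ∧ LocallyIntegrableOn g D ∧ ∀ η, IsTestFunction D η →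
      ∫ x in D, f x * partialDeriv i η x = - ∫ x in D, g x * η x := by
  unfold HasWeakDeriv
  simp only [unitIndex_order, pow_one, multiDeriv_unitIndex, neg_mul, one_mul]
  refine and_congr_right fun _ => and_congr_right fun _ => ?_
  exact ⟨fun h η hη => h η hη.1 hη.2 hη.3, fun h η h1 h2 h3 => h η ⟨h1, h2, h3⟩⟩

lemma HasWeakDeriv.trans {i : Fin 2} (h1 : HasWeakDeriv D (unitIndex i) f g)
    (h2 : HasWeakDeriv D α g h) : HasWeakDeriv D (α + unitIndex i) f h := by
  refine ⟨h1.1, h2.2.1, fun η e1 e2 e3 => ?_⟩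
  have hη : IsTestFunction D η := ⟨e1, e2, e3⟩
  rw [multiDeriv_add_unitIndex_of_contDiff e1, (hasWeakDeriv_unitIndex_iff.1 h1).2.2 _
    (hη.multiDeriv α), h2.2.2 η e1 e2 e3]
  have : (α + unitIndex i).1 + (α + unitIndex i).2 = α.1 + α.2 + 1 := by
    have := unitIndex_order i
    simp only [Prod.fst_add, Prod.snd_add]; omega
  rw [this, pow_succ]; ring

lemma HasWeakDeriv.of_trans {i : Fin 2} (h1 : HasWeakDeriv D (unitIndex i) f g)
    (h2 : HasWeakDeriv D (α + unitIndex i) f h) : HasWeakDeriv D α g h := by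
  refine ⟨h1.2.1, h2.2.1, fun η e1 e2 e3 => ?_⟩
  have hη : IsTestFunction D η := ⟨e1, e2, e3⟩
  have := (hasWeakDeriv_unitIndex_iff.1 h1).2.2 _ (hη.multiDeriv α)
  rw [← multiDeriv_add_unitIndex_of_contDiff e1, h2.2.2 η e1 e2 e3] at this
  have e : (α + unitIndex i).1 + (α + unitIndex i).2 = α.1 + α.2 + 1 := by
    have := unitIndex_order i
    simp only [Prod.fst_add, Prod.snd_add]; omega
  rw [e, pow_succ] at this
  linarith

end WeakDeriv

/-! ### Mollification -/

section Mollify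

open ContinuousLinearMap
open scoped Convolution

/-- A sequence of bump functions at the origin whose supports shrink to a point. -/
noncomputable def shrinkingBump (n : ℕ) : ContDiffBump (0 : Plane) where
  rIn := 1 / (n + 1)
  rOut := 2 / (n + 1)
  rIn_pos := by positivity
  rIn_lt_rOut := by gcongr; norm_num

/-- The mollification of `f` at the scale of `shrinkingBump n`. -/
noncomputable def mollify (n : ℕ) (f : Plane → ℝ) : Plane → ℝ :=
  (shrinkingBump n).normed volume ⋆[lsmul ℝ ℝ, volume] f

variable {f g : Plane → ℝ} {n : ℕ}

lemma tendsto_shrinkingBump_rOut : Tendsto (fun n => (shrinkingBump n).rOut) atTop (𝓝 0) := by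
  have := tendsto_one_div_add_atTop_nhds_zero_nat (𝕜 := ℝ)
  have h2 := this.const_mul 2
  simp only [mul_zero] at h2
  refine h2.congr fun n => ?_
  simp [shrinkingBump, div_eq_mul_inv]

lemma contDiff_mollify (hf : LocallyIntegrable f) : ContDiff ℝ ∞ (mollify n f) :=
  (shrinkingBump n).hasCompactSupport_normed.contDiff_convolution_left _
    (shrinkingBump n).contDiff_normed hf

lemma integrable_mollify (hf : Integrable f) : Integrable (mollify n f) :=
  (shrinkingBump n).integrable_normed.integrable_convolution _ hf

lemma integral_mollify (hf : Integrable f) : ∫ x, mollify n f x = ∫ x, f x := by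
  unfold mollify
  rw [integral_convolution _ (shrinkingBump n).integrable_normed hf]
  simp [(shrinkingBump n).integral_normed]

lemma mollify_nonneg (hf : 0 ≤ f) : 0 ≤ mollify n f := fun x => by
  unfold mollify convolution
  exact integral_nonneg fun t => mul_nonneg ((shrinkingBump n).nonneg_normed t) (hf _)

lemma mollify_apply (n : ℕ) (f : Plane → ℝ) (x : Plane) :
    mollify n f x = ∫ y, (shrinkingBump n).normed volume (x - y) * f y := by
  unfold mollify
  rw [convolution_lsmul_swap]
  simp [smul_eq_mul]

lemma integrable_mollify_integrand (hf : LocallyIntegrable f) (x : Plane) :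
    Integrable fun y => (shrinkingBump n).normed volume (x - y) * f y := by
  have h := ((shrinkingBump n).hasCompactSupport_normed (μ := volume)).comp_homeomorph
    (Homeomorph.subLeft x)
  have h2 : Continuous fun y => (shrinkingBump n).normed volume (x - y) :=
    (shrinkingBump n).continuous_normed.comp (continuous_const.sub continuous_id)
  exact hf.integrable_smul_left_of_hasCompactSupport h2 h

lemma mollify_sub (hf : LocallyIntegrable f) (hg : LocallyIntegrable g) :
    mollify n (f - g) = mollify n f - mollify n g := by
  funext x
  simp only [Pi.sub_apply, mollify_apply]
  rw [← integral_sub (integrable_mollify_integrand hf x) (integrable_mollify_integrand hg x)]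
  simp_rw [mul_sub]

lemma ae_tendsto_mollify (hf : LocallyIntegrable f) :
    ∀ᵐ x, Tendsto (fun n => mollify n f x) atTop (𝓝 (f x)) := by
  refine ContDiffBump.ae_convolution_tendsto_right_of_locallyIntegrable (K := 2)
    tendsto_shrinkingBump_rOut (Eventually.of_forall fun n => ?_) hf
  simp [shrinkingBump, div_eq_mul_inv]

/-- Almost everywhere convergence of nonnegative functions with constant mass improves to
convergence in mean, because `|a - b| = a + b - 2 min a b`. -/
lemma tendsto_integral_abs_mollify_sub_of_nonneg (hf : Integrable f) (h0 : 0 ≤ f) :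
    Tendsto (fun n => ∫ x, |mollify n f x - f x|) atTop (𝓝 0) := by
  have h1 : ∀ n, Integrable (fun x => min (mollify n f x) (f x)) := fun n =>
    (integrable_mollify hf).inf hf
  have h2 : Tendsto (fun n => ∫ x, min (mollify n f x) (f x)) atTop (𝓝 (∫ x, f x)) := by
    refine tendsto_integral_of_dominated_convergence f (fun n => (h1 n).aestronglyMeasurable) hf
      (fun n => Eventually.of_forall fun x => ?_) ?_
    · rw [Real.norm_eq_abs, abs_of_nonneg (le_min (mollify_nonneg h0 x) (h0 x))]
      exact min_le_right _ _
    · filter_upwards [ae_tendsto_mollify hf.locallyIntegrable] with x hx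
      simpa using hx.min (tendsto_const_nhds (x := f x))
  have h3 : ∀ n, ∫ x, |mollify n f x - f x| =
      2 * (∫ x, f x) - 2 * ∫ x, min (mollify n f x) (f x) := by
    intro n
    have : ∀ x, |mollify n f x - f x| = (mollify n f x + f x) - 2 * min (mollify n f x) (f x) := by
      intro x
      rcases le_total (mollify n f x) (f x) with h | h
      · rw [abs_of_nonpos (by linarith), min_eq_left h]; ring
      · rw [abs_of_nonneg (by linarith), min_eq_right h]; ring
    simp_rw [this]
    have hadd : Integrable fun x => mollify n f x + f x := (integrable_mollify hf).add hf
    rw [integral_sub hadd ((h1 n).const_mul 2),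
      integral_add (integrable_mollify hf) hf, integral_mollify hf, integral_const_mul]
    ring
  simp_rw [h3]
  simpa using (tendsto_const_nhds (x := 2 * ∫ x, f x)).sub (h2.const_mul 2)

lemma tendsto_integral_abs_mollify_sub (hf : Integrable f) :
    Tendsto (fun n => ∫ x, |mollify n f x - f x|) atTop (𝓝 0) := by
  have hp := tendsto_integral_abs_mollify_sub_of_nonneg hf.pos_part (fun x => le_max_right _ _)
  have hm := tendsto_integral_abs_mollify_sub_of_nonneg hf.neg_part (fun x => le_max_right _ _)
  have hsum := hp.add hm
  simp only [add_zero] at hsum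
  refine squeeze_zero (fun n => integral_nonneg fun x => abs_nonneg _) (fun n => ?_) hsum
  have e : f = (fun x => max (f x) 0) - fun x => max (-f x) 0 := by
    funext x
    simp only [Pi.sub_apply]
    exact (max_zero_sub_eq_self (f x)).symm
  have habs : ∀ {h : Plane → ℝ}, Integrable h → Integrable fun x => |mollify n h x - h x| :=
    fun hh => ((integrable_mollify hh).sub hh).abs
  rw [← integral_add (habs hf.pos_part) (habs hf.neg_part)]
  refine integral_mono (habs hf) ((habs hf.pos_part).add (habs hf.neg_part)) fun x => ?_
  have e2 : mollify n f x - f x = (mollify n (fun x => max (f x) 0) x - max (f x) 0) -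
      (mollify n (fun x => max (-f x) 0) x - max (-f x) 0) := by
    conv_lhs => rw [e, mollify_sub hf.pos_part.locallyIntegrable hf.neg_part.locallyIntegrable]
    simp only [Pi.sub_apply]
    ring
  change |mollify n f x - f x| ≤ _
  rw [e2]
  exact abs_sub _ _

lemma tendsto_lintegral_enorm_mollify_sub (hf : Integrable f) :
    Tendsto (fun n => ∫⁻ x, ‖mollify n f x - f x‖ₑ) atTop (𝓝 0) := by
  have h : ∀ n, ∫⁻ x, ‖mollify n f x - f x‖ₑ = ENNReal.ofReal (∫ x, |mollify n f x - f x|) := by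
    intro n
    exact (ofReal_integral_norm_eq_lintegral_enorm ((integrable_mollify hf).sub hf)).symm
  simp_rw [h]
  simpa using ENNReal.tendsto_ofReal (tendsto_integral_abs_mollify_sub hf)

/-- The mollification kernel centred at `x`, as a test function. -/
lemma isTestFunction_bump {D : Set Plane} {x : Plane}
    (h : Metric.closedBall x (shrinkingBump n).rOut ⊆ D) :
    IsTestFunction D fun y => (shrinkingBump n).normed volume (x - y) where
  contDiff := (shrinkingBump n).contDiff_normed.comp (contDiff_const.sub contDiff_id)
  hasCompactSupport := ((shrinkingBump n).hasCompactSupport_normed (μ := volume)).comp_homeomorph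
    (Homeomorph.subLeft x)
  tsupport_subset := by
    refine (closure_minimal ?_ Metric.isClosed_closedBall).trans h
    intro y hy
    have : x - y ∈ Function.support ((shrinkingBump n).normed volume) := hy
    rw [ContDiffBump.support_normed_eq, Metric.mem_ball, dist_zero_right] at this
    rw [Metric.mem_closedBall, dist_comm, dist_eq_norm]
    exact this.le

lemma partialDeriv_mollify (hf : LocallyIntegrable f) (i : Fin 2) (x : Plane) :
    partialDeriv i (mollify n f) x =
      - ∫ y, f y * partialDeriv i (fun y => (shrinkingBump n).normed volume (x - y)) y := by
  have hs := (shrinkingBump n).hasCompactSupport_normed (μ := (volume : Measure Plane))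
  have h := hs.hasFDerivAt_convolution_left (lsmul ℝ ℝ : ℝ →L[ℝ] ℝ →L[ℝ] ℝ)
    ((shrinkingBump n).contDiff_normed (n := 1)) hf x
  have hint : ConvolutionExistsAt (fderiv ℝ ((shrinkingBump n).normed volume)) f x
      ((lsmul ℝ ℝ : ℝ →L[ℝ] ℝ →L[ℝ] ℝ).precompL Plane) volume :=
    (hs.fderiv ℝ).convolutionExists_left _
      ((shrinkingBump n).contDiff_normed.continuous_fderiv one_ne_zero) hf x
  rw [partialDeriv, mollify, h.fderiv, convolution_eq_swap, integral_apply, ← integral_neg]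
  · refine integral_congr_ae (Eventually.of_forall fun y => ?_)
    have hd : HasFDerivAt (fun y => (shrinkingBump n).normed volume (x - y))
        ((fderiv ℝ ((shrinkingBump n).normed volume) (x - y)).comp
          (-(ContinuousLinearMap.id ℝ Plane : Plane →L[ℝ] Plane))) y := by
      have h1 : HasFDerivAt (fun y : Plane => x - y) (-(ContinuousLinearMap.id ℝ Plane)) y :=
        (hasFDerivAt_id (𝕜 := ℝ) y).const_sub x
      have h2 : HasFDerivAt ((shrinkingBump n).normed volume)
          (fderiv ℝ ((shrinkingBump n).normed volume) (x - y)) (x - y) :=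
        (((shrinkingBump n).contDiff_normed (n := 1)).differentiable one_ne_zero _).hasFDerivAt
      exact h2.comp y h1
    simp [partialDeriv, hd.fderiv, mul_comm]
  · exact hint.integrable_swap

/-- Functions with weak first derivatives are approximated by smooth functions, together with
their first derivatives, in mean on compact subsets. -/
lemma exists_smooth_approx {D K : Set Plane} (hD : IsOpen D) (hK : IsCompact K) (hKD : K ⊆ D)
    {f' : Fin 2 → Plane → ℝ} (hf : ∀ i, HasWeakDeriv D (unitIndex i) f (f' i)) :
    ∃ u : ℕ → Plane → ℝ, (∀ n, ContDiff ℝ ∞ (u n)) ∧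
      Tendsto (fun n => ∫⁻ x in K, ‖u n x - f x‖ₑ) atTop (𝓝 0) ∧
      ∀ i, Tendsto (fun n => ∫⁻ x in K, ‖partialDeriv i (u n) x - f' i x‖ₑ) atTop (𝓝 0) := by
  obtain ⟨K', hK', hKK', hK'D⟩ := exists_compact_between hK hD hKD
  have hi : ∀ {h : Plane → ℝ}, LocallyIntegrableOn h D → Integrable (K'.indicator h) := fun hh =>
    (hh.integrableOn_compact_subset hK'D hK').integrable_indicator hK'.measurableSet
  have hf0 := hi (hf 0).1
  have hsub : ∀ (a : Plane → ℝ) (b c : Plane → ℝ), (∀ x ∈ K, a x = c x) →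
      ∫⁻ x in K, ‖a x - b x‖ₑ ≤ ∫⁻ x, ‖c x - K'.indicator b x‖ₑ := by
    intro a b c hac
    rw [setLIntegral_congr_fun hK.measurableSet (g := fun x => ‖c x - K'.indicator b x‖ₑ)]
    · exact setLIntegral_le_lintegral _ _
    · intro x hx
      simp only [hac x hx, indicator_of_mem (interior_subset (hKK' hx))]
  refine ⟨fun n => mollify n (K'.indicator f), fun n => contDiff_mollify hf0.locallyIntegrable,
    ?_, fun i => ?_⟩
  · exact tendsto_of_tendsto_of_tendsto_of_le_of_le tendsto_const_nhds
      (tendsto_lintegral_enorm_mollify_sub hf0) (fun n => zero_le)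
      (fun n => hsub _ _ _ fun x _ => rfl)
  · obtain ⟨δ, hδ, hδK⟩ := hK.exists_cthickening_subset_open isOpen_interior hKK'
    have hev : ∀ᶠ n in atTop, (shrinkingBump n).rOut < δ :=
      tendsto_shrinkingBump_rOut.eventually (gt_mem_nhds hδ)
    refine tendsto_of_tendsto_of_tendsto_of_le_of_le' tendsto_const_nhds
      (tendsto_lintegral_enorm_mollify_sub (hi (hf i).2.1)) (Eventually.of_forall fun n => zero_le)
      (hev.mono fun n hn => hsub _ _ _ fun x hx => ?_)
    have hball : Metric.closedBall x (shrinkingBump n).rOut ⊆ interior K' :=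
      (Metric.closedBall_subset_closedBall hn.le).trans
        ((Metric.closedBall_subset_cthickening hx δ).trans hδK)
    have ht := isTestFunction_bump (D := interior K') hball
    have htD := isTestFunction_bump (D := D) (hball.trans (interior_subset.trans hK'D))
    -- integrals over `D` against functions supported in `K'` are integrals over the plane
    have hrest : ∀ (h ζ : Plane → ℝ), tsupport ζ ⊆ interior K' →
        ∫ y, K'.indicator h y * ζ y = ∫ y in D, h y * ζ y := by
      intro h ζ hζ
      have h1 : ∀ y, K'.indicator h y * ζ y = h y * ζ y := by
        intro y
        by_cases hy : y ∈ K'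
        · rw [indicator_of_mem hy]
        · have : ζ y = 0 :=
            image_eq_zero_of_notMem_tsupport fun h' => hy (interior_subset (hζ h'))
          simp [this]
      simp_rw [h1]
      refine (setIntegral_eq_integral_of_forall_compl_eq_zero fun y hy => ?_).symm
      rw [image_eq_zero_of_notMem_tsupport
        (fun h' => hy (hK'D (interior_subset (hζ h')))), mul_zero]
    rw [partialDeriv_mollify hf0.locallyIntegrable, mollify_apply,
      hrest _ _ (ht.partialDeriv i).tsupport_subset,
      (hasWeakDeriv_unitIndex_iff.1 (hf i)).2.2 _ htD, neg_neg, ← hrest _ _ ht.tsupport_subset]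
    simp_rw [mul_comm]

end Mollify

/-! ### Multiplication of weakly differentiable functions by Lipschitz functions -/

section ProductRule

variable {D : Set Plane} {f m : Plane → ℝ}

lemma locallyIntegrableOn_bdd_mul (hD : IsOpen D) (hf : LocallyIntegrableOn f D)
    (hm : AEStronglyMeasurable m (volume.restrict D)) {B : ℝ}
    (hB : ∀ᵐ x ∂(volume.restrict D), |m x| ≤ B) : LocallyIntegrableOn (fun x => m x * f x) D := by
  rw [locallyIntegrableOn_iff hD.isLocallyClosed] at hf ⊢
  intro K hK hKc
  exact (hf K hK hKc).bdd_mul (hm.mono_measure (Measure.restrict_mono hK le_rfl))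
    (ae_restrict_of_ae_restrict_of_subset hK hB)

/-- Convergence in mean on a compact set may be tested against bounded functions that vanish
off that set. -/
lemma tendsto_setIntegral_mul {K : Set Plane} (hK : IsCompact K) (hD : MeasurableSet D)
    (hKD : K ⊆ D) {u : ℕ → Plane → ℝ} {b : Plane → ℝ} (hu : ∀ n, IntegrableOn (u n) K)
    (hf : IntegrableOn f K) (hb : AEStronglyMeasurable b (volume.restrict D)) {B : ℝ}
    (hB : ∀ x ∈ D, |b x| ≤ B) (hb0 : ∀ x, x ∉ K → b x = 0)
    (h : Tendsto (fun n => ∫⁻ x in K, ‖u n x - f x‖ₑ) atTop (𝓝 0)) :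
    Tendsto (fun n => ∫ x in D, u n x * b x) atTop (𝓝 (∫ x in D, f x * b x)) := by
  have hred : ∀ g : Plane → ℝ, ∫ x in D, g x * b x = ∫ x in K, b x * g x := by
    intro g
    simp_rw [mul_comm (g _)]
    exact setIntegral_eq_of_subset_of_forall_sdiff_eq_zero hD hKD
      fun x hx => by rw [hb0 x hx.2, zero_mul]
  simp_rw [hred]
  have hbK : AEStronglyMeasurable b (volume.restrict K) :=
    hb.mono_measure (Measure.restrict_mono hKD le_rfl)
  have hBK : ∀ᵐ x ∂(volume.restrict K), ‖b x‖ ≤ B :=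
    (ae_restrict_iff' hK.measurableSet).2 (Eventually.of_forall fun x hx => hB x (hKD hx))
  refine tendsto_integral_of_L1 _ (hf.bdd_mul hbK hBK).aestronglyMeasurable
    (Eventually.of_forall fun n => (hu n).bdd_mul hbK hBK) ?_
  have hlim := ENNReal.Tendsto.const_mul (a := ENNReal.ofReal B) h (Or.inr ENNReal.ofReal_ne_top)
  rw [mul_zero] at hlim
  refine tendsto_of_tendsto_of_tendsto_of_le_of_le tendsto_const_nhds hlim (fun n => zero_le)
    fun n => ?_
  rw [← lintegral_const_mul' _ _ ENNReal.ofReal_ne_top]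
  refine lintegral_mono_ae ?_
  filter_upwards [hBK] with x hx
  rw [← mul_sub, enorm_mul]
  gcongr
  rw [← ofReal_norm]
  exact ENNReal.ofReal_le_ofReal hx

lemma ae_differentiableAt_of_lipschitzOnWith {C : NNReal} (hD : IsOpen D)
    (hm : LipschitzOnWith C m D) : ∀ᵐ x ∂(volume.restrict D), DifferentiableAt ℝ m x := by
  filter_upwards [hm.ae_differentiableWithinAt (μ := volume) hD.measurableSet,
    self_mem_ae_restrict hD.measurableSet] with x hx hxD
  exact hx.differentiableAt (hD.mem_nhds hxD)

lemma abs_partialDeriv_le_of_lipschitzOnWith {C : NNReal} (hD : IsOpen D)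
    (hm : LipschitzOnWith C m D) (i : Fin 2) {x : Plane} (hx : x ∈ D) :
    |partialDeriv i m x| ≤ C := by
  have h := (fderiv ℝ m x).le_opNorm (EuclideanSpace.single i 1)
  rw [PiLp.norm_single, norm_one, mul_one] at h
  exact h.trans (norm_fderiv_le_of_lipschitzOn ℝ (hD.mem_nhds hx) hm)

lemma measurable_partialDeriv (i : Fin 2) (m : Plane → ℝ) : Measurable (partialDeriv i m) :=
  measurable_fderiv_apply_const ℝ m _

/-- Integration by parts for a Lipschitz function against a test function: the almost everywhere
derivative of Rademacher's theorem is the weak derivative. -/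
lemma integral_lipschitz_mul_partialDeriv {C : NNReal} (hD : IsOpen D)
    (hm : LipschitzOnWith C m D) {η : Plane → ℝ} (hη : IsTestFunction D η) (i : Fin 2) :
    ∫ x in D, m x * partialDeriv i η x = - ∫ x in D, partialDeriv i m x * η x := by
  obtain ⟨m', hm', hmm'⟩ := hm.extend_real
  obtain ⟨C', hC'⟩ := hη.contDiff.lipschitzWith_of_hasCompactSupport hη.hasCompactSupport (by simp)
  have key := hm'.integral_lineDeriv_mul_eq (μ := volume) hC' hη.hasCompactSupport
    (EuclideanSpace.single i 1)
  have e1 : ∫ x, lineDeriv ℝ m' x (EuclideanSpace.single i 1) * η x =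
      ∫ x in D, partialDeriv i m x * η x := by
    rw [← setIntegral_eq_integral_of_forall_compl_eq_zero (s := D)]
    · refine integral_congr_ae ?_
      filter_upwards [ae_differentiableAt_of_lipschitzOnWith hD hm,
        self_mem_ae_restrict hD.measurableSet] with x hx hxD
      have : m' =ᶠ[𝓝 x] m := hmm'.symm.eventuallyEq_of_mem (hD.mem_nhds hxD)
      rw [this.lineDeriv_eq, hx.lineDeriv_eq_fderiv, partialDeriv]
    · intro x hx
      rw [image_eq_zero_of_notMem_tsupport fun h => hx (hη.tsupport_subset h), mul_zero]
  have e2 : ∫ x, lineDeriv ℝ η x (-(EuclideanSpace.single i 1)) * m' x =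
      - ∫ x in D, m x * partialDeriv i η x := by
    rw [← setIntegral_eq_integral_of_forall_compl_eq_zero (s := D), ← integral_neg]
    · refine setIntegral_congr_fun hD.measurableSet fun x hxD => ?_
      have : DifferentiableAt ℝ η x := hη.contDiff.differentiable (by simp) x
      simp only [this.lineDeriv_eq_fderiv, map_neg, partialDeriv, ← hmm' hxD]
      ring
    · intro x hx
      have hd : DifferentiableAt ℝ η x := hη.contDiff.differentiable (by simp) x
      have h0 : partialDeriv i η x = 0 := image_eq_zero_of_notMem_tsupport
        fun h => hx ((hη.partialDeriv i).tsupport_subset h)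
      rw [partialDeriv] at h0
      rw [hd.lineDeriv_eq_fderiv, map_neg, h0, neg_zero, zero_mul]
  rw [e1, e2] at key
  rw [key, neg_neg]

lemma IsTestFunction.contDiff_mul {u η : Plane → ℝ} (hη : IsTestFunction D η)
    (hu : ContDiff ℝ ∞ u) : IsTestFunction D fun x => u x * η x where
  contDiff := hu.mul hη.contDiff
  hasCompactSupport := hη.hasCompactSupport.mul_left
  tsupport_subset := (tsupport_mul_subset_right (f := u) (g := η)).trans hη.tsupport_subset

lemma IsTestFunction.exists_bound {η : Plane → ℝ} (hη : IsTestFunction D η) :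
    ∃ B, 0 ≤ B ∧ ∀ x, |η x| ≤ B := by
  obtain ⟨B, hB⟩ := hη.contDiff.continuous.bounded_above_of_compact_support hη.hasCompactSupport
  exact ⟨B, (norm_nonneg _).trans (hB 0), hB⟩

/-- The product rule for a function with weak first derivatives and a bounded Lipschitz
function. -/
lemma hasWeakDeriv_lipschitz_mul {C : NNReal} {B : ℝ} (hD : IsOpen D)
    (hm : LipschitzOnWith C m D) (hB : ∀ x ∈ D, |m x| ≤ B) {f' : Fin 2 → Plane → ℝ}
    (hf : ∀ i, HasWeakDeriv D (unitIndex i) f (f' i)) (i : Fin 2) :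
    HasWeakDeriv D (unitIndex i) (fun x => m x * f x)
      (fun x => m x * f' i x + partialDeriv i m x * f x) := by
  have hmeas : AEStronglyMeasurable m (volume.restrict D) :=
    hm.continuousOn.aestronglyMeasurable hD.measurableSet
  have hmeas' : AEStronglyMeasurable (partialDeriv i m) (volume.restrict D) :=
    (measurable_partialDeriv i m).aestronglyMeasurable
  have hC : ∀ x ∈ D, |partialDeriv i m x| ≤ C := fun x hx =>
    abs_partialDeriv_le_of_lipschitzOnWith hD hm i hx
  have hae : ∀ {b : Plane → ℝ} {c : ℝ}, (∀ x ∈ D, |b x| ≤ c) →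
      ∀ᵐ x ∂(volume.restrict D), |b x| ≤ c := fun h =>
    (ae_restrict_iff' hD.measurableSet).2 (Eventually.of_forall h)
  have l1 := locallyIntegrableOn_bdd_mul hD (hf i).1 hmeas (hae hB)
  have l2 := locallyIntegrableOn_bdd_mul hD (hf i).2.1 hmeas (hae hB)
  have l3 := locallyIntegrableOn_bdd_mul hD (hf i).1 hmeas' (hae hC)
  refine hasWeakDeriv_unitIndex_iff.2 ⟨l1, l2.add l3, fun η hη => ?_⟩
  set K := tsupport η with hKdef
  have hK : IsCompact K := hη.hasCompactSupport
  have hKD : K ⊆ D := hη.tsupport_subset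
  obtain ⟨u, hu, hu0, hu1⟩ := exists_smooth_approx hD hK hKD hf
  obtain ⟨E, hE0, hE⟩ := hη.exists_bound
  obtain ⟨E', hE0', hE'⟩ := (hη.partialDeriv i).exists_bound
  have hηm : AEStronglyMeasurable η (volume.restrict D) :=
    hη.contDiff.continuous.aestronglyMeasurable
  have hηm' : AEStronglyMeasurable (partialDeriv i η) (volume.restrict D) :=
    (measurable_partialDeriv i η).aestronglyMeasurable
  have hη0 : ∀ x, x ∉ K → η x = 0 := fun x hx => image_eq_zero_of_notMem_tsupport hx
  have hη0' : ∀ x, x ∉ K → partialDeriv i η x = 0 := fun x hx =>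
    image_eq_zero_of_notMem_tsupport fun h => hx (tsupport_partialDeriv_subset h)
  have huK : ∀ n, IntegrableOn (u n) K := fun n =>
    (hu n).continuous.continuousOn.integrableOn_compact hK
  have huK' : ∀ n, IntegrableOn (partialDeriv i (u n)) K := fun n =>
    (contDiff_partialDeriv (hu n)).continuous.continuousOn.integrableOn_compact hK
  have hfK : IntegrableOn f K := (hf i).1.integrableOn_compact_subset hKD hK
  have hfK' : IntegrableOn (f' i) K := (hf i).2.1.integrableOn_compact_subset hKD hK
  have hbd : ∀ {a b : Plane → ℝ} {c d : ℝ}, (∀ x ∈ D, |a x| ≤ c) → (∀ x, |b x| ≤ d) →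
      ∀ x ∈ D, |a x * b x| ≤ c * d := by
    intro a b c d ha hb x hx
    rw [abs_mul]
    exact mul_le_mul (ha x hx) (hb x) (abs_nonneg _) ((abs_nonneg _).trans (ha x hx))
  have t1 := tendsto_setIntegral_mul hK hD.measurableSet hKD huK hfK (hmeas.mul hηm')
    (hbd hB hE') (fun x hx => by simp [hη0' x hx]) hu0
  have t2 := tendsto_setIntegral_mul hK hD.measurableSet hKD huK' hfK' (hmeas.mul hηm)
    (hbd hB hE) (fun x hx => by simp [hη0 x hx]) (hu1 i)
  have t3 := tendsto_setIntegral_mul hK hD.measurableSet hKD huK hfK (hmeas'.mul hηm)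
    (hbd hC hE) (fun x hx => by simp [hη0 x hx]) hu0
  have lu : ∀ n, LocallyIntegrableOn (u n) D := fun n =>
    ((hu n).continuous.locallyIntegrable).locallyIntegrableOn _
  have lu' : ∀ n, LocallyIntegrableOn (partialDeriv i (u n)) D := fun n =>
    ((contDiff_partialDeriv (hu n)).continuous.locallyIntegrable).locallyIntegrableOn _
  -- integration by parts against the test function `u n * η`
  have hn : ∀ n, ∫ x in D, u n x * (m x * partialDeriv i η x) =
      -((∫ x in D, partialDeriv i (u n) x * (m x * η x)) +
        ∫ x in D, u n x * (partialDeriv i m x * η x)) := by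
    intro n
    have hp := integral_lipschitz_mul_partialDeriv hD hm (hη.contDiff_mul (hu n)) i
    have e1 : ∀ x, m x * partialDeriv i (fun x => u n x * η x) x =
        (m x * u n x) * partialDeriv i η x + (m x * partialDeriv i (u n) x) * η x := by
      intro x
      rw [partialDeriv_mul ((hu n).differentiable (by simp) x)
        (hη.contDiff.differentiable (by simp) x)]
      ring
    simp_rw [e1] at hp
    rw [integral_add (integrable_mul_of_isTestFunction
      (locallyIntegrableOn_bdd_mul hD (lu n) hmeas (hae hB)) (hη.partialDeriv i))
      (integrable_mul_of_isTestFunction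
      (locallyIntegrableOn_bdd_mul hD (lu' n) hmeas (hae hB)) hη)] at hp
    have r1 : ∀ x, u n x * (m x * partialDeriv i η x) = m x * u n x * partialDeriv i η x :=
      fun x => by ring
    have r2 : ∀ x, partialDeriv i (u n) x * (m x * η x) = m x * partialDeriv i (u n) x * η x :=
      fun x => by ring
    have r3 : ∀ x, u n x * (partialDeriv i m x * η x) = partialDeriv i m x * (u n x * η x) :=
      fun x => by ring
    simp_rw [r1, r2, r3]
    linarith
  have t4 := (t2.add t3).neg
  have := tendsto_nhds_unique (t1.congr hn) t4
  have r1 : ∀ x, f x * (m x * partialDeriv i η x) = m x * f x * partialDeriv i η x :=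
    fun x => by ring
  have r2 : ∀ x, f' i x * (m x * η x) = m x * f' i x * η x := fun x => by ring
  have r3 : ∀ x, f x * (partialDeriv i m x * η x) = partialDeriv i m x * f x * η x :=
    fun x => by ring
  simp_rw [Pi.mul_apply, r1, r2, r3] at this
  rw [this, ← integral_add (integrable_mul_of_isTestFunction l2 hη)
    (integrable_mul_of_isTestFunction l3 hη)]
  simp_rw [add_mul]

end ProductRule

/-! ### Multipliers -/

section Multiplier

variable {D : Set Plane} {m n : Plane → ℝ} {k : ℕ}

/-- The class `W^{k,∞}(D)` of bounded functions with bounded derivatives up to order `k`. For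
`k ≥ 1` its members are Lipschitz functions whose almost everywhere defined partial derivatives
are represented by members of the class of order `k - 1`. -/
def IsMultiplier (D : Set Plane) : ℕ → (Plane → ℝ) → Prop
  | 0, m => AEStronglyMeasurable m (volume.restrict D) ∧
      ∃ B : ℝ, ∀ᵐ x ∂(volume.restrict D), |m x| ≤ B
  | k + 1, m => (∃ B : ℝ, ∀ x ∈ D, |m x| ≤ B) ∧ (∃ L : NNReal, LipschitzOnWith L m D) ∧
      ∀ i, ∃ m', m' =ᵐ[volume.restrict D] partialDeriv i m ∧ IsMultiplier D k m'

lemma IsMultiplier.zero_of_succ (hD : IsOpen D) (h : IsMultiplier D (k + 1) m) :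
    IsMultiplier D 0 m := by
  obtain ⟨⟨B, hB⟩, ⟨L, hL⟩, -⟩ := h
  exact ⟨hL.continuousOn.aestronglyMeasurable hD.measurableSet, B,
    (ae_restrict_iff' hD.measurableSet).2 (Eventually.of_forall hB)⟩

lemma IsMultiplier.of_succ (hD : IsOpen D) (h : IsMultiplier D (k + 1) m) :
    IsMultiplier D k m := by
  induction k generalizing m with
  | zero => exact h.zero_of_succ hD
  | succ k ih =>
    obtain ⟨hB, hL, h'⟩ := h
    refine ⟨hB, hL, fun i => ?_⟩
    obtain ⟨m', h1, h2⟩ := h' i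
    exact ⟨m', h1, ih h2⟩

lemma IsMultiplier.add (hD : IsOpen D) (hm : IsMultiplier D k m) (hn : IsMultiplier D k n) :
    IsMultiplier D k fun x => m x + n x := by
  induction k generalizing m n with
  | zero =>
    obtain ⟨a1, B1, b1⟩ := hm
    obtain ⟨a2, B2, b2⟩ := hn
    refine ⟨a1.add a2, B1 + B2, ?_⟩
    filter_upwards [b1, b2] with x h1 h2
    exact (abs_add_le _ _).trans (add_le_add h1 h2)
  | succ k ih =>
    obtain ⟨⟨B1, b1⟩, ⟨L1, l1⟩, d1⟩ := hm
    obtain ⟨⟨B2, b2⟩, ⟨L2, l2⟩, d2⟩ := hn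
    refine ⟨⟨B1 + B2, fun x hx => (abs_add_le _ _).trans (add_le_add (b1 x hx) (b2 x hx))⟩,
      ⟨_, l1.add l2⟩, fun i => ?_⟩
    obtain ⟨m', e1, h1⟩ := d1 i
    obtain ⟨n', e2, h2⟩ := d2 i
    refine ⟨_, ?_, ih h1 h2⟩
    filter_upwards [e1, e2, ae_differentiableAt_of_lipschitzOnWith hD l1,
      ae_differentiableAt_of_lipschitzOnWith hD l2] with x q1 q2 q3 q4
    rw [q1, q2, partialDeriv_add q3 q4]

lemma IsMultiplier.mul (hD : IsOpen D) (hm : IsMultiplier D k m) (hn : IsMultiplier D k n) :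
    IsMultiplier D k fun x => m x * n x := by
  induction k generalizing m n with
  | zero =>
    obtain ⟨a1, B1, b1⟩ := hm
    obtain ⟨a2, B2, b2⟩ := hn
    refine ⟨a1.mul a2, B1 * B2, ?_⟩
    filter_upwards [b1, b2] with x h1 h2
    rw [abs_mul]
    exact mul_le_mul h1 h2 (abs_nonneg _) ((abs_nonneg _).trans h1)
  | succ k ih =>
    have hm0 := hm.of_succ hD
    have hn0 := hn.of_succ hD
    obtain ⟨⟨B1, b1⟩, ⟨L1, l1⟩, d1⟩ := hm
    obtain ⟨⟨B2, b2⟩, ⟨L2, l2⟩, d2⟩ := hn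
    refine ⟨⟨B1 * B2, fun x hx => ?_⟩, ⟨Real.toNNReal (B1 * L2 + L1 * B2), ?_⟩, fun i => ?_⟩
    · rw [abs_mul]
      exact mul_le_mul (b1 x hx) (b2 x hx) (abs_nonneg _) ((abs_nonneg _).trans (b1 x hx))
    · refine LipschitzOnWith.of_dist_le_mul fun x hx y hy => ?_
      have p1 := l1.dist_le_mul x hx y hy
      have p2 := l2.dist_le_mul x hx y hy
      rw [Real.dist_eq] at p1 p2 ⊢
      have hsplit : m x * n x - m y * n y = m x * (n x - n y) + (m x - m y) * n y := by ring
      rw [hsplit]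
      refine (abs_add_le _ _).trans ?_
      rw [abs_mul, abs_mul]
      have q1 : |m x| * |n x - n y| ≤ B1 * (L2 * dist x y) :=
        mul_le_mul (b1 x hx) p2 (abs_nonneg _) ((abs_nonneg _).trans (b1 x hx))
      have q2 : |m x - m y| * |n y| ≤ L1 * dist x y * B2 :=
        mul_le_mul p1 (b2 y hy) (abs_nonneg _) (by positivity)
      calc _ ≤ (B1 * L2 + L1 * B2) * dist x y := by linarith
        _ ≤ _ := by gcongr; exact Real.le_coe_toNNReal _
    · obtain ⟨m', e1, h1⟩ := d1 i
      obtain ⟨n', e2, h2⟩ := d2 i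
      refine ⟨_, ?_, (ih hm0 h2).add hD (ih h1 hn0)⟩
      filter_upwards [e1, e2, ae_differentiableAt_of_lipschitzOnWith hD l1,
        ae_differentiableAt_of_lipschitzOnWith hD l2] with x q1 q2 q3 q4
      rw [q1, q2, partialDeriv_mul q3 q4]

lemma isMultiplier_const (c : ℝ) : IsMultiplier D k fun _ => c := by
  induction k generalizing c with
  | zero => exact ⟨aestronglyMeasurable_const, |c|, Eventually.of_forall fun _ => le_rfl⟩
  | succ k ih =>
    refine ⟨⟨|c|, fun _ _ => le_rfl⟩, ⟨0, LipschitzOnWith.of_dist_le_mul fun x _ y _ => by simp⟩,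
      fun i => ⟨fun _ => 0, ?_, ih 0⟩⟩
    exact Eventually.of_forall fun x => by simp [partialDeriv]

lemma IsMultiplier.neg (hD : IsOpen D) (hm : IsMultiplier D k m) :
    IsMultiplier D k fun x => -m x := by
  simpa using (isMultiplier_const (-1)).mul hD hm

lemma partialDeriv_inv {i : Fin 2} {x : Plane} (hm : DifferentiableAt ℝ m x) (h0 : m x ≠ 0) :
    partialDeriv i (fun y => (m y)⁻¹) x = -((m x)⁻¹ * (m x)⁻¹ * partialDeriv i m x) := by
  have h := (hasDerivAt_inv h0).comp_hasFDerivAt x hm.hasFDerivAt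
  have h2 : HasFDerivAt (fun y => (m y)⁻¹) (-(m x ^ 2)⁻¹ • fderiv ℝ m x) x := h
  rw [partialDeriv, h2.fderiv]
  simp [partialDeriv, pow_two]

lemma IsMultiplier.inv (hD : IsOpen D) {c : ℝ} (hc : 0 < c) (h : ∀ x ∈ D, c ≤ m x)
    (hm : IsMultiplier D k m) : IsMultiplier D k fun x => (m x)⁻¹ := by
  have hb : ∀ x ∈ D, |(m x)⁻¹| ≤ c⁻¹ := fun x hx => by
    rw [abs_inv, abs_of_pos (hc.trans_le (h x hx))]
    exact inv_anti₀ hc (h x hx)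
  induction k with
  | zero =>
    obtain ⟨a1, -⟩ := hm
    exact ⟨a1.aemeasurable.inv.aestronglyMeasurable, c⁻¹,
      (ae_restrict_iff' hD.measurableSet).2 (Eventually.of_forall hb)⟩
  | succ k ih =>
    have h0 := ih (hm.of_succ hD)
    obtain ⟨-, ⟨L, l⟩, d⟩ := hm
    refine ⟨⟨c⁻¹, hb⟩, ⟨Real.toNNReal (c⁻¹ * c⁻¹ * L), ?_⟩, fun i => ?_⟩
    · refine LipschitzOnWith.of_dist_le_mul fun x hx y hy => ?_
      have p := l.dist_le_mul x hx y hy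
      have hx0 := (hc.trans_le (h x hx)).ne'
      have hy0 := (hc.trans_le (h y hy)).ne'
      rw [Real.dist_eq] at p ⊢
      have : (m x)⁻¹ - (m y)⁻¹ = -((m x)⁻¹ * (m y)⁻¹ * (m x - m y)) := by field_simp; ring
      rw [this, abs_neg, abs_mul, abs_mul, Real.coe_toNNReal _ (by positivity), mul_assoc _ (L : ℝ)]
      gcongr
      · exact hb x hx
      · exact hb y hy
    · obtain ⟨m', e, h'⟩ := d i
      refine ⟨_, ?_, ((h0.mul hD h0).mul hD h').neg hD⟩
      filter_upwards [e, ae_differentiableAt_of_lipschitzOnWith hD l,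
        self_mem_ae_restrict hD.measurableSet] with x q1 q2 hx
      rw [q1, partialDeriv_inv q2 (hc.trans_le (h x hx)).ne']

end Multiplier

/-! ### Families of weak derivatives up to a given order -/

section DerivSum

variable {D : Set Plane} {f g m : Plane → ℝ} {k : ℕ} {α : ℕ × ℕ}

/-- All weak derivatives of order at most `k` exist, as locally integrable functions. -/
def HasWeakDerivs (k : ℕ) (D : Set Plane) (f : Plane → ℝ) : Prop :=
  ∀ α : ℕ × ℕ, α.1 + α.2 ≤ k → ∃ g, HasWeakDeriv D α f g

/-- The multi-indices of order at most `k`. -/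
def multiIndices (k : ℕ) : Finset (ℕ × ℕ) :=
  (Finset.range (k + 1) ×ˢ Finset.range (k + 1)).filter (fun α => α.1 + α.2 ≤ k)

/-- The sum of the absolute values of all weak derivatives of order at most `k`. -/
noncomputable def derivSum (k : ℕ) (D : Set Plane) (f : Plane → ℝ) (x : Plane) : ℝ :=
  ∑ α ∈ multiIndices k, |weakDeriv D α f x|

lemma mem_multiIndices : α ∈ multiIndices k ↔ α.1 + α.2 ≤ k := by
  simp only [multiIndices, Finset.mem_filter, Finset.mem_product, Finset.mem_range]
  omega

lemma MemSobolev.hasWeakDerivs (h : MemSobolev k D f) : HasWeakDerivs k D f := fun α hα => by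
  obtain ⟨g, hg, -⟩ := h α hα
  exact ⟨g, hg⟩

lemma hasWeakDeriv_weakDeriv (h : ∃ g, HasWeakDeriv D α f g) :
    HasWeakDeriv D α f (weakDeriv D α f) := by
  rw [weakDeriv, dif_pos h]
  exact h.choose_spec

lemma HasWeakDeriv.weakDeriv_ae_eq (hD : IsOpen D) (h : HasWeakDeriv D α f g) :
    weakDeriv D α f =ᵐ[volume.restrict D] g :=
  (hasWeakDeriv_weakDeriv ⟨g, h⟩).unique hD h

lemma HasWeakDerivs.mono {l : ℕ} (h : HasWeakDerivs k D f) (hl : l ≤ k) : HasWeakDerivs l D f :=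
  fun α hα => h α (hα.trans hl)

lemma HasWeakDerivs.locallyIntegrableOn (h : HasWeakDerivs k D f) : LocallyIntegrableOn f D := by
  obtain ⟨g, hg⟩ := h 0 (by simp)
  exact hg.1

lemma HasWeakDerivs.exists_partial (h : HasWeakDerivs (k + 1) D f) (i : Fin 2) :
    ∃ g, HasWeakDeriv D (unitIndex i) f g :=
  h _ (by rw [unitIndex_order]; omega)

lemma HasWeakDerivs.of_unitIndex {i : Fin 2} (h : HasWeakDerivs (k + 1) D f)
    (hg : HasWeakDeriv D (unitIndex i) f g) : HasWeakDerivs k D g := fun α hα => by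
  obtain ⟨u, hu⟩ := h (α + unitIndex i) (by
    have := unitIndex_order i
    simp only [Prod.fst_add, Prod.snd_add]; omega)
  exact ⟨u, hg.of_trans hu⟩

lemma hasWeakDerivs_succ {f' : Fin 2 → Plane → ℝ}
    (hf : ∀ i, HasWeakDeriv D (unitIndex i) f (f' i)) (h : ∀ i, HasWeakDerivs k D (f' i)) :
    HasWeakDerivs (k + 1) D f := by
  intro α hα
  rcases Nat.eq_zero_or_pos (α.1 + α.2) with h0 | h0
  · have : α = 0 := Prod.ext (by simp; omega) (by simp; omega)
    exact ⟨f, this ▸ hasWeakDeriv_zero (hf 0).1⟩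
  · obtain ⟨i, β, rfl, hβ⟩ := exists_eq_add_unitIndex (α := α) (k := α.1 + α.2 - 1) (by omega)
    obtain ⟨u, hu⟩ := h i β (by omega)
    exact ⟨u, (hf i).trans hu⟩

lemma weakDeriv_congr (hD : IsOpen D) (h : f =ᵐ[volume.restrict D] g) :
    weakDeriv D α f = weakDeriv D α g := by
  have : HasWeakDeriv D α f = HasWeakDeriv D α g := by
    funext u
    exact propext ⟨fun hu => hu.congr hD h EventuallyEq.rfl,
      fun hu => hu.congr hD h.symm EventuallyEq.rfl⟩
  unfold weakDeriv
  rw [this]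

lemma derivSum_congr (hD : IsOpen D) (h : f =ᵐ[volume.restrict D] g) :
    derivSum k D f = derivSum k D g := by
  funext x
  simp only [derivSum, weakDeriv_congr hD h]

lemma HasWeakDerivs.add (hf : HasWeakDerivs k D f) (hg : HasWeakDerivs k D g) :
    HasWeakDerivs k D fun x => f x + g x := fun α hα => by
  obtain ⟨u, hu⟩ := hf α hα
  obtain ⟨v, hv⟩ := hg α hα
  exact ⟨_, hu.add hv⟩

lemma derivSum_nonneg (x : Plane) : 0 ≤ derivSum k D f x :=
  Finset.sum_nonneg fun _ _ => abs_nonneg _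

lemma derivSum_mono {l : ℕ} (h : k ≤ l) (x : Plane) : derivSum k D f x ≤ derivSum l D f x :=
  Finset.sum_le_sum_of_subset_of_nonneg
    (fun _ hα => mem_multiIndices.2 ((mem_multiIndices.1 hα).trans h)) fun _ _ _ => abs_nonneg _

lemma abs_weakDeriv_le_derivSum (h : α.1 + α.2 ≤ k) (x : Plane) :
    |weakDeriv D α f x| ≤ derivSum k D f x :=
  Finset.single_le_sum (f := fun α => |weakDeriv D α f x|) (fun _ _ => abs_nonneg _)
    (mem_multiIndices.2 h)

lemma abs_le_derivSum (hD : IsOpen D) (hf : LocallyIntegrableOn f D) :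
    ∀ᵐ x ∂(volume.restrict D), |f x| ≤ derivSum k D f x := by
  filter_upwards [(hasWeakDeriv_zero hf).weakDeriv_ae_eq hD] with x hx
  rw [← hx]
  exact abs_weakDeriv_le_derivSum (α := 0) (by simp) x

lemma derivSum_zero_ae_eq (hD : IsOpen D) (hf : LocallyIntegrableOn f D) :
    ∀ᵐ x ∂(volume.restrict D), derivSum 0 D f x = |f x| := by
  filter_upwards [(hasWeakDeriv_zero hf).weakDeriv_ae_eq hD] with x hx
  rw [← hx]
  have : multiIndices 0 = {0} := by
    ext α
    rw [mem_multiIndices, Finset.mem_singleton, Prod.ext_iff]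
    simp
  simp [derivSum, this]

lemma derivSum_add_le (hD : IsOpen D) (hf : HasWeakDerivs k D f) (hg : HasWeakDerivs k D g) :
    ∀ᵐ x ∂(volume.restrict D),
      derivSum k D (fun y => f y + g y) x ≤ derivSum k D f x + derivSum k D g x := by
  have : ∀ α ∈ multiIndices k, ∀ᵐ x ∂(volume.restrict D),
      weakDeriv D α (fun y => f y + g y) x = weakDeriv D α f x + weakDeriv D α g x := by
    intro α hα
    rw [mem_multiIndices] at hα
    exact ((hasWeakDeriv_weakDeriv (hf α hα)).add
      (hasWeakDeriv_weakDeriv (hg α hα))).weakDeriv_ae_eq hD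
  filter_upwards [(Finset.eventually_all _).2 this] with x hx
  rw [derivSum, derivSum, derivSum, ← Finset.sum_add_distrib]
  exact Finset.sum_le_sum fun α hα => by rw [hx α hα]; exact abs_add_le _ _

/-- The derivatives of order at most `k + 1` are the function and the derivatives of order at most
`k` of its partial derivatives. -/
lemma derivSum_succ_le (hD : IsOpen D) {f' : Fin 2 → Plane → ℝ}
    (hf : ∀ i, HasWeakDeriv D (unitIndex i) f (f' i)) (h : ∀ i, HasWeakDerivs k D (f' i)) :
    ∀ᵐ x ∂(volume.restrict D), derivSum (k + 1) D f x ≤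
      (multiIndices (k + 1)).card * (|f x| + ∑ i, derivSum k D (f' i) x) := by
  have : ∀ α ∈ multiIndices (k + 1), ∀ᵐ x ∂(volume.restrict D),
      |weakDeriv D α f x| ≤ |f x| + ∑ i, derivSum k D (f' i) x := by
    intro α hα
    rw [mem_multiIndices] at hα
    have hs : ∀ x, 0 ≤ ∑ i, derivSum k D (f' i) x := fun x =>
      Finset.sum_nonneg fun i _ => derivSum_nonneg x
    rcases Nat.eq_zero_or_pos (α.1 + α.2) with h0 | h0
    · have : α = 0 := Prod.ext (by simp; omega) (by simp; omega)
      subst this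
      filter_upwards [(hasWeakDeriv_zero (hf 0).1).weakDeriv_ae_eq hD] with x hx
      rw [hx]
      linarith [hs x]
    · obtain ⟨i, β, rfl, hβ⟩ := exists_eq_add_unitIndex (α := α) (k := α.1 + α.2 - 1) (by omega)
      have hβk : β.1 + β.2 ≤ k := by omega
      filter_upwards [((hf i).trans (hasWeakDeriv_weakDeriv (h i β hβk))).weakDeriv_ae_eq hD]
        with x hx
      rw [hx]
      have h1 := abs_weakDeriv_le_derivSum (D := D) (f := f' i) hβk x
      have h2 := Finset.single_le_sum (f := fun i => derivSum k D (f' i) x)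
        (fun i _ => derivSum_nonneg x) (Finset.mem_univ i)
      have h3 := abs_nonneg (f x)
      linarith
  filter_upwards [(Finset.eventually_all _).2 this] with x hx
  rw [← nsmul_eq_mul]
  exact Finset.sum_le_card_nsmul _ _ _ hx

lemma derivSum_partial_le (hD : IsOpen D) {i : Fin 2} (h : HasWeakDerivs (k + 1) D f)
    (hf : HasWeakDeriv D (unitIndex i) f g) : ∀ᵐ x ∂(volume.restrict D),
      derivSum k D g x ≤ (multiIndices k).card * derivSum (k + 1) D f x := by
  have : ∀ α ∈ multiIndices k, ∀ᵐ x ∂(volume.restrict D),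
      |weakDeriv D α g x| ≤ derivSum (k + 1) D f x := by
    intro α hα
    rw [mem_multiIndices] at hα
    have hg := h.of_unitIndex hf
    filter_upwards [(hf.trans (hasWeakDeriv_weakDeriv (hg α hα))).weakDeriv_ae_eq hD] with x hx
    rw [← hx]
    refine abs_weakDeriv_le_derivSum ?_ x
    have := unitIndex_order i
    simp only [Prod.fst_add, Prod.snd_add]
    omega
  filter_upwards [(Finset.eventually_all _).2 this] with x hx
  rw [← nsmul_eq_mul]
  exact Finset.sum_le_card_nsmul _ _ _ hx

/-- Multiplication by a member of `W^{k,∞}(D)` preserves weak differentiability of order `k`, with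
a pointwise bound of the derivatives of the product. -/
lemma IsMultiplier.hasWeakDerivs_mul (hD : IsOpen D) (hm : IsMultiplier D k m) :
    ∃ C : ℝ, 0 ≤ C ∧ ∀ f, HasWeakDerivs k D f → HasWeakDerivs k D (fun x => m x * f x) ∧
      ∀ᵐ x ∂(volume.restrict D), derivSum k D (fun x => m x * f x) x ≤ C * derivSum k D f x := by
  induction k generalizing m with
  | zero =>
    obtain ⟨hmeas, B, hB⟩ := hm
    refine ⟨|B|, abs_nonneg _, fun f hf => ?_⟩
    have hl := locallyIntegrableOn_bdd_mul hD hf.locallyIntegrableOn hmeas hB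
    refine ⟨fun α hα => ?_, ?_⟩
    · have : α = 0 := Prod.ext (by simp; omega) (by simp; omega)
      exact ⟨_, this ▸ hasWeakDeriv_zero hl⟩
    · filter_upwards [derivSum_zero_ae_eq hD hl, derivSum_zero_ae_eq hD hf.locallyIntegrableOn, hB]
        with x h1 h2 h3
      rw [h1, h2, abs_mul]
      exact mul_le_mul_of_nonneg_right (h3.trans (le_abs_self B)) (abs_nonneg _)
  | succ k ih =>
    obtain ⟨C0, hC0, ih0⟩ := ih (hm.of_succ hD)
    obtain ⟨⟨B, hB⟩, ⟨L, hL⟩, hm'⟩ := hm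
    choose m' hmm' hmult using hm'
    choose C hC ihC using fun i => ih (hmult i)
    set N : ℝ := ((multiIndices k).card : ℝ) with hN
    set N' : ℝ := ((multiIndices (k + 1)).card : ℝ) with hN'
    refine ⟨N' * (|B| + ∑ i, (C0 * N + C i)), ?_, fun f hf => ?_⟩
    · have : ∀ i, 0 ≤ C0 * N + C i := fun i => by have := hC i; positivity
      have := Finset.sum_nonneg fun i (_ : i ∈ Finset.univ) => this i
      positivity
    choose f' hf' using hf.exists_partial
    have hfk : HasWeakDerivs k D f := hf.mono (Nat.le_succ k)
    have hfk' : ∀ i, HasWeakDerivs k D (f' i) := fun i => hf.of_unitIndex (hf' i)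
    have hder : ∀ i, HasWeakDeriv D (unitIndex i) (fun x => m x * f x)
        (fun x => m x * f' i x + m' i x * f x) := fun i => by
      refine (hasWeakDeriv_lipschitz_mul hD hL hB hf' i).congr hD EventuallyEq.rfl ?_
      filter_upwards [hmm' i] with x hx
      rw [hx]
    have hk : ∀ i, HasWeakDerivs k D (fun x => m x * f' i x + m' i x * f x) := fun i =>
      (ih0 _ (hfk' i)).1.add (ihC i _ hfk).1
    refine ⟨hasWeakDerivs_succ hder hk, ?_⟩
    have hi : ∀ i, ∀ᵐ x ∂(volume.restrict D),
        derivSum k D (fun x => m x * f' i x + m' i x * f x) x ≤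
          (C0 * N + C i) * derivSum (k + 1) D f x := by
      intro i
      filter_upwards [derivSum_add_le hD (ih0 _ (hfk' i)).1 (ihC i _ hfk).1, (ih0 _ (hfk' i)).2,
        (ihC i _ hfk).2, derivSum_partial_le hD hf (hf' i)] with x h1 h2 h3 h4
      have h5 := mul_le_mul_of_nonneg_left h4 hC0
      have h6 := mul_le_mul_of_nonneg_left
        (derivSum_mono (D := D) (f := f) (Nat.le_succ k) x) (hC i)
      calc _ ≤ _ := h1
        _ ≤ C0 * (N * derivSum (k + 1) D f x) + C i * derivSum (k + 1) D f x := by linarith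
        _ = _ := by ring
    filter_upwards [derivSum_succ_le hD hder hk, ae_all_iff.2 hi,
      abs_le_derivSum (k := k + 1) hD hf.locallyIntegrableOn,
      self_mem_ae_restrict hD.measurableSet] with x h1 h2 h3 hx
    refine h1.trans ?_
    rw [mul_assoc]
    refine mul_le_mul_of_nonneg_left ?_ (by positivity)
    rw [add_mul, Finset.sum_mul]
    refine add_le_add ?_ (Finset.sum_le_sum fun i _ => h2 i)
    rw [abs_mul]
    exact mul_le_mul ((hB x hx).trans (le_abs_self B)) h3 (abs_nonneg _) (abs_nonneg _)

end DerivSum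

/-! ### The chain rule for weak derivatives -/

section ChainRule

variable {D : Set Plane} {F : Plane → Plane}

/-- A continuously differentiable map on the open set `D`, with open image, under which
integrals over `D` and over `F '' D` are comparable up to the factor `C`. The map need not be
injective. -/
structure IsTransport (D : Set Plane) (F : Plane → Plane) (C : NNReal) : Prop where
  isOpen : IsOpen D
  isOpen_image : IsOpen (F '' D)
  contDiffOn : ContDiffOn ℝ 1 F D
  lintegral_comp_le : ∀ A ⊆ D, MeasurableSet A → ∀ h : Plane → ENNReal,
    ∫⁻ x in A, h (F x) ≤ C * ∫⁻ y in F '' A, h y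
  lintegral_image_le : ∀ h : Plane → ENNReal,
    ∫⁻ y in F '' D, h y ≤ C * ∫⁻ x in D, h (F x)

lemma partialDeriv_coord {x : Plane} (hF : DifferentiableAt ℝ F x) (i j : Fin 2) :
    partialDeriv i (fun y => F y j) x = fderiv ℝ F x (EuclideanSpace.single i 1) j := by
  have h : HasFDerivAt (fun y => F y j) ((EuclideanSpace.proj j : Plane →L[ℝ] ℝ).comp
      (fderiv ℝ F x)) x := (EuclideanSpace.proj j : Plane →L[ℝ] ℝ).hasFDerivAt.comp x hF.hasFDerivAt
  rw [partialDeriv, h.fderiv]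
  rfl

lemma partialDeriv_comp {u : Plane → ℝ} {x : Plane} (hu : DifferentiableAt ℝ u (F x))
    (hF : DifferentiableAt ℝ F x) (i : Fin 2) :
    partialDeriv i (fun y => u (F y)) x =
      ∑ j, partialDeriv j u (F x) * partialDeriv i (fun y => F y j) x := by
  have h : HasFDerivAt (fun y => u (F y)) ((fderiv ℝ u (F x)).comp (fderiv ℝ F x)) x :=
    hu.hasFDerivAt.comp x hF.hasFDerivAt
  rw [partialDeriv, h.fderiv, ContinuousLinearMap.comp_apply, fderiv_apply_eq_sum]
  exact Finset.sum_congr rfl fun j _ => by rw [partialDeriv_coord hF, mul_comm]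

/-- Integration by parts for a continuously differentiable function against a test function. -/
lemma integral_contDiffOn_mul_partialDeriv {g η : Plane → ℝ} (hD : IsOpen D)
    (hg : ContDiffOn ℝ 1 g D) (hη : IsTestFunction D η) (i : Fin 2) :
    ∫ x in D, g x * partialDeriv i η x = - ∫ x in D, partialDeriv i g x * η x := by
  have hg' : ContinuousOn (partialDeriv i g) D :=
    (contDiffOn_partialDeriv (m := 0) hD hg (by simp)).continuousOn
  have hint : ∀ {a ζ : Plane → ℝ}, ContinuousOn a D → IsTestFunction D ζ →
      Integrable fun x => a x * ζ x := by
    intro a ζ ha hζ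
    refine (integrableOn_iff_integrable_of_support_subset (s := D) ?_).1
      (integrable_mul_of_isTestFunction (ha.locallyIntegrableOn hD.measurableSet) hζ)
    intro x hx
    exact hζ.tsupport_subset (subset_tsupport _ (right_ne_zero_of_mul hx))
  have hset : ∀ {a ζ : Plane → ℝ}, IsTestFunction D ζ →
      ∫ x in D, a x * ζ x = ∫ x, a x * ζ x := fun hζ =>
    setIntegral_eq_integral_of_forall_compl_eq_zero fun x hx => by
      rw [image_eq_zero_of_notMem_tsupport fun h => hx (hζ.tsupport_subset h), mul_zero]
  rw [hset (hη.partialDeriv i), hset hη]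
  exact integral_mul_fderiv_eq_neg_fderiv_mul_of_integrable (hint hg' hη)
    (hint hg.continuousOn (hη.partialDeriv i)) (hint hg.continuousOn hη)
    (fun x hx => (hg.contDiffAt (hD.mem_nhds (hη.tsupport_subset hx))).differentiableAt one_ne_zero)
    (fun x _ => hη.contDiff.differentiable (by simp) x)

namespace IsTransport

variable {C : NNReal} {φ : Plane → ℝ}

lemma aemeasurable (h : IsTransport D F C) : AEMeasurable F (volume.restrict D) :=
  h.contDiffOn.continuousOn.aemeasurable h.isOpen.measurableSet

lemma map_absolutelyContinuous (h : IsTransport D F C) :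
    (volume.restrict D).map F ≪ volume.restrict (F '' D) := by
  refine Measure.AbsolutelyContinuous.mk fun s hs h0 => ?_
  rw [Measure.map_apply_of_aemeasurable h.aemeasurable hs]
  have h1 := h.lintegral_comp_le D subset_rfl h.isOpen.measurableSet (s.indicator 1)
  rw [lintegral_indicator_one hs, h0, mul_zero, nonpos_iff_eq_zero] at h1
  have h2 : AEMeasurable (fun x => s.indicator (1 : Plane → ENNReal) (F x)) (volume.restrict D) :=
    (measurable_one.indicator hs).comp_aemeasurable h.aemeasurable
  rw [lintegral_eq_zero_iff' h2] at h1
  refine measure_mono_null (fun x hx => ?_) h1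
  have hx' : F x ∈ s := hx
  simp [hx']

lemma ae_comp (h : IsTransport D F C) {P : Plane → Prop}
    (hP : ∀ᵐ y ∂(volume.restrict (F '' D)), P y) : ∀ᵐ x ∂(volume.restrict D), P (F x) :=
  ae_of_ae_map h.aemeasurable (h.map_absolutelyContinuous hP)

lemma aestronglyMeasurable_comp (h : IsTransport D F C)
    (hφ : AEStronglyMeasurable φ (volume.restrict (F '' D))) :
    AEStronglyMeasurable (fun x => φ (F x)) (volume.restrict D) :=
  (hφ.mono_ac h.map_absolutelyContinuous).comp_aemeasurable h.aemeasurable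

lemma locallyIntegrableOn_comp (h : IsTransport D F C) (hφ : LocallyIntegrableOn φ (F '' D)) :
    LocallyIntegrableOn (fun x => φ (F x)) D := by
  rw [locallyIntegrableOn_iff h.isOpen.isLocallyClosed]
  intro K hK hKc
  have hFK : IsCompact (F '' K) := hKc.image_of_continuousOn (h.contDiffOn.continuousOn.mono hK)
  have hi := hφ.integrableOn_compact_subset (image_mono hK) hFK
  refine ⟨(h.aestronglyMeasurable_comp hφ.aestronglyMeasurable).mono_measure
    (Measure.restrict_mono hK le_rfl), ?_⟩
  refine (h.lintegral_comp_le K hK hKc.measurableSet fun y => ‖φ y‖ₑ).trans_lt ?_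
  exact ENNReal.mul_lt_top ENNReal.coe_lt_top hi.2

/-- The chain rule `∂ᵢ(φ ∘ F) = ∑ⱼ (∂ⱼφ ∘ F) ∂ᵢFⱼ` for weak derivatives. -/
lemma hasWeakDeriv_comp (h : IsTransport D F C) {φ' : Fin 2 → Plane → ℝ}
    (hφ : ∀ j, HasWeakDeriv (F '' D) (unitIndex j) φ (φ' j)) (i : Fin 2) :
    HasWeakDeriv D (unitIndex i) (fun x => φ (F x))
      (fun x => ∑ j, partialDeriv i (fun y => F y j) x * φ' j (F x)) := by
  have hD := h.isOpen
  have hFc : ContinuousOn F D := h.contDiffOn.continuousOn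
  have hA : ∀ j, ContinuousOn (partialDeriv i (fun y => F y j)) D := fun j =>
    (contDiffOn_partialDeriv (m := 0) hD (contDiffOn_euclidean.1 h.contDiffOn j)
      (by simp)).continuousOn
  have lφ := h.locallyIntegrableOn_comp (hφ 0).1
  have lφ' := fun j => h.locallyIntegrableOn_comp (hφ j).2.1
  have lmul : ∀ {a b : Plane → ℝ}, ContinuousOn a D → LocallyIntegrableOn b D →
      LocallyIntegrableOn (fun x => a x * b x) D := fun ha hb =>
    hb.continuousOn_mul ha hD.isLocallyClosed
  have lsum : LocallyIntegrableOn
      (fun x => ∑ j, partialDeriv i (fun y => F y j) x * φ' j (F x)) D := by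
    simp only [Fin.sum_univ_two]
    exact (lmul (hA 0) (lφ' 0)).add (lmul (hA 1) (lφ' 1))
  refine hasWeakDeriv_unitIndex_iff.2 ⟨lφ, lsum, fun η hη => ?_⟩
  set K := tsupport η with hKdef
  have hK : IsCompact K := hη.hasCompactSupport
  have hKD : K ⊆ D := hη.tsupport_subset
  have hFK : IsCompact (F '' K) := hK.image_of_continuousOn (hFc.mono hKD)
  obtain ⟨u, hu, hu0, hu1⟩ := exists_smooth_approx h.isOpen_image hFK (image_mono hKD) hφ
  have htr : ∀ {a : ℕ → Plane → ℝ} {b : Plane → ℝ},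
      Tendsto (fun n => ∫⁻ y in F '' K, ‖a n y - b y‖ₑ) atTop (𝓝 0) →
      Tendsto (fun n => ∫⁻ x in K, ‖a n (F x) - b (F x)‖ₑ) atTop (𝓝 0) := by
    intro a b hab
    have := ENNReal.Tendsto.const_mul (a := (C : ENNReal)) hab (Or.inr ENNReal.coe_ne_top)
    rw [mul_zero] at this
    exact tendsto_of_tendsto_of_tendsto_of_le_of_le tendsto_const_nhds this (fun n => zero_le)
      fun n => h.lintegral_comp_le K hKD hK.measurableSet fun y => ‖a n y - b y‖ₑ
  have hη0 : ∀ x, x ∉ K → η x = 0 := fun x hx => image_eq_zero_of_notMem_tsupport hx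
  have hη0' : ∀ x, x ∉ K → partialDeriv i η x = 0 := fun x hx =>
    image_eq_zero_of_notMem_tsupport fun h => hx (tsupport_partialDeriv_subset h)
  have hcomp : ∀ {v : Plane → ℝ}, Continuous v → ContinuousOn (fun x => v (F x)) D := fun hv =>
    hv.comp_continuousOn hFc
  have hintK : ∀ {v : Plane → ℝ}, Continuous v → IntegrableOn (fun x => v (F x)) K := fun hv =>
    ((hcomp hv).mono hKD).integrableOn_compact hK
  obtain ⟨E, hE0, hE⟩ := (hη.partialDeriv i).exists_bound
  have t1 := tendsto_setIntegral_mul hK hD.measurableSet hKD (fun n => hintK (hu n).continuous)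
    (lφ.integrableOn_compact_subset hKD hK)
    (hη.partialDeriv i).contDiff.continuous.aestronglyMeasurable
    (fun x _ => hE x) hη0' (htr hu0)
  have t2 : ∀ j, Tendsto (fun n => ∫ x in D, partialDeriv j (u n) (F x) *
      (partialDeriv i (fun y => F y j) x * η x)) atTop
      (𝓝 (∫ x in D, φ' j (F x) * (partialDeriv i (fun y => F y j) x * η x))) := by
    intro j
    have hb : ContinuousOn (fun x => partialDeriv i (fun y => F y j) x * η x) D :=
      (hA j).mul hη.contDiff.continuous.continuousOn
    obtain ⟨B, hB⟩ := hK.exists_bound_of_continuousOn (hb.mono hKD)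
    refine tendsto_setIntegral_mul hK hD.measurableSet hKD (B := |B|)
      (fun n => hintK (contDiff_partialDeriv (hu n)).continuous)
      ((lφ' j).integrableOn_compact_subset hKD hK) (hb.aestronglyMeasurable hD.measurableSet)
      (fun x _ => ?_) (fun x hx => by rw [hη0 x hx, mul_zero]) (htr (hu1 j))
    by_cases hx : x ∈ K
    · exact (hB x hx).trans (le_abs_self B)
    · rw [hη0 x hx, mul_zero, abs_zero]
      exact abs_nonneg _
  have lη : ∀ {a : Plane → ℝ}, LocallyIntegrableOn a D → ∀ j,
      Integrable (fun x => a x * (partialDeriv i (fun y => F y j) x * η x))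
        (volume.restrict D) := by
    intro a ha j
    refine (integrable_mul_of_isTestFunction (lmul (hA j) ha) hη).congr
      (Eventually.of_forall fun x => ?_)
    simp only
    ring
  -- integration by parts and the classical chain rule for the smooth approximations
  have hn : ∀ n, ∫ x in D, u n (F x) * partialDeriv i η x = - ∑ j, ∫ x in D,
      partialDeriv j (u n) (F x) * (partialDeriv i (fun y => F y j) x * η x) := by
    intro n
    have hc : ContDiffOn ℝ 1 (fun x => u n (F x)) D :=
      ((hu n).of_le (by simp)).comp_contDiffOn h.contDiffOn
    rw [integral_contDiffOn_mul_partialDeriv hD hc hη, ← integral_finsetSum _ fun j _ =>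
      lη ((hcomp (contDiff_partialDeriv (hu n)).continuous).locallyIntegrableOn hD.measurableSet) j]
    congr 1
    refine setIntegral_congr_fun hD.measurableSet fun x hx => ?_
    simp only
    rw [partialDeriv_comp ((hu n).differentiable (by simp) _)
      ((h.contDiffOn.contDiffAt (hD.mem_nhds hx)).differentiableAt one_ne_zero), Finset.sum_mul]
    exact Finset.sum_congr rfl fun j _ => by ring
  have t3 := tendsto_nhds_unique (t1.congr hn) (tendsto_finsetSum Finset.univ fun j _ => t2 j).neg
  rw [t3, ← integral_finsetSum _ fun j _ => lη (lφ' j) j]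
  congr 1
  refine integral_congr_ae (Eventually.of_forall fun x => ?_)
  simp only
  rw [Finset.sum_mul]
  exact Finset.sum_congr rfl fun j _ => by ring

end IsTransport

end ChainRule

/-! ### Equivalence of Sobolev norms under composition -/

section Transport

variable {D : Set Plane} {F : Plane → Plane} {C : NNReal} {p k : ℕ}

lemma exists_derivSum_sum_mul_le (hD : IsOpen D) {m : Fin 2 → Plane → ℝ}
    (hm : ∀ j, IsMultiplier D k (m j)) :
    ∃ B : ℝ, 0 ≤ B ∧ ∀ f : Fin 2 → Plane → ℝ, (∀ j, HasWeakDerivs k D (f j)) →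
      HasWeakDerivs k D (fun x => ∑ j, m j x * f j x) ∧ ∀ᵐ x ∂(volume.restrict D),
        derivSum k D (fun x => ∑ j, m j x * f j x) x ≤ B * ∑ j, derivSum k D (f j) x := by
  choose B hB h using fun j => (hm j).hasWeakDerivs_mul hD
  refine ⟨∑ j, B j, Finset.sum_nonneg fun j _ => hB j, fun f hf => ?_⟩
  simp only [Fin.sum_univ_two]
  have h0 := h 0 _ (hf 0)
  have h1 := h 1 _ (hf 1)
  refine ⟨h0.1.add h1.1, ?_⟩
  filter_upwards [derivSum_add_le hD h0.1 h1.1, h0.2, h1.2] with x e e0 e1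
  have d0 := derivSum_nonneg (k := k) (D := D) (f := f 0) x
  have d1 := derivSum_nonneg (k := k) (D := D) (f := f 1) x
  nlinarith [mul_nonneg (hB 0) d1, mul_nonneg (hB 1) d0]

/-- If the first derivatives of `F` and the entries of the inverse of its Jacobian matrix belong to
`W^{p,∞}`, then the derivatives of `φ ∘ F` and those of `φ` bound each other pointwise up to the
order `p + 1`. Both bounds follow by induction from `∂ᵢ(φ ∘ F) = ∑ⱼ ∂ᵢFⱼ (∂ⱼφ ∘ F)` and its
inversion. -/
lemma IsTransport.exists_derivSum_comp_le (h : IsTransport D F C)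
    (hA : ∀ i j, IsMultiplier D p (partialDeriv i fun y => F y j)) {K : Fin 2 → Fin 2 → Plane → ℝ}
    (hK : ∀ j i, IsMultiplier D p (K j i))
    (hKA : ∀ x ∈ D, ∀ j l, ∑ i, K j i x * partialDeriv i (fun y => F y l) x =
      if j = l then 1 else 0) (hk : k ≤ p + 1) :
    ∃ B : ℝ, 0 ≤ B ∧ ∀ φ, HasWeakDerivs k (F '' D) φ → HasWeakDerivs k D (fun x => φ (F x)) ∧
      ∀ᵐ x ∂(volume.restrict D),
        derivSum k D (fun x => φ (F x)) x ≤ B * derivSum k (F '' D) φ (F x) ∧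
        derivSum k (F '' D) φ (F x) ≤ B * derivSum k D (fun x => φ (F x)) x := by
  have hD := h.isOpen
  have hΩ := h.isOpen_image
  induction k with
  | zero =>
    refine ⟨1, zero_le_one, fun φ hφ => ?_⟩
    have hl := h.locallyIntegrableOn_comp hφ.locallyIntegrableOn
    refine ⟨fun α hα => ?_, ?_⟩
    · have : α = 0 := Prod.ext (by simp; omega) (by simp; omega)
      exact ⟨_, this ▸ hasWeakDeriv_zero hl⟩
    · filter_upwards [derivSum_zero_ae_eq hD hl,
        h.ae_comp (derivSum_zero_ae_eq hΩ hφ.locallyIntegrableOn)] with x h1 h2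
      rw [h1, h2, one_mul]
      exact ⟨le_rfl, le_rfl⟩
  | succ k ih =>
    obtain ⟨B, hB, ihB⟩ := ih (by omega)
    have hdown : ∀ {m : Plane → ℝ}, IsMultiplier D p m → IsMultiplier D k m := fun {m} hm => by
      obtain ⟨q, rfl⟩ := Nat.exists_eq_add_of_le (show k ≤ p by omega)
      clear * - hm hD
      induction q with
      | zero => exact hm
      | succ q ih => exact ih (hm.of_succ hD)
    choose B1 hB1 hA1 using fun i => exists_derivSum_sum_mul_le hD fun j => hdown (hA i j)
    choose B2 hB2 hK2 using fun j => exists_derivSum_sum_mul_le hD fun i => hdown (hK j i)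
    set N : ℝ := ((multiIndices k).card : ℝ)
    set N' : ℝ := ((multiIndices (k + 1)).card : ℝ)
    set R1 : ℝ := N' * (1 + ∑ i, B1 i * (2 * (B * N)))
    set R2 : ℝ := N' * (1 + ∑ j, B * (B2 j * (2 * N)))
    have hs1 : 0 ≤ ∑ i, B1 i * (2 * (B * N)) :=
      Finset.sum_nonneg fun i _ => by have := hB1 i; positivity
    have hs2 : 0 ≤ ∑ j, B * (B2 j * (2 * N)) :=
      Finset.sum_nonneg fun i _ => by have := hB2 i; positivity
    have hR1 : 0 ≤ R1 := by positivity
    have hR2 : 0 ≤ R2 := by positivity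
    refine ⟨R1 + R2, by positivity, fun φ hφ => ?_⟩
    choose φ' hφ' using hφ.exists_partial
    have hφk : ∀ j, HasWeakDerivs k (F '' D) (φ' j) := fun j => hφ.of_unitIndex (hφ' j)
    have hcomp := fun j => ihB _ (hφk j)
    have hder := h.hasWeakDeriv_comp hφ'
    have hA2 := fun i => hA1 i (fun j x => φ' j (F x)) fun j => (hcomp j).1
    have hW := hasWeakDerivs_succ hder fun i => (hA2 i).1
    refine ⟨hW, ?_⟩
    -- the partial derivatives of `φ`, recovered from those of `φ ∘ F`
    have hinv : ∀ j, (fun x => φ' j (F x)) =ᵐ[volume.restrict D]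
        fun x => ∑ i, K j i x * ∑ l, partialDeriv i (fun y => F y l) x * φ' l (F x) := by
      intro j
      filter_upwards [self_mem_ae_restrict hD.measurableSet] with x hx
      simp_rw [Finset.mul_sum]
      rw [Finset.sum_comm]
      simp_rw [← mul_assoc, ← Finset.sum_mul, hKA x hx]
      simp
    have hK3 := fun j => hK2 j _ fun i => (hA2 i).1
    filter_upwards [derivSum_succ_le hD hder fun i => (hA2 i).1,
      ae_all_iff.2 fun i => (hA2 i).2, ae_all_iff.2 fun j => (hcomp j).2,
      h.ae_comp (ae_all_iff.2 fun j => derivSum_partial_le hΩ hφ (hφ' j)),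
      h.ae_comp (abs_le_derivSum (k := k + 1) hΩ hφ.locallyIntegrableOn),
      h.ae_comp (derivSum_succ_le hΩ hφ' hφk),
      ae_all_iff.2 fun j => (hK3 j).2, ae_all_iff.2 fun i => derivSum_partial_le hD hW (hder i),
      abs_le_derivSum (k := k + 1) hD hW.locallyIntegrableOn]
      with x a1 a2 a3 a4 a5 b1 b2 b3 b4
    have d1 := derivSum_nonneg (k := k + 1) (D := F '' D) (f := φ) (F x)
    have d2 := derivSum_nonneg (k := k + 1) (D := D) (f := fun x => φ (F x)) x
    set X := derivSum (k + 1) (F '' D) φ (F x)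
    set Y := derivSum (k + 1) D (fun x => φ (F x)) x
    constructor
    · have c1 : ∑ j, derivSum k D (fun x => φ' j (F x)) x ≤ 2 * (B * N) * X := by
        calc _ ≤ ∑ _j : Fin 2, B * (N * X) := Finset.sum_le_sum fun j _ =>
              ((a3 j).1).trans (mul_le_mul_of_nonneg_left (a4 j) hB)
          _ = _ := by simp; ring
      have c2 : ∀ i, derivSum k D
          (fun x => ∑ j, partialDeriv i (fun y => F y j) x * φ' j (F x)) x ≤
          B1 i * (2 * (B * N)) * X := fun i =>
        (a2 i).trans (by rw [mul_assoc]; exact mul_le_mul_of_nonneg_left c1 (hB1 i))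
      have c3 : Y ≤ R1 * X := by
        refine a1.trans ?_
        rw [mul_assoc]
        refine mul_le_mul_of_nonneg_left ?_ (by positivity)
        rw [add_mul, one_mul, Finset.sum_mul]
        exact add_le_add a5 (Finset.sum_le_sum fun i _ => c2 i)
      nlinarith [mul_nonneg hR2 d1]
    · have c1 : ∀ j, derivSum k (F '' D) (φ' j) (F x) ≤ B * (B2 j * (2 * N)) * Y := by
        intro j
        have e1 : derivSum k D (fun x => φ' j (F x)) x ≤ B2 j * (2 * N * Y) := by
          rw [derivSum_congr hD (hinv j)]
          refine (b2 j).trans (mul_le_mul_of_nonneg_left ?_ (hB2 j))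
          calc _ ≤ ∑ _i : Fin 2, N * Y := Finset.sum_le_sum fun i _ => b3 i
            _ = _ := by simp; ring
        refine ((a3 j).2).trans ?_
        calc _ ≤ B * (B2 j * (2 * N * Y)) := mul_le_mul_of_nonneg_left e1 hB
          _ = _ := by ring
      have c3 : X ≤ R2 * Y := by
        refine b1.trans ?_
        rw [mul_assoc]
        refine mul_le_mul_of_nonneg_left ?_ (by positivity)
        rw [add_mul, one_mul, Finset.sum_mul]
        exact add_le_add b4 (Finset.sum_le_sum fun i _ => c1 i)
      nlinarith [mul_nonneg hR1 d2]

lemma IsTransport.integrable_comp (h : IsTransport D F C) {g : Plane → ℝ}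
    (hg : Integrable g (volume.restrict (F '' D))) :
    Integrable (fun x => g (F x)) (volume.restrict D) := by
  refine ⟨h.aestronglyMeasurable_comp hg.aestronglyMeasurable, ?_⟩
  refine (h.lintegral_comp_le D subset_rfl h.isOpen.measurableSet fun y => ‖g y‖ₑ).trans_lt ?_
  exact ENNReal.mul_lt_top ENNReal.coe_lt_top hg.2

lemma IsTransport.integral_comp_le (h : IsTransport D F C) {g : Plane → ℝ} (h0 : ∀ y, 0 ≤ g y)
    (hg : Integrable g (volume.restrict (F '' D))) :
    ∫ x in D, g (F x) ≤ C * ∫ y in F '' D, g y ∧ ∫ y in F '' D, g y ≤ C * ∫ x in D, g (F x) := by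
  have hg' := h.integrable_comp hg
  have e1 := ofReal_integral_eq_lintegral_ofReal hg (Eventually.of_forall h0)
  have e2 := ofReal_integral_eq_lintegral_ofReal hg' (Eventually.of_forall fun x => h0 (F x))
  have p1 : 0 ≤ ∫ y in F '' D, g y := integral_nonneg h0
  have p2 : 0 ≤ ∫ x in D, g (F x) := integral_nonneg fun x => h0 (F x)
  have l1 := h.lintegral_comp_le D subset_rfl h.isOpen.measurableSet fun y => ENNReal.ofReal (g y)
  have l2 := h.lintegral_image_le fun y => ENNReal.ofReal (g y)
  rw [← e1, ← e2, ← ENNReal.ofReal_coe_nnreal, ← ENNReal.ofReal_mul C.coe_nonneg,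
    ENNReal.ofReal_le_ofReal_iff (by positivity)] at l1 l2
  exact ⟨l1, l2⟩

lemma MemSobolev.memLp_weakDeriv {f : Plane → ℝ} {α : ℕ × ℕ} (hD : IsOpen D)
    (h : MemSobolev k D f) (hα : α.1 + α.2 ≤ k) :
    MemLp (weakDeriv D α f) 2 (volume.restrict D) := by
  obtain ⟨g, hg, hL⟩ := h α hα
  exact hL.ae_eq (hg.weakDeriv_ae_eq hD).symm

lemma MemSobolev.integrable_derivSum_sq {f : Plane → ℝ} (hD : IsOpen D) (h : MemSobolev k D f) :
    Integrable (fun x => derivSum k D f x ^ 2) (volume.restrict D) := by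
  have : MemLp (derivSum k D f) 2 (volume.restrict D) :=
    memLp_finsetSum _ fun α hα => (h.memLp_weakDeriv hD (mem_multiIndices.1 hα)).abs
  exact this.integrable_sq

lemma MemSobolev.mono {f : Plane → ℝ} {l : ℕ} (h : MemSobolev k D f) (hl : l ≤ k) :
    MemSobolev l D f := fun α hα => h α (hα.trans hl)

/-- The Sobolev norm is equivalent to the `L²` norm of `derivSum`. -/
lemma MemSobolev.sobolevNorm_sq_bounds {f : Plane → ℝ} (hD : IsOpen D) (h : MemSobolev k D f) :
    sobolevNorm k D f ^ 2 ≤ (multiIndices k).card * ∫ x in D, derivSum k D f x ^ 2 ∧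
      ∫ x in D, derivSum k D f x ^ 2 ≤ (multiIndices k).card * sobolevNorm k D f ^ 2 := by
  have hint : ∀ α ∈ multiIndices k, Integrable (fun x => weakDeriv D α f x ^ 2)
      (volume.restrict D) := fun α hα =>
    (h.memLp_weakDeriv hD (mem_multiIndices.1 hα)).integrable_sq
  have hnorm : sobolevNorm k D f ^ 2 =
      ∑ α ∈ multiIndices k, ∫ x in D, weakDeriv D α f x ^ 2 :=
    Real.sq_sqrt (Finset.sum_nonneg fun α _ => integral_nonneg fun x => sq_nonneg _)
  rw [hnorm]
  constructor
  · rw [← nsmul_eq_mul]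
    refine Finset.sum_le_card_nsmul _ _ _ fun α hα => ?_
    refine integral_mono (hint α hα) (h.integrable_derivSum_sq hD) fun x => ?_
    simp only
    rw [← sq_abs]
    exact pow_le_pow_left₀ (abs_nonneg _)
      (abs_weakDeriv_le_derivSum (mem_multiIndices.1 hα) x) 2
  · rw [← integral_finsetSum _ hint, ← integral_const_mul]
    refine integral_mono (h.integrable_derivSum_sq hD)
      ((integrable_finsetSum _ hint).const_mul _) fun x => ?_
    have := sq_sum_le_card_mul_sum_sq (s := multiIndices k) (f := fun α => |weakDeriv D α f x|)
    simp only [sq_abs] at this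
    exact this

/-- Composition with `F` is an equivalence of Sobolev norms as soon as derivatives bound each other
pointwise. -/
lemma IsTransport.exists_sobolevNorm_comp (h : IsTransport D F C) {B : ℝ}
    (hk : ∀ φ, HasWeakDerivs k (F '' D) φ → HasWeakDerivs k D (fun x => φ (F x)) ∧
      ∀ᵐ x ∂(volume.restrict D),
        derivSum k D (fun x => φ (F x)) x ≤ B * derivSum k (F '' D) φ (F x) ∧
        derivSum k (F '' D) φ (F x) ≤ B * derivSum k D (fun x => φ (F x)) x) :
    ∃ R : ℝ, 0 ≤ R ∧ ∀ φ, MemSobolev k (F '' D) φ → MemSobolev k D (φ ∘ F) ∧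
      sobolevNorm k D (φ ∘ F) ≤ R * sobolevNorm k (F '' D) φ ∧
      sobolevNorm k (F '' D) φ ≤ R * sobolevNorm k D (φ ∘ F) := by
  set N : ℝ := ((multiIndices k).card : ℝ)
  refine ⟨Real.sqrt (N * (B ^ 2 * C * N)), Real.sqrt_nonneg _, fun φ hφ => ?_⟩
  have hD := h.isOpen
  have hΩ := h.isOpen_image
  obtain ⟨hW, hae⟩ := hk φ hφ.hasWeakDerivs
  have hint := hφ.integrable_derivSum_sq hΩ
  have hint' := h.integrable_comp hint
  have hmem : MemSobolev k D (φ ∘ F) := by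
    intro α hα
    refine ⟨_, hasWeakDeriv_weakDeriv (hW α hα), ?_⟩
    have hmeas : AEStronglyMeasurable (weakDeriv D α (fun x => φ (F x))) (volume.restrict D) :=
      (hasWeakDeriv_weakDeriv (hW α hα)).2.1.aestronglyMeasurable
    refine (memLp_two_iff_integrable_sq hmeas).2 ?_
    refine (hint'.const_mul (B ^ 2)).mono' (hmeas.pow 2) ?_
    filter_upwards [hae] with x hx
    have := (abs_weakDeriv_le_derivSum (D := D) (f := fun x => φ (F x)) hα x).trans hx.1
    rw [Real.norm_eq_abs, abs_of_nonneg (sq_nonneg _), ← mul_pow, ← sq_abs]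
    exact pow_le_pow_left₀ (abs_nonneg _) this 2
  obtain ⟨i1, i2⟩ := h.integral_comp_le (fun y => sq_nonneg (derivSum k (F '' D) φ y)) hint
  have hintD := hmem.integrable_derivSum_sq hD
  have j1 : ∫ x in D, derivSum k D (φ ∘ F) x ^ 2 ≤
      B ^ 2 * ∫ x in D, derivSum k (F '' D) φ (F x) ^ 2 := by
    rw [← integral_const_mul]
    refine integral_mono_ae hintD (hint'.const_mul _) ?_
    filter_upwards [hae] with x hx
    rw [← mul_pow]
    exact pow_le_pow_left₀ (derivSum_nonneg _) hx.1 2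
  have j2 : ∫ x in D, derivSum k (F '' D) φ (F x) ^ 2 ≤
      B ^ 2 * ∫ x in D, derivSum k D (φ ∘ F) x ^ 2 := by
    rw [← integral_const_mul]
    refine integral_mono_ae hint' (hintD.const_mul _) ?_
    filter_upwards [hae] with x hx
    rw [← mul_pow]
    exact pow_le_pow_left₀ (derivSum_nonneg _) hx.2 2
  obtain ⟨a1, a2⟩ := hφ.sobolevNorm_sq_bounds hΩ
  obtain ⟨b1, b2⟩ := hmem.sobolevNorm_sq_bounds hD
  have hsq : ∀ {a b : ℝ}, 0 ≤ b → a ^ 2 ≤ N * (B ^ 2 * C * N) * b ^ 2 →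
      a ≤ Real.sqrt (N * (B ^ 2 * C * N)) * b := by
    intro a b hb hab
    refine (le_abs_self a).trans ?_
    rw [← Real.sqrt_sq_eq_abs, ← Real.sqrt_sq hb, ← Real.sqrt_mul (by positivity)]
    exact Real.sqrt_le_sqrt hab
  refine ⟨hmem, hsq (Real.sqrt_nonneg _) ?_, hsq (Real.sqrt_nonneg _) ?_⟩
  · calc _ ≤ _ := b1
      _ ≤ N * (B ^ 2 * (C * (N * sobolevNorm k (F '' D) φ ^ 2))) := by
        refine mul_le_mul_of_nonneg_left (j1.trans ?_) (by positivity)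
        refine mul_le_mul_of_nonneg_left (i1.trans ?_) (by positivity)
        exact mul_le_mul_of_nonneg_left a2 (by positivity)
      _ = _ := by ring
  · calc _ ≤ _ := a1
      _ ≤ N * (C * (B ^ 2 * (N * sobolevNorm k D (φ ∘ F) ^ 2))) := by
        refine mul_le_mul_of_nonneg_left (i2.trans ?_) (by positivity)
        refine mul_le_mul_of_nonneg_left (j2.trans ?_) (by positivity)
        exact mul_le_mul_of_nonneg_left b2 (by positivity)
      _ = _ := by ring

end Transport

/-! ### Local diffeomorphisms with Lipschitz derivative on bounded convex domains -/

section Diffeo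

variable {D : Set Plane} {F : Plane → Plane} {p : ℕ}

lemma norm_le_abs_add_abs (v : Plane) : ‖v‖ ≤ |v 0| + |v 1| := by
  rw [EuclideanSpace.norm_eq, Fin.sum_univ_two]
  refine Real.sqrt_le_iff.2 ⟨by positivity, ?_⟩
  simp only [Real.norm_eq_abs]
  nlinarith [abs_nonneg (v 0), abs_nonneg (v 1)]

lemma abs_coord_le_norm (v : Plane) (i : Fin 2) : |v i| ≤ ‖v‖ := PiLp.norm_apply_le v i

lemma fderiv_coord_apply {x : Plane} (hF : DifferentiableAt ℝ F x) (v : Plane) (j : Fin 2) :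
    fderiv ℝ F x v j = ∑ i, v i * partialDeriv i (fun y => F y j) x := by
  rw [← fderiv_apply_eq_sum]
  have h : HasFDerivAt (fun y => F y j) ((EuclideanSpace.proj j : Plane →L[ℝ] ℝ).comp
      (fderiv ℝ F x)) x := (EuclideanSpace.proj j : Plane →L[ℝ] ℝ).hasFDerivAt.comp x hF.hasFDerivAt
  rw [h.fderiv]
  rfl

lemma det_fderiv {x : Plane} (hF : DifferentiableAt ℝ F x) : (fderiv ℝ F x).det =
    partialDeriv 0 (fun y => F y 0) x * partialDeriv 1 (fun y => F y 1) x -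
      partialDeriv 0 (fun y => F y 1) x * partialDeriv 1 (fun y => F y 0) x := by
  have h := LinearMap.det_toMatrix (EuclideanSpace.basisFun (Fin 2) ℝ).toBasis
    (fderiv ℝ F x : Plane →ₗ[ℝ] Plane)
  rw [ContinuousLinearMap.det, ← h, Matrix.det_fin_two]
  simp only [LinearMap.toMatrix_apply, OrthonormalBasis.coe_toBasis, EuclideanSpace.basisFun_apply,
    ContinuousLinearMap.coe_coe, OrthonormalBasis.coe_toBasis_repr_apply,
    EuclideanSpace.basisFun_repr, ← partialDeriv_coord hF]
  ring

/-- The entries of the inverse of the Jacobian matrix, by Cramer's rule. -/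
noncomputable def inverseJacobian (F : Plane → Plane) (j i : Fin 2) (x : Plane) : ℝ :=
  ((partialDeriv 0 (fun y => F y 0) x * partialDeriv 1 (fun y => F y 1) x +
      -(partialDeriv 0 (fun y => F y 1) x * partialDeriv 1 (fun y => F y 0) x)))⁻¹ *
    if j = i then partialDeriv (1 - i) (fun y => F y (1 - j)) x
    else -partialDeriv j (fun y => F y i) x

lemma isMultiplier_inverseJacobian (hD : IsOpen D) (hF : ∀ x ∈ D, DifferentiableAt ℝ F x)
    (hA : ∀ i j, IsMultiplier D p (partialDeriv i fun y => F y j))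
    {c : ℝ} (hc : 0 < c) (hdet : ∀ x ∈ D, c < (fderiv ℝ F x).det) (j i : Fin 2) :
    IsMultiplier D p (inverseJacobian F j i) := by
  have h1 := (((hA 0 0).mul hD (hA 1 1)).add hD (((hA 0 1).mul hD (hA 1 0)).neg hD)).inv hD hc
    fun x hx => by
      have := hdet x hx
      rw [det_fderiv (hF x hx)] at this
      linarith
  unfold inverseJacobian
  split_ifs
  · exact h1.mul hD (hA _ _)
  · exact h1.mul hD ((hA _ _).neg hD)

lemma sum_inverseJacobian_mul {x : Plane} (hF : DifferentiableAt ℝ F x)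
    (hdet : (fderiv ℝ F x).det ≠ 0)
    (j l : Fin 2) : ∑ i, inverseJacobian F j i x * partialDeriv i (fun y => F y l) x =
      if j = l then 1 else 0 := by
  rw [det_fderiv hF, sub_eq_add_neg] at hdet
  simp only [inverseJacobian, Fin.sum_univ_two]
  fin_cases j <;> fin_cases l <;> simp <;> field_simp <;> ring

lemma sum_fderiv_mul_inverseJacobian {x : Plane} (hF : DifferentiableAt ℝ F x)
    (hdet : (fderiv ℝ F x).det ≠ 0) (v : Plane) (i : Fin 2) :
    ∑ j, fderiv ℝ F x v j * inverseJacobian F j i x = v i := by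
  simp only [fderiv_coord_apply hF]
  rw [det_fderiv hF, sub_eq_add_neg] at hdet
  have key := mul_inv_cancel₀ hdet
  simp only [inverseJacobian, Fin.sum_univ_two]
  fin_cases i <;> simp
  · linear_combination v 0 * key
  · linear_combination v 1 * key

lemma IsMultiplier.exists_bound_lipschitz {m : Plane → ℝ} (h : IsMultiplier D (p + 1) m) :
    ∃ B : ℝ, 0 ≤ B ∧ (∀ x ∈ D, |m x| ≤ B) ∧ ∀ x ∈ D, ∀ y ∈ D, |m x - m y| ≤ B * ‖x - y‖ := by
  obtain ⟨⟨B, hB⟩, ⟨L, hL⟩, -⟩ := h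
  refine ⟨|B| + L, by positivity, fun x hx => (hB x hx).trans ?_, fun x hx y hy => ?_⟩
  · linarith [le_abs_self B, L.coe_nonneg]
  · have := hL.dist_le_mul x hx y hy
    rw [Real.dist_eq, dist_eq_norm] at this
    refine this.trans ?_
    gcongr
    linarith [abs_nonneg B]

lemma isOpen_image_of_det_ne_zero (hD : IsOpen D) (hF : ContDiffOn ℝ 1 F D)
    (hdet : ∀ x ∈ D, (fderiv ℝ F x).det ≠ 0) : IsOpen (F '' D) := by
  rw [isOpen_iff_mem_nhds]
  rintro _ ⟨x, hx, rfl⟩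
  have hs : HasStrictFDerivAt F (fderiv ℝ F x) x :=
    (hF.contDiffAt (hD.mem_nhds hx)).hasStrictFDerivAt one_ne_zero
  have hs' : HasStrictFDerivAt F
      (((fderiv ℝ F x).toContinuousLinearEquivOfDetNeZero (hdet x hx) :
        Plane ≃L[ℝ] Plane) : Plane →L[ℝ] Plane) x := by
    rwa [ContinuousLinearMap.coe_toContinuousLinearEquivOfDetNeZero]
  rw [← hs'.map_nhds_eq_of_equiv]
  exact image_mem_map (hD.mem_nhds hx)

/-- A map whose derivative is Lipschitz and has a bounded inverse is injective at a uniform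
scale. -/
lemma exists_injective_scale (hD : IsOpen D) (hconv : Convex ℝ D)
    (hF : ∀ x ∈ D, DifferentiableAt ℝ F x)
    (hA : ∀ i j, IsMultiplier D (p + 1) (partialDeriv i fun y => F y j))
    {c : ℝ} (hc : 0 < c) (hdet : ∀ x ∈ D, c < (fderiv ℝ F x).det) :
    ∃ δ : ℝ, 0 < δ ∧ ∀ x ∈ D, ∀ y ∈ D, ‖y - x‖ < δ → F x = F y → x = y := by
  choose L hL0 _ hL using fun i j => (hA i j).exists_bound_lipschitz
  choose B hB0 hB _ using fun j i =>
    (isMultiplier_inverseJacobian hD hF hA hc hdet j i).exists_bound_lipschitz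
  set Ls := ∑ j, ∑ i, L i j with hLs
  set Bs := ∑ i, ∑ j, B j i with hBs
  have hLs0 : 0 ≤ Ls := Finset.sum_nonneg fun j _ => Finset.sum_nonneg fun i _ => hL0 i j
  have hBs0 : 0 ≤ Bs := Finset.sum_nonneg fun j _ => Finset.sum_nonneg fun i _ => hB0 i j
  have hder : ∀ x ∈ D, ∀ z ∈ D, ‖fderiv ℝ F z - fderiv ℝ F x‖ ≤ Ls * ‖z - x‖ := by
    intro x hx z hz
    refine ContinuousLinearMap.opNorm_le_bound _ (by positivity) fun v => ?_
    refine (norm_le_abs_add_abs _).trans ?_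
    have hj : ∀ j, |(fderiv ℝ F z - fderiv ℝ F x) v j| ≤ (∑ i, L i j) * ‖z - x‖ * ‖v‖ := by
      intro j
      have : (fderiv ℝ F z - fderiv ℝ F x) v j = ∑ i, v i *
          (partialDeriv i (fun y => F y j) z - partialDeriv i (fun y => F y j) x) := by
        simp only [sub_apply, PiLp.sub_apply, fderiv_coord_apply (hF z hz),
          fderiv_coord_apply (hF x hx), mul_sub, Finset.sum_sub_distrib]
      rw [this, Finset.sum_mul, Finset.sum_mul]
      refine (Finset.abs_sum_le_sum_abs _ _).trans (Finset.sum_le_sum fun i _ => ?_)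
      rw [abs_mul, mul_comm]
      exact mul_le_mul (hL i j z hz x hx) (abs_coord_le_norm v i) (abs_nonneg _)
        (mul_nonneg (hL0 i j) (norm_nonneg _))
    calc _ ≤ _ := add_le_add (hj 0) (hj 1)
      _ = _ := by rw [hLs, Fin.sum_univ_two (fun j => ∑ i, L i j)]; ring
  refine ⟨1 / (Bs * Ls + 1), by positivity, fun x hx y hy hxy hFxy => ?_⟩
  have hseg : segment ℝ x y ⊆ D := hconv.segment_subset hx hy
  have hmv : ‖F y - F x - fderiv ℝ F x (y - x)‖ ≤ Ls * ‖y - x‖ * ‖y - x‖ := by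
    refine (convex_segment x y).norm_image_sub_le_of_norm_hasFDerivWithin_le'
      (fun z hz => (hF z (hseg hz)).hasFDerivAt.hasFDerivWithinAt) (fun z hz => ?_)
      (left_mem_segment ℝ x y) (right_mem_segment ℝ x y)
    refine (hder x hx z (hseg hz)).trans (mul_le_mul_of_nonneg_left ?_ hLs0)
    exact norm_sub_le_of_mem_segment hz
  rw [hFxy, sub_self, zero_sub, norm_neg] at hmv
  set v := y - x
  have hv : ∀ i, |v i| ≤ (∑ j, B j i) * ‖fderiv ℝ F x v‖ := by
    intro i
    conv_lhs => rw [← sum_fderiv_mul_inverseJacobian (hF x hx) (hc.trans (hdet x hx)).ne' v i]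
    rw [Finset.sum_mul]
    refine (Finset.abs_sum_le_sum_abs _ _).trans (Finset.sum_le_sum fun j _ => ?_)
    rw [abs_mul, mul_comm]
    exact mul_le_mul (hB j i x hx) (abs_coord_le_norm _ j) (abs_nonneg _) (hB0 j i)
  have hv2 : ‖v‖ ≤ Bs * (Ls * ‖v‖ * ‖v‖) := by
    calc ‖v‖ ≤ |v 0| + |v 1| := norm_le_abs_add_abs v
      _ ≤ Bs * ‖fderiv ℝ F x v‖ := by
        rw [hBs, Fin.sum_univ_two, add_mul]; exact add_le_add (hv 0) (hv 1)
      _ ≤ _ := mul_le_mul_of_nonneg_left hmv hBs0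
  have hv3 : v = 0 := by
    by_contra hne
    have hpos : 0 < ‖v‖ := norm_pos_iff.2 hne
    rw [lt_div_iff₀ (by positivity)] at hxy
    nlinarith
  exact (sub_eq_zero.1 hv3).symm

/-- The change of variables formula, applied on the pieces of a finite cover of `D` by sets on
which `F` is injective. -/
lemma exists_isTransport (hD : IsOpen D) (hconv : Convex ℝ D) (hbdd : Bornology.IsBounded D)
    (hF : ContDiffOn ℝ 1 F D)
    (hA : ∀ i j, IsMultiplier D (p + 1) (partialDeriv i fun y => F y j))
    {c : ℝ} (hc : 0 < c) (hdet : ∀ x ∈ D, c < (fderiv ℝ F x).det) :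
    ∃ C, IsTransport D F C := by
  have hd : ∀ x ∈ D, DifferentiableAt ℝ F x := fun x hx =>
    (hF.contDiffAt (hD.mem_nhds hx)).differentiableAt one_ne_zero
  obtain ⟨δ, hδ, hinj⟩ := exists_injective_scale hD hconv hd hA hc hdet
  obtain ⟨t, ht, hcov⟩ := Metric.totallyBounded_iff.1
    (hbdd.isCompact_closure.totallyBounded.subset subset_closure) (δ / 2) (by positivity)
  have : Fintype t := ht.fintype
  choose B hB0 hB _ using fun i j => (hA i j).exists_bound_lipschitz
  set M := B 0 0 * B 1 1 + B 0 1 * B 1 0 with hM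
  have hM0 : 0 ≤ M := add_nonneg (mul_nonneg (hB0 _ _) (hB0 _ _)) (mul_nonneg (hB0 _ _) (hB0 _ _))
  have hdetM : ∀ x ∈ D, |(fderiv ℝ F x).det| ≤ M := fun x hx => by
    rw [det_fderiv (hd x hx)]
    refine (abs_sub _ _).trans ?_
    rw [abs_mul, abs_mul]
    exact add_le_add (mul_le_mul (hB _ _ x hx) (hB _ _ x hx) (abs_nonneg _) (hB0 _ _))
      (mul_le_mul (hB _ _ x hx) (hB _ _ x hx) (abs_nonneg _) (hB0 _ _))
  have hcv : ∀ A ⊆ D, MeasurableSet A → ∀ (y : t) (h : Plane → ENNReal),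
      ∫⁻ z in F '' (A ∩ Metric.ball y (δ / 2)), h z =
        ∫⁻ x in A ∩ Metric.ball y (δ / 2), ENNReal.ofReal |(fderiv ℝ F x).det| * h (F x) := by
    intro A hAD hAm y h
    refine lintegral_image_eq_lintegral_abs_det_fderiv_mul volume
      (hAm.inter measurableSet_ball)
      (fun x hx => (hd x (hAD hx.1)).hasFDerivAt.hasFDerivWithinAt) (fun x hx z hz hxz => ?_) h
    refine hinj x (hAD hx.1) z (hAD hz.1) ?_ hxz
    rw [← dist_eq_norm]
    calc dist z x ≤ dist z y + dist x y := dist_triangle_right _ _ _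
      _ < δ := by linarith [Metric.mem_ball.1 hx.2, Metric.mem_ball.1 hz.2]
  have hcovA : ∀ A ⊆ D, A = ⋃ y : t, A ∩ Metric.ball y (δ / 2) := by
    intro A hAD
    rw [← inter_iUnion]
    refine (inter_eq_left.2 ?_).symm
    rw [iUnion_subtype]
    exact hAD.trans hcov
  have hcard : ∀ (a : ENNReal), ∑' _ : t, a = Fintype.card t * a := fun a => by
    rw [tsum_fintype, Finset.sum_const, Finset.card_univ, nsmul_eq_mul]
  set m : NNReal := (Fintype.card t : NNReal)
  refine ⟨m * (Real.toNNReal c)⁻¹ + m * Real.toNNReal M, hD,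
    isOpen_image_of_det_ne_zero hD hF fun x hx => (hc.trans (hdet x hx)).ne', hF, ?_, ?_⟩
  · intro A hAD hAm h
    have hc0 : Real.toNNReal c ≠ 0 := (Real.toNNReal_pos.2 hc).ne'
    have hpiece : ∀ y : t, ∫⁻ x in A ∩ Metric.ball y (δ / 2), h (F x) ≤
        ((Real.toNNReal c)⁻¹ : NNReal) * ∫⁻ y in F '' A, h y := by
      intro y
      calc _ ≤ ∫⁻ x in A ∩ Metric.ball y (δ / 2), ((Real.toNNReal c)⁻¹ : NNReal) *
            (ENNReal.ofReal |(fderiv ℝ F x).det| * h (F x)) := by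
            refine setLIntegral_mono' (hAm.inter measurableSet_ball) fun x hx => ?_
            rw [← mul_assoc]
            refine le_mul_of_one_le_left zero_le ?_
            have h1 : (Real.toNNReal c : ENNReal) ≤ ENNReal.ofReal |(fderiv ℝ F x).det| :=
              ENNReal.ofReal_le_ofReal ((hdet x (hAD hx.1)).le.trans (le_abs_self _))
            calc (1 : ENNReal) = ((Real.toNNReal c)⁻¹ : NNReal) * (Real.toNNReal c : ENNReal) := by
                  rw [← ENNReal.coe_mul, inv_mul_cancel₀ hc0, ENNReal.coe_one]
              _ ≤ _ := by gcongr
        _ = ((Real.toNNReal c)⁻¹ : NNReal) * ∫⁻ z in F '' (A ∩ Metric.ball y (δ / 2)), h z := by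
            rw [hcv A hAD hAm, lintegral_const_mul' _ _ ENNReal.coe_ne_top]
        _ ≤ _ := by
            gcongr
            exact inter_subset_left
    calc ∫⁻ x in A, h (F x) = ∫⁻ x in ⋃ y : t, A ∩ Metric.ball y (δ / 2), h (F x) := by
          rw [← hcovA A hAD]
      _ ≤ ∑' y : t, ∫⁻ x in A ∩ Metric.ball y (δ / 2), h (F x) := lintegral_iUnion_le _ _
      _ ≤ ∑' _ : t, ((Real.toNNReal c)⁻¹ : NNReal) * ∫⁻ y in F '' A, h y :=
          ENNReal.tsum_le_tsum hpiece
      _ = ((m * (Real.toNNReal c)⁻¹ : NNReal) : ENNReal) * ∫⁻ y in F '' A, h y := by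
          rw [hcard, ENNReal.coe_mul, mul_assoc]
          simp [m]
      _ ≤ _ := by
          gcongr
          exact le_self_add
  · intro h
    have hpiece : ∀ y : t, ∫⁻ z in F '' (D ∩ Metric.ball y (δ / 2)), h z ≤
        (Real.toNNReal M : ENNReal) * ∫⁻ x in D, h (F x) := by
      intro y
      rw [hcv D subset_rfl hD.measurableSet, ← lintegral_const_mul' _ _ ENNReal.coe_ne_top]
      refine (setLIntegral_mono' (hD.measurableSet.inter measurableSet_ball)
        (g := fun x => (Real.toNNReal M : ENNReal) * h (F x)) fun x hx => ?_).trans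
        (lintegral_mono_set inter_subset_left)
      gcongr
      exact ENNReal.ofReal_le_ofReal (hdetM x hx.1)
    calc ∫⁻ y in F '' D, h y = ∫⁻ z in ⋃ y : t, F '' (D ∩ Metric.ball y (δ / 2)), h z := by
          rw [← image_iUnion, ← hcovA D subset_rfl]
      _ ≤ ∑' y : t, ∫⁻ z in F '' (D ∩ Metric.ball y (δ / 2)), h z := lintegral_iUnion_le _ _
      _ ≤ ∑' _ : t, (Real.toNNReal M : ENNReal) * ∫⁻ x in D, h (F x) :=
          ENNReal.tsum_le_tsum hpiece
      _ = ((m * Real.toNNReal M : NNReal) : ENNReal) * ∫⁻ x in D, h (F x) := by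
          rw [hcard, ENNReal.coe_mul, mul_assoc]
          simp [m]
      _ ≤ _ := by
          gcongr
          exact le_add_self

end Diffeo

/-! ### Rational functions of `u` and `v / u` -/

section Rational

open Polynomial

/-- The value of the bivariate polynomial `N` (outer variable `s`, inner variable `t`) at
`s = u`, `t = v / u`, as a function of the point `(u, v)`. -/
noncomputable def polarEval (N : ℝ[X][X]) (x : Plane) : ℝ := N.evalEval (x 1 / x 0) (x 0)

lemma continuous_evalEval (N : ℝ[X][X]) : Continuous fun q : ℝ × ℝ => N.evalEval q.1 q.2 := by
  induction N using Polynomial.induction_on with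
  | C a =>
    simp only [evalEval_C]
    exact a.continuous.comp continuous_fst
  | add p q hp hq =>
    simp only [evalEval_add]
    exact hp.add hq
  | monomial n a _ =>
    simp only [evalEval_mul, evalEval_pow, evalEval_C, evalEval_X]
    exact (a.continuous.comp continuous_fst).mul (continuous_snd.pow (n + 1))

lemma hasFDerivAt_coord (i : Fin 2) (x : Plane) :
    HasFDerivAt (fun y : Plane => y i) (EuclideanSpace.proj i : Plane →L[ℝ] ℝ) x :=
  (EuclideanSpace.proj i : Plane →L[ℝ] ℝ).hasFDerivAt

lemma partialDeriv_coord_fun (i j : Fin 2) (x : Plane) :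
    partialDeriv i (fun y : Plane => y j) x = if i = j then 1 else 0 := by
  rw [partialDeriv, (hasFDerivAt_coord j x).fderiv]
  simp [eq_comm]

lemma differentiableAt_coord (i : Fin 2) (x : Plane) :
    DifferentiableAt ℝ (fun y : Plane => y i) x := (hasFDerivAt_coord i x).differentiableAt

lemma partialDeriv_pow {g : Plane → ℝ} {x : Plane} (hg : DifferentiableAt ℝ g x) (h0 : g x ≠ 0)
    (i : Fin 2) (k : ℕ) :
    partialDeriv i (fun y => g y ^ k) x = k * g x ^ k * partialDeriv i g x / g x := by
  rcases k with _ | k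
  · simp [partialDeriv]
  · have h := (hg.hasFDerivAt.pow (k + 1)).fderiv
    rw [partialDeriv, h]
    simp only [Nat.add_sub_cancel, smul_eq_mul, FunLike.coe_smul, Pi.smul_apply, partialDeriv,
      nsmul_eq_mul]
    field_simp
    ring

lemma partialDeriv_congr_of_eventuallyEq {f g : Plane → ℝ} {x : Plane} (i : Fin 2)
    (h : f =ᶠ[𝓝 x] g) : partialDeriv i f x = partialDeriv i g x := by
  rw [partialDeriv, partialDeriv, h.fderiv_eq]

/-- In polar form, `∂_u = ∂_s - (t / s) ∂_t` and `∂_v = (1 / s) ∂_t`. -/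
lemma exists_partialDeriv_polarEval (N : ℝ[X][X]) : ∃ Ns Nt : ℝ[X][X], ∀ x : Plane, x 0 ≠ 0 →
    DifferentiableAt ℝ (polarEval N) x ∧
    partialDeriv 0 (polarEval N) x =
      polarEval Ns x - x 1 / x 0 / x 0 * polarEval Nt x ∧
    partialDeriv 1 (polarEval N) x = polarEval Nt x / x 0 := by
  have hC : ∀ a : ℝ[X], ∀ x : Plane, x 0 ≠ 0 →
      DifferentiableAt ℝ (polarEval (C a)) x ∧
      partialDeriv 0 (polarEval (C a)) x =
        - (x 1 / x 0 / x 0 * polarEval (C (derivative a)) x) ∧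
      partialDeriv 1 (polarEval (C a)) x = polarEval (C (derivative a)) x / x 0 := by
    intro a x hx
    have e : polarEval (C a) = fun y : Plane => a.eval (y 1 * (y 0)⁻¹) := by
      funext y
      simp [polarEval, evalEval_C, div_eq_mul_inv]
    have hd0 := differentiableAt_coord 0 x
    have hinv : DifferentiableAt ℝ (fun y : Plane => (y 0)⁻¹) x := hd0.inv hx
    have hdiv : DifferentiableAt ℝ (fun y : Plane => y 1 * (y 0)⁻¹) x :=
      (differentiableAt_coord 1 x).mul hinv
    have h' : HasFDerivAt (polarEval (C a)) (a.derivative.eval (x 1 * (x 0)⁻¹) •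
        fderiv ℝ (fun y : Plane => y 1 * (y 0)⁻¹) x) x := by
      rw [e]
      exact (a.hasDerivAt (x 1 * (x 0)⁻¹)).comp_hasFDerivAt x hdiv.hasFDerivAt
    have hp : ∀ i, partialDeriv i (polarEval (C a)) x =
        a.derivative.eval (x 1 * (x 0)⁻¹) * partialDeriv i (fun y : Plane => y 1 * (y 0)⁻¹) x := by
      intro i
      rw [partialDeriv, h'.fderiv]
      rfl
    refine ⟨h'.differentiableAt, ?_, ?_⟩
    · rw [hp, partialDeriv_mul (differentiableAt_coord 1 x) hinv, partialDeriv_inv hd0 hx,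
        partialDeriv_coord_fun, partialDeriv_coord_fun]
      simp [polarEval, evalEval_C, div_eq_mul_inv]
      ring
    · rw [hp, partialDeriv_mul (differentiableAt_coord 1 x) hinv, partialDeriv_inv hd0 hx,
        partialDeriv_coord_fun, partialDeriv_coord_fun]
      simp [polarEval, evalEval_C, div_eq_mul_inv]
  induction N using Polynomial.induction_on with
  | C a =>
    refine ⟨0, C (derivative a), fun x hx => ?_⟩
    obtain ⟨h1, h2, h3⟩ := hC a x hx
    refine ⟨h1, ?_, h3⟩
    rw [h2]
    simp [polarEval, evalEval_C]
  | add p q hp hq =>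
    obtain ⟨ps, pt, hp⟩ := hp
    obtain ⟨qs, qt, hq⟩ := hq
    refine ⟨ps + qs, pt + qt, fun x hx => ?_⟩
    obtain ⟨p1, p2, p3⟩ := hp x hx
    obtain ⟨q1, q2, q3⟩ := hq x hx
    have e : ∀ a b : ℝ[X][X], polarEval (a + b) = fun y => polarEval a y + polarEval b y := by
      intro a b; funext y; simp [polarEval]
    simp only [e]
    refine ⟨p1.add q1, ?_, ?_⟩
    · rw [partialDeriv_add p1 q1, p2, q2]; ring
    · rw [partialDeriv_add p1 q1, p3, q3]; ring
  | monomial n a _ =>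
    refine ⟨C a * (C (C ((n + 1 : ℕ) : ℝ)) * X ^ n), C (derivative a) * X ^ (n + 1),
      fun x hx => ?_⟩
    obtain ⟨h1, h2, h3⟩ := hC a x hx
    have e : ∀ b : ℝ[X], polarEval (C b * X ^ (n + 1)) =
        fun y => polarEval (C b) y * y 0 ^ (n + 1) := by
      intro b; funext y; simp [polarEval, evalEval_C]
    have hd0 := differentiableAt_coord 0 x
    have e2 : polarEval (C a * (C (C ((n + 1 : ℕ) : ℝ)) * X ^ n)) x =
        polarEval (C a) x * ((n + 1 : ℕ) * x 0 ^ n) := by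
      simp [polarEval, evalEval_C]
    have hpow : DifferentiableAt ℝ (fun y : Plane => y 0 ^ (n + 1)) x := hd0.pow _
    rw [e, e, e2]
    refine ⟨h1.mul hpow, ?_, ?_⟩
    · rw [partialDeriv_mul h1 hpow, h2, partialDeriv_pow hd0 hx, partialDeriv_coord_fun]
      simp only [if_true]
      field_simp
      ring
    · rw [partialDeriv_mul h1 hpow, h3, partialDeriv_pow hd0 hx, partialDeriv_coord_fun]
      simp
      ring

/-- The partial derivatives of `N / (sᵏ wᵐ)`, with `s = u` and `N`, `w` polynomials in `s = u` and
`t = v / u`, are of the same form with `k` and `m` increased by one. -/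
lemma exists_partialDeriv_rational {U : Set Plane} (hU : IsOpen U) {w : ℝ[X][X]}
    (h0 : ∀ x ∈ U, x 0 ≠ 0) (hw : ∀ x ∈ U, polarEval w x ≠ 0) {k m : ℕ} {N : ℝ[X][X]}
    {f : Plane → ℝ} (hf : ∀ x ∈ U, f x = polarEval N x / (x 0 ^ k * polarEval w x ^ m))
    (i : Fin 2) : (∀ x ∈ U, DifferentiableAt ℝ f x) ∧ ∃ N' : ℝ[X][X], ∀ x ∈ U,
      partialDeriv i f x = polarEval N' x / (x 0 ^ (k + 1) * polarEval w x ^ (m + 1)) := by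
  obtain ⟨Ns, Nt, hN⟩ := exists_partialDeriv_polarEval N
  obtain ⟨ws, wt, hw'⟩ := exists_partialDeriv_polarEval w
  have hev : ∀ x ∈ U, f =ᶠ[𝓝 x]
      fun y => polarEval N y * (y 0 ^ k * polarEval w y ^ m)⁻¹ := by
    intro x hx
    filter_upwards [hU.mem_nhds hx] with y hy
    rw [hf y hy, div_eq_mul_inv]
  have hden : ∀ x ∈ U, DifferentiableAt ℝ (fun y : Plane => y 0 ^ k * polarEval w y ^ m) x :=
    fun x hx => ((differentiableAt_coord 0 x).pow k).mul ((hw' x (h0 x hx)).1.pow m)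
  have hdinv : ∀ x ∈ U, x 0 ^ k * polarEval w x ^ m ≠ 0 →
      DifferentiableAt ℝ (fun y : Plane => (y 0 ^ k * polarEval w y ^ m)⁻¹) x :=
    fun x hx h => (hden x hx).inv h
  have hne : ∀ x ∈ U, x 0 ^ k * polarEval w x ^ m ≠ 0 := fun x hx =>
    mul_ne_zero (pow_ne_zero _ (h0 x hx)) (pow_ne_zero _ (hw x hx))
  have hpd : ∀ x ∈ U, ∀ i, partialDeriv i f x =
      (partialDeriv i (polarEval N) x - polarEval N x * (k * (if i = 0 then 1 else 0) / x 0 +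
        m * partialDeriv i (polarEval w) x / polarEval w x)) /
        (x 0 ^ k * polarEval w x ^ m) := by
    intro x hx i
    have hx0 := h0 x hx
    have hxw := hw x hx
    have hdw := (hw' x hx0).1
    have hp1 : DifferentiableAt ℝ (fun y : Plane => y 0 ^ k) x := (differentiableAt_coord 0 x).pow k
    have hp2 : DifferentiableAt ℝ (fun y : Plane => polarEval w y ^ m) x := hdw.pow m
    rw [partialDeriv_congr_of_eventuallyEq i (hev x hx),
      partialDeriv_mul (hN x hx0).1 (hdinv x hx (hne x hx)),
      partialDeriv_inv (hden x hx) (hne x hx),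
      partialDeriv_mul hp1 hp2,
      partialDeriv_pow (differentiableAt_coord 0 x) hx0, partialDeriv_pow hdw hxw,
      partialDeriv_coord_fun]
    field_simp
    ring
  refine ⟨fun x hx => ((hev x hx).differentiableAt_iff).2
    ((hN x (h0 x hx)).1.mul (hdinv x hx (hne x hx))), ?_⟩
  have hnum : i = 0 ∨ i = 1 := by fin_cases i <;> simp
  rcases hnum with rfl | rfl
  · refine ⟨(X * Ns - C X * Nt - C (C (k : ℝ)) * N) * w -
      C (C (m : ℝ)) * N * (X * ws - C X * wt), fun x hx => ?_⟩
    have hx0 := h0 x hx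
    have hxw := hw x hx
    rw [hpd x hx, (hN x hx0).2.1, (hw' x hx0).2.1]
    have : polarEval ((X * Ns - C X * Nt - C (C (k : ℝ)) * N) * w -
        C (C (m : ℝ)) * N * (X * ws - C X * wt)) x =
        (x 0 * polarEval Ns x - x 1 / x 0 * polarEval Nt x - k * polarEval N x) * polarEval w x -
        m * polarEval N x * (x 0 * polarEval ws x - x 1 / x 0 * polarEval wt x) := by
      simp [polarEval, evalEval_C]
    rw [this]
    simp only [if_true]
    field_simp
    ring
  · refine ⟨Nt * w - C (C (m : ℝ)) * N * wt, fun x hx => ?_⟩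
    have hx0 := h0 x hx
    have hxw := hw x hx
    rw [hpd x hx, (hN x hx0).2.2, (hw' x hx0).2.2]
    have : polarEval (Nt * w - C (C (m : ℝ)) * N * wt) x =
        polarEval Nt x * polarEval w x - m * polarEval N x * polarEval wt x := by
      simp [polarEval]
    rw [this]
    simp only [one_ne_zero, if_false]
    field_simp
    ring

/-- Each differentiation raises the power of `s = u` and that of the denominator `w` by one. -/
lemma exists_multiDeriv_rational {U : Set Plane} (hU : IsOpen U) {w : ℝ[X][X]}
    (h0 : ∀ x ∈ U, x 0 ≠ 0) (hw : ∀ x ∈ U, polarEval w x ≠ 0) {N : ℝ[X][X]} {f : Plane → ℝ}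
    (hf : ∀ x ∈ U, f x = polarEval N x / polarEval w x) (α : ℕ × ℕ) :
    ∃ N' : ℝ[X][X], ∀ x ∈ U, multiDeriv α f x =
      polarEval N' x / (x 0 ^ (α.1 + α.2) * polarEval w x ^ (α.1 + α.2 + 1)) := by
  have iter : ∀ (i : Fin 2) (a k : ℕ) (N : ℝ[X][X]) (g : Plane → ℝ),
      (∀ x ∈ U, g x = polarEval N x / (x 0 ^ k * polarEval w x ^ (k + 1))) →
      ∃ N' : ℝ[X][X], ∀ x ∈ U, (partialDeriv i)^[a] g x =
        polarEval N' x / (x 0 ^ (a + k) * polarEval w x ^ (a + k + 1)) := by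
    intro i a k N g hg
    induction a with
    | zero => exact ⟨N, by simpa using hg⟩
    | succ a ih =>
      obtain ⟨N1, h1⟩ := ih
      obtain ⟨-, N2, h2⟩ := exists_partialDeriv_rational hU h0 hw h1 i
      refine ⟨N2, fun x hx => ?_⟩
      rw [Function.iterate_succ_apply', h2 x hx]
      congr 3 <;> ring
  obtain ⟨N1, h1⟩ := iter 1 α.2 0 N f (by simpa using hf)
  exact iter 0 α.1 α.2 N1 _ (by simpa using h1)

/-- A polynomial in `s` that is `o(s ^ p)` at the origin is divisible by `s ^ (p + 1)`. -/
lemma X_pow_dvd_of_tendsto {q : ℝ[X]} {p : ℕ}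
    (h : Tendsto (fun s => q.eval s / s ^ p) (𝓝[>] 0) (𝓝 0)) : X ^ (p + 1) ∣ q := by
  induction p with
  | zero =>
    have h2 : Tendsto (fun s => q.eval s) (𝓝[>] 0) (𝓝 (q.eval 0)) :=
      (q.continuous.tendsto 0).mono_left nhdsWithin_le_nhds
    have h3 := tendsto_nhds_unique h2 (by simpa using h)
    rw [zero_add, pow_one, X_dvd_iff, coeff_zero_eq_eval_zero, h3]
  | succ p ih =>
    have hs : Tendsto (fun s : ℝ => s) (𝓝[>] 0) (𝓝 0) := tendsto_id.mono_left nhdsWithin_le_nhds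
    have h1 : Tendsto (fun s => q.eval s / s ^ p) (𝓝[>] 0) (𝓝 0) := by
      have := h.mul hs
      rw [mul_zero] at this
      refine this.congr' ?_
      filter_upwards [self_mem_nhdsWithin] with s (hs : 0 < s)
      rw [pow_succ]
      field_simp
    obtain ⟨r, rfl⟩ := ih h1
    have h2 : Tendsto (fun s => r.eval s) (𝓝[>] 0) (𝓝 0) := by
      refine h.congr' ?_
      filter_upwards [self_mem_nhdsWithin] with s (hs : 0 < s)
      simp
      field_simp
    have h3 : Tendsto (fun s => r.eval s) (𝓝[>] 0) (𝓝 (r.eval 0)) :=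
      (r.continuous.tendsto 0).mono_left nhdsWithin_le_nhds
    have h4 := tendsto_nhds_unique h3 h2
    rw [pow_succ X (p + 1)]
    exact mul_dvd_mul_left _ (by rw [X_dvd_iff, coeff_zero_eq_eval_zero, h4])

/-- The coefficients of `N` with respect to `s` are polynomials in `t`, which vanish if they do so
for infinitely many `t`. -/
lemma X_pow_dvd_of_tendsto_evalEval {N : ℝ[X][X]} {p : ℕ} {J : Set ℝ} (hJ : J.Infinite)
    (h : ∀ t ∈ J, Tendsto (fun s => N.evalEval t s / s ^ p) (𝓝[>] 0) (𝓝 0)) :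
    X ^ (p + 1) ∣ N := by
  rw [X_pow_dvd_iff]
  intro d hd
  refine eq_zero_of_infinite_isRoot _ (hJ.mono fun t ht => ?_)
  have h1 : Tendsto (fun s => (N.map (evalRingHom t)).eval s / s ^ p) (𝓝[>] 0) (𝓝 0) := by
    simpa [map_evalRingHom_eval] using h t ht
  have h2 := X_pow_dvd_iff.1 (X_pow_dvd_of_tendsto h1) d hd
  simpa [coeff_map] using h2

/-- A function of the form `l + u M(u, v / u) / W(u, v / u)`, with `W` free of zeros on a compact
box, has bounded partial derivatives: differentiating `v / u` costs a factor `1 / u`, which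
the prefactor `u` absorbs. -/
lemma exists_bound_partialDeriv {U : Set Plane} (hU : IsOpen U) (h0 : ∀ x ∈ U, x 0 ≠ 0)
    {Q : Set (ℝ × ℝ)} (hQ : IsCompact Q) (hUQ : ∀ x ∈ U, (x 1 / x 0, x 0) ∈ Q)
    {M W : ℝ[X][X]} (hW : ∀ q ∈ Q, W.evalEval q.1 q.2 ≠ 0) {l : ℝ} {f : Plane → ℝ}
    (hf : ∀ x ∈ U, f x = l + x 0 * polarEval M x / polarEval W x) :
    ∃ B : ℝ, ∀ x ∈ U, DifferentiableAt ℝ f x ∧ ∀ i, |partialDeriv i f x| ≤ B := by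
  have hwU : ∀ x ∈ U, polarEval W x ≠ 0 := fun x hx => hW _ (hUQ x hx)
  obtain ⟨Ms, Mt, hM⟩ := exists_partialDeriv_polarEval M
  obtain ⟨Ws, Wt, hW'⟩ := exists_partialDeriv_polarEval W
  have hbound : ∀ N : ℝ[X][X], ∃ B : ℝ, ∀ x ∈ U, |polarEval N x / polarEval W x ^ 2| ≤ B := by
    intro N
    have hc : ContinuousOn (fun q : ℝ × ℝ => N.evalEval q.1 q.2 / W.evalEval q.1 q.2 ^ 2) Q :=
      (continuous_evalEval N).continuousOn.div ((continuous_evalEval W).pow 2).continuousOn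
        fun q hq => pow_ne_zero _ (hW q hq)
    obtain ⟨B, hB⟩ := hQ.exists_bound_of_continuousOn hc
    exact ⟨B, fun x hx => hB _ (hUQ x hx)⟩
  obtain ⟨B0, hB0⟩ := hbound (M * W + X * (Ms * W - M * Ws) - C X * (Mt * W - M * Wt))
  obtain ⟨B1, hB1⟩ := hbound (Mt * W - M * Wt)
  refine ⟨max B0 B1, fun x hx => ?_⟩
  have hx0 := h0 x hx
  have hxW := hwU x hx
  have hd0 := differentiableAt_coord 0 x
  obtain ⟨m1, m2, m3⟩ := hM x hx0
  obtain ⟨w1, w2, w3⟩ := hW' x hx0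
  have hev : f =ᶠ[𝓝 x] fun y => l + y 0 * polarEval M y * (polarEval W y)⁻¹ := by
    filter_upwards [hU.mem_nhds hx] with y hy
    rw [hf y hy, div_eq_mul_inv]
  have hdm : DifferentiableAt ℝ (fun y : Plane => y 0 * polarEval M y) x := hd0.mul m1
  have hdi : DifferentiableAt ℝ (fun y => (polarEval W y)⁻¹) x := w1.inv hxW
  have hdd : DifferentiableAt ℝ (fun y : Plane => y 0 * polarEval M y * (polarEval W y)⁻¹) x :=
    hdm.mul hdi
  have hp : ∀ i, partialDeriv i f x = x 0 * polarEval M x *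
      -((polarEval W x)⁻¹ * (polarEval W x)⁻¹ * partialDeriv i (polarEval W) x) +
      (x 0 * partialDeriv i (polarEval M) x + (if i = 0 then 1 else 0) * polarEval M x) *
        (polarEval W x)⁻¹ := by
    intro i
    rw [partialDeriv_congr_of_eventuallyEq i hev,
      partialDeriv_add (differentiableAt_const l) hdd, partialDeriv_mul hdm hdi,
      partialDeriv_mul hd0 m1, partialDeriv_inv w1 hxW, partialDeriv_coord_fun]
    simp [partialDeriv]
  refine ⟨(hev.differentiableAt_iff).2 (hdd.const_add l), fun i => ?_⟩
  have hi : i = 0 ∨ i = 1 := by fin_cases i <;> simp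
  rcases hi with rfl | rfl
  · refine le_trans (le_of_eq ?_) ((hB0 x hx).trans (le_max_left _ _))
    congr 1
    have : polarEval (M * W + X * (Ms * W - M * Ws) - C X * (Mt * W - M * Wt)) x =
        polarEval M x * polarEval W x + x 0 * (polarEval Ms x * polarEval W x -
        polarEval M x * polarEval Ws x) - x 1 / x 0 * (polarEval Mt x * polarEval W x -
        polarEval M x * polarEval Wt x) := by
      simp [polarEval, evalEval_C]
    rw [hp, this, m2, w2]
    simp only [if_true]
    field_simp
    ring
  · refine le_trans (le_of_eq ?_) ((hB1 x hx).trans (le_max_right _ _))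
    congr 1
    have : polarEval (Mt * W - M * Wt) x = polarEval Mt x * polarEval W x -
        polarEval M x * polarEval Wt x := by
      simp [polarEval]
    rw [hp, this, m3, w3]
    simp only [one_ne_zero, if_false]
    field_simp
    ring

end Rational

/-! ### NURBS maps on the images of the mesh cells -/

section Cells

open Polynomial

variable {p n : ℕ}

/-- Every knot lies to the left or to the right of the `a`-th mesh interval. -/
lemma knot_le_or_le (p : ℕ) {n a : ℕ} (ha : a < 2 ^ n) (j : ℕ) :
    knot p n j ≤ a / 2 ^ n ∨ ((a : ℝ) + 1) / 2 ^ n ≤ knot p n j := by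
  have h2 : (0 : ℝ) < 2 ^ n := by positivity
  have ha' : (a : ℝ) + 1 ≤ 2 ^ n := by exact_mod_cast ha
  unfold knot
  rcases Nat.lt_or_ge (p + a) j with h | h
  · right
    have : (p : ℝ) + a + 1 ≤ j := by exact_mod_cast h
    refine le_max_of_le_right (le_min ?_ ?_)
    · rwa [div_le_one h2]
    · gcongr; linarith
  · left
    have : (j : ℝ) ≤ p + a := by exact_mod_cast h
    refine max_le (by positivity) (min_le_of_right_le ?_)
    gcongr; linarith

/-- On an open mesh interval a B-spline is a polynomial. -/
lemma exists_polynomial_coxDeBoor (p : ℕ) {n a : ℕ} (ha : a < 2 ^ n) (q i : ℕ) :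
    ∃ P : ℝ[X], ∀ s : ℝ, (a : ℝ) / 2 ^ n < s → s < ((a : ℝ) + 1) / 2 ^ n →
      coxDeBoor (knot p n) q i s = P.eval s := by
  induction q generalizing i with
  | zero =>
    by_cases h : knot p n i ≤ a / 2 ^ n ∧ ((a : ℝ) + 1) / 2 ^ n ≤ knot p n (i + 1)
    · refine ⟨1, fun s h1 h2 => ?_⟩
      rw [coxDeBoor, if_pos ⟨h.1.trans h1.le, h2.trans_le h.2⟩, eval_one]
    · refine ⟨0, fun s h1 h2 => ?_⟩
      rw [coxDeBoor, if_neg, eval_zero]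
      rintro ⟨h3, h4⟩
      refine h ⟨(knot_le_or_le p ha i).resolve_right fun h5 => ?_,
        (knot_le_or_le p ha (i + 1)).resolve_left fun h5 => ?_⟩ <;> linarith
  | succ q ih =>
    obtain ⟨P, hP⟩ := ih i
    obtain ⟨Q, hQ⟩ := ih (i + 1)
    refine ⟨(X - C (knot p n i)) * C (knot p n (i + q + 1) - knot p n i)⁻¹ * P +
      (C (knot p n (i + q + 2)) - X) * C (knot p n (i + q + 2) - knot p n (i + 1))⁻¹ * Q,
      fun s h1 h2 => ?_⟩
    rw [coxDeBoor, hP s h1 h2, hQ s h1 h2]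
    simp [div_eq_mul_inv]

/-- On an open mesh cell a spline is a polynomial; `ℝ[X][X]` carries `s` as the outer and `t` as
the inner variable. -/
lemma exists_polynomial_spline {a b : ℕ} (ha : a < 2 ^ n) (hb : b < 2 ^ n) {S : Plane → ℝ}
    (hS : S ∈ splineSpace p n) : ∃ P : ℝ[X][X], ∀ x : Plane,
      (a : ℝ) / 2 ^ n < x 0 → x 0 < ((a : ℝ) + 1) / 2 ^ n →
      (b : ℝ) / 2 ^ n < x 1 → x 1 < ((b : ℝ) + 1) / 2 ^ n → S x = P.evalEval (x 1) (x 0) := by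
  induction hS using Submodule.span_induction with
  | mem S hS =>
    obtain ⟨ij, rfl⟩ := hS
    obtain ⟨P, hP⟩ := exists_polynomial_coxDeBoor p ha p ij.1
    obtain ⟨Q, hQ⟩ := exists_polynomial_coxDeBoor p hb p ij.2
    refine ⟨P.map C * C Q, fun x h1 h2 h3 h4 => ?_⟩
    rw [evalEval_mul, evalEval_map_C, evalEval_C, ← hP _ h1 h2, ← hQ _ h3 h4]
    rfl
  | zero => exact ⟨0, fun x _ _ _ _ => by simp⟩
  | add S T _ _ hS hT =>
    obtain ⟨P, hP⟩ := hS
    obtain ⟨Q, hQ⟩ := hT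
    refine ⟨P + Q, fun x h1 h2 h3 h4 => ?_⟩
    rw [Pi.add_apply, hP x h1 h2 h3 h4, hQ x h1 h2 h3 h4, evalEval_add]
  | smul r S _ hS =>
    obtain ⟨P, hP⟩ := hS
    refine ⟨C (C r) * P, fun x h1 h2 h3 h4 => ?_⟩
    rw [Pi.smul_apply, hP x h1 h2 h3 h4, evalEval_mul, evalEval_C, eval_C, smul_eq_mul]

/-- The image in the triangle of the open mesh cell with indices `a` and `b`. -/
def cell (n a b : ℕ) : Set Plane :=
  {x | (a : ℝ) < 2 ^ n * x 0 ∧ 2 ^ n * x 0 < a + 1 ∧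
    b * x 0 < 2 ^ n * x 1 ∧ 2 ^ n * x 1 < (b + 1) * x 0}

lemma isOpen_cell (n a b : ℕ) : IsOpen (cell n a b) := by
  have h0 : Continuous fun x : Plane => x 0 := by fun_prop
  have h1 : Continuous fun x : Plane => x 1 := by fun_prop
  exact (isOpen_lt continuous_const (continuous_const.mul h0)).inter
    ((isOpen_lt (continuous_const.mul h0) continuous_const).inter
    ((isOpen_lt (continuous_const.mul h0) (continuous_const.mul h1)).inter
    (isOpen_lt (continuous_const.mul h1) (continuous_const.mul h0))))

variable {a b : ℕ} {x : Plane}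

lemma pos_of_mem_cell (hx : x ∈ cell n a b) : 0 < x 0 :=
  pos_of_mul_pos_right ((Nat.cast_nonneg a).trans_lt hx.1) (by positivity)

/-- Polar coordinates of the points of a cell. -/
lemma polar_mem_of_mem_cell (hx : x ∈ cell n a b) :
    ((a : ℝ) / 2 ^ n < x 0 ∧ x 0 < ((a : ℝ) + 1) / 2 ^ n) ∧
      (b : ℝ) / 2 ^ n < x 1 / x 0 ∧ x 1 / x 0 < ((b : ℝ) + 1) / 2 ^ n := by
  have h0 := pos_of_mem_cell hx
  have h2 : (0 : ℝ) < 2 ^ n := by positivity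
  obtain ⟨h1, h3, h4, h5⟩ := hx
  refine ⟨⟨?_, ?_⟩, ?_, ?_⟩
  · rw [div_lt_iff₀ h2]; linarith
  · rw [lt_div_iff₀ h2]; linarith
  · rw [div_lt_div_iff₀ h2 h0]; linarith
  · rw [div_lt_div_iff₀ h0 h2]; linarith

lemma mem_cell_of_polar {s t : ℝ} (hs : 0 < s) (h1 : (a : ℝ) / 2 ^ n < s)
    (h2 : s < ((a : ℝ) + 1) / 2 ^ n) (h3 : (b : ℝ) / 2 ^ n < t) (h4 : t < ((b : ℝ) + 1) / 2 ^ n) :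
    (!₂[s, s * t] : Plane) ∈ cell n a b := by
  have hn : (0 : ℝ) < 2 ^ n := by positivity
  rw [div_lt_iff₀ hn] at h1 h3
  rw [lt_div_iff₀ hn] at h2 h4
  simp only [cell, mem_ofPred_eq, Matrix.cons_val_zero, Matrix.cons_val_one]
  refine ⟨by linarith, by linarith, by nlinarith, by nlinarith⟩

lemma cell_subset_triangle (ha : a < 2 ^ n) (hb : b < 2 ^ n) : cell n a b ⊆ triangle := by
  intro x hx
  have h0 := pos_of_mem_cell hx
  have hn : (0 : ℝ) < 2 ^ n := by positivity
  have ha' : (a : ℝ) + 1 ≤ 2 ^ n := by exact_mod_cast ha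
  have hb' : (b : ℝ) + 1 ≤ 2 ^ n := by exact_mod_cast hb
  obtain ⟨h1, h3, h4, h5⟩ := hx
  refine ⟨h0, ?_, ?_, ?_⟩
  · by_contra! h; nlinarith
  · have : 0 ≤ (b : ℝ) * x 0 := by positivity
    exact pos_of_mul_pos_right (this.trans_lt h4) hn.le
  · by_contra! h; nlinarith

lemma collapse_polar (h0 : x 0 ≠ 0) : collapse !₂[x 0, x 1 / x 0] = x := by
  ext i
  fin_cases i
  · simp [collapse]
  · simp [collapse]
    field_simp

/-- On each cell, a derivative of a component of `F` that has a limit `l` at the collapsed corner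
has a bounded gradient. It is a quotient `N / (s ^ k w ^ (k + 1))` of polynomials; on the cells
adjacent to the corner the limit forces `s ^ (k + 1)` to divide `N - l s ^ k w ^ (k + 1)`. -/
lemma exists_bound_partialDeriv_cell {F : Plane → Plane} (hG : IsNurbsMap p n (F ∘ collapse))
    (α : ℕ × ℕ) (i : Fin 2) {l : ℝ}
    (hl : Tendsto (multiDeriv α fun x => F x i) (𝓝[triangle] 0) (𝓝 l))
    (ha : a < 2 ^ n) (hb : b < 2 ^ n) :
    ∃ B : ℝ, ∀ x ∈ cell n a b, DifferentiableAt ℝ (multiDeriv α fun x => F x i) x ∧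
      ∀ j, |partialDeriv j (multiDeriv α fun x => F x i) x| ≤ B := by
  obtain ⟨w, hw, ⟨ε, hε, hwε⟩, hv⟩ := hG
  obtain ⟨v, hv, hFv⟩ := hv i
  obtain ⟨Pw, hPw⟩ := exists_polynomial_spline ha hb hw
  obtain ⟨Pv, hPv⟩ := exists_polynomial_spline ha hb hv
  have hn : (0 : ℝ) < 2 ^ n := by positivity
  have ha' : ((a : ℝ) + 1) / 2 ^ n ≤ 1 := by
    rw [div_le_one hn]; exact_mod_cast ha
  have hb' : ((b : ℝ) + 1) / 2 ^ n ≤ 1 := by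
    rw [div_le_one hn]; exact_mod_cast hb
  have ha0 : 0 ≤ (a : ℝ) / 2 ^ n := by positivity
  have hb0 : 0 ≤ (b : ℝ) / 2 ^ n := by positivity
  have halt : (a : ℝ) / 2 ^ n < ((a : ℝ) + 1) / 2 ^ n := by gcongr; linarith
  have hblt : (b : ℝ) / 2 ^ n < ((b : ℝ) + 1) / 2 ^ n := by gcongr; linarith
  -- the lower bound of the weight extends to the closed cell
  have hPwε : ∀ q ∈ Icc ((b : ℝ) / 2 ^ n) (((b : ℝ) + 1) / 2 ^ n) ×ˢ
      Icc ((a : ℝ) / 2 ^ n) (((a : ℝ) + 1) / 2 ^ n), ε ≤ Pw.evalEval q.1 q.2 := by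
    intro q hq
    have hcl : IsClosed {q : ℝ × ℝ | ε ≤ Pw.evalEval q.1 q.2} :=
      isClosed_le continuous_const (continuous_evalEval Pw)
    refine closure_minimal ?_ hcl (a := q)
      (s := Ioo ((b : ℝ) / 2 ^ n) (((b : ℝ) + 1) / 2 ^ n) ×ˢ
        Ioo ((a : ℝ) / 2 ^ n) (((a : ℝ) + 1) / 2 ^ n)) ?_
    · rintro ⟨t, s⟩ ⟨⟨ht1, ht2⟩, hs1, hs2⟩
      have h1 := hPw !₂[s, t] (by simpa using hs1) (by simpa using hs2) (by simpa using ht1)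
        (by simpa using ht2)
      have h2 := hwε !₂[s, t] (by
        simp only [unitSquare, mem_ofPred_eq, Matrix.cons_val_zero,
          Matrix.cons_val_one]
        exact ⟨by linarith, by linarith, by linarith, by linarith⟩)
      rw [h1] at h2
      simpa using h2
    · rwa [closure_prod_eq, closure_Ioo halt.ne, closure_Ioo hblt.ne]
  have hU := isOpen_cell n a b
  have h0 : ∀ x ∈ cell n a b, x 0 ≠ 0 := fun x hx => (pos_of_mem_cell hx).ne'
  set Q := Icc ((b : ℝ) / 2 ^ n) (((b : ℝ) + 1) / 2 ^ n) ×ˢ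
      Icc ((a : ℝ) / 2 ^ n) (((a : ℝ) + 1) / 2 ^ n) with hQ
  have hQc : IsCompact Q := isCompact_Icc.prod isCompact_Icc
  have hUQ : ∀ x ∈ cell n a b, (x 1 / x 0, x 0) ∈ Q := fun x hx => by
    obtain ⟨⟨h1, h2⟩, h3, h4⟩ := polar_mem_of_mem_cell hx
    exact ⟨⟨h3.le, h4.le⟩, h1.le, h2.le⟩
  have hPw0 : ∀ q ∈ Q, Pw.evalEval q.1 q.2 ≠ 0 := fun q hq => (hε.trans_le (hPwε q hq)).ne'
  have hw0 : ∀ x ∈ cell n a b, polarEval Pw x ≠ 0 := fun x hx => hPw0 _ (hUQ x hx)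
  have hFcell : ∀ x ∈ cell n a b, F x i = polarEval Pv x / polarEval Pw x := by
    intro x hx
    obtain ⟨⟨h1, h2⟩, h3, h4⟩ := polar_mem_of_mem_cell hx
    have e1 := hPw !₂[x 0, x 1 / x 0] h1 h2 h3 h4
    have e2 := hPv !₂[x 0, x 1 / x 0] h1 h2 h3 h4
    have e3 := hFv !₂[x 0, x 1 / x 0] ⟨(pos_of_mem_cell hx : 0 < x 0), h2.trans_le ha',
      hb0.trans_lt h3, h4.trans_le hb'⟩
    rw [Function.comp_apply, collapse_polar (h0 x hx), e1, e2] at e3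
    exact e3
  obtain ⟨N, hN⟩ := exists_multiDeriv_rational hU h0 hw0 hFcell α
  set k := α.1 + α.2 with hk
  rcases Nat.eq_zero_or_pos a with rfl | hapos
  · have hdvd : X ^ (k + 1) ∣ N - C (C l) * X ^ k * Pw ^ (k + 1) := by
      refine X_pow_dvd_of_tendsto_evalEval (Ioo_infinite hblt) fun t ht => ?_
      have htQ : (t, (0 : ℝ)) ∈ Q := ⟨⟨ht.1.le, ht.2.le⟩, by simp, by positivity⟩
      have hs0 : ∀ᶠ s : ℝ in 𝓝[>] 0, s ∈ Ioo (0 : ℝ) (((0 : ℕ) + 1) / 2 ^ n) :=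
        Ioo_mem_nhdsGT (by positivity)
      have hcellev : ∀ᶠ s : ℝ in 𝓝[>] 0, (!₂[s, s * t] : Plane) ∈ cell n 0 b := by
        filter_upwards [hs0] with s hs
        exact mem_cell_of_polar hs.1 (by simpa using hs.1) hs.2 ht.1 ht.2
      have hpath : Tendsto (fun s : ℝ => (!₂[s, s * t] : Plane)) (𝓝[>] 0) (𝓝[triangle] 0) := by
        refine tendsto_nhdsWithin_iff.2 ⟨?_, hcellev.mono fun s hs =>
          cell_subset_triangle ha hb hs⟩
        have hc : Continuous fun s : ℝ => (!₂[s, s * t] : Plane) := by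
          refine (PiLp.continuous_toLp 2 _).comp (continuous_pi fun j => ?_)
          fin_cases j
          · exact continuous_id
          · exact continuous_id.mul continuous_const
        have h1 := (hc.tendsto 0).mono_left (nhdsWithin_le_nhds (s := Ioi 0))
        have h2 : (!₂[(0 : ℝ), 0 * t] : Plane) = 0 := by
          ext j
          fin_cases j <;> simp
        rwa [h2] at h1
      have h1 := (hl.comp hpath).sub_const l
      have hwc : Tendsto (fun s : ℝ => Pw.evalEval t s ^ (k + 1)) (𝓝[>] 0)
          (𝓝 (Pw.evalEval t 0 ^ (k + 1))) := by
        have : Continuous fun s : ℝ => Pw.evalEval t s ^ (k + 1) :=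
          ((continuous_evalEval Pw).comp (Continuous.prodMk continuous_const continuous_id)).pow _
        exact (this.tendsto 0).mono_left nhdsWithin_le_nhds
      have h2 := h1.mul hwc
      rw [sub_self, zero_mul] at h2
      refine h2.congr' ?_
      filter_upwards [hcellev, hs0] with s hs hs'
      have hsne : s ≠ 0 := hs'.1.ne'
      have e1 : ∀ R : ℝ[X][X], polarEval R !₂[s, s * t] = R.evalEval t s := by
        intro R
        simp [polarEval, hsne]
      have hwne : Pw.evalEval t s ≠ 0 := by
        have := hw0 _ hs
        rwa [e1] at this
      simp only [Function.comp_apply]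
      rw [hN _ hs, e1, e1]
      simp only [Matrix.cons_val_zero, evalEval_sub, evalEval_mul, evalEval_pow,
        evalEval_C, eval_C, evalEval_X]
      field_simp
    obtain ⟨M, hM⟩ := hdvd
    refine exists_bound_partialDeriv hU h0 hQc hUQ (M := M) (W := Pw ^ (k + 1)) (l := l)
      (fun q hq => ?_) fun x hx => ?_
    · rw [evalEval_pow]
      exact pow_ne_zero _ (hPw0 q hq)
    · have hx0 := h0 x hx
      have hxw := hw0 x hx
      have e : N = C (C l) * X ^ k * Pw ^ (k + 1) + X ^ (k + 1) * M := by rw [← hM]; ring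
      have e2 : polarEval N x = l * x 0 ^ k * polarEval Pw x ^ (k + 1) +
          x 0 ^ (k + 1) * polarEval M x := by
        rw [e]; simp [polarEval, evalEval_C]
      have e3 : polarEval (Pw ^ (k + 1)) x = polarEval Pw x ^ (k + 1) := by simp [polarEval]
      rw [hN x hx, e2, e3, pow_succ (x 0) k]
      field_simp
  · refine exists_bound_partialDeriv hU h0 hQc hUQ (M := N) (W := X ^ (k + 1) * Pw ^ (k + 1))
      (l := 0) (fun q hq => ?_) fun x hx => ?_
    · rw [evalEval_mul, evalEval_pow, evalEval_pow, evalEval_X]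
      have : 0 < q.2 := lt_of_lt_of_le (by positivity) hq.2.1
      exact mul_ne_zero (pow_ne_zero _ this.ne') (pow_ne_zero _ (hPw0 q hq))
    · have hx0 := h0 x hx
      have hxw := hw0 x hx
      have e3 : polarEval (X ^ (k + 1) * Pw ^ (k + 1)) x =
          x 0 ^ (k + 1) * polarEval Pw x ^ (k + 1) := by simp [polarEval]
      rw [hN x hx, e3, zero_add, pow_succ (x 0) k]
      field_simp

end Cells

/-! ### Smoothness of the geometry map on the triangle -/

section Triangle

variable {f : Plane → ℝ} {x : Plane}

lemma isOpen_triangle : IsOpen triangle := by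
  have h0 : Continuous fun x : Plane => x 0 := by fun_prop
  have h1 : Continuous fun x : Plane => x 1 := by fun_prop
  exact (isOpen_lt continuous_const h0).inter ((isOpen_lt h0 continuous_const).inter
    ((isOpen_lt continuous_const h1).inter (isOpen_lt h1 h0)))

lemma convex_triangle : Convex ℝ triangle := by
  rw [convex_iff_forall_pos]
  rintro x ⟨h1, h2, h3, h4⟩ y ⟨g1, g2, g3, g4⟩ a b ha hb hab
  have hb' : b = 1 - a := by linarith
  simp only [triangle, mem_ofPred_eq, PiLp.add_apply, PiLp.smul_apply, smul_eq_mul]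
  refine ⟨by positivity, ?_, by positivity, ?_⟩
  · calc a * x 0 + b * y 0 < a * 1 + b * 1 := by gcongr
      _ = 1 := by linarith
  · gcongr

lemma isBounded_triangle : Bornology.IsBounded triangle := by
  refine isBounded_iff_forall_norm_le.2 ⟨2, fun x hx => ?_⟩
  obtain ⟨h1, h2, h3, h4⟩ := hx
  refine (norm_le_abs_add_abs x).trans ?_
  rw [abs_of_pos h1, abs_of_pos h3]
  linarith

lemma zero_mem_frontier_triangle : (0 : Plane) ∈ frontier triangle := by
  rw [isOpen_triangle.frontier_eq]
  refine ⟨Metric.mem_closure_iff.2 fun ε hε => ?_, fun h => lt_irrefl _ h.1⟩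
  have hs : 0 < min (1 / 2) (ε / 4) := by positivity
  set s := min (1 / 2) (ε / 4) with hsdef
  have h1 : s ≤ 1 / 2 := min_le_left _ _
  have h2 : s ≤ ε / 4 := min_le_right _ _
  refine ⟨!₂[s, s / 2], ?_, ?_⟩
  · simp only [triangle, mem_ofPred_eq, Matrix.cons_val_zero, Matrix.cons_val_one]
    exact ⟨hs, by linarith, by linarith, by linarith⟩
  · rw [dist_zero_left]
    refine (norm_le_abs_add_abs _).trans_lt ?_
    simp only [Matrix.cons_val_zero, Matrix.cons_val_one]
    rw [abs_of_pos hs, abs_of_pos (by positivity)]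
    linarith

/-- Continuous functions with limits at the boundary of a bounded open set are bounded. -/
lemma exists_bound_of_tendsto_frontier {D : Set Plane} (hD : IsOpen D)
    (hb : Bornology.IsBounded D) (hf : ContinuousOn f D)
    (hlim : ∀ x ∈ frontier D, ∃ l : ℝ, Tendsto f (𝓝[D] x) (𝓝 l)) :
    ∃ B : ℝ, ∀ x ∈ D, |f x| ≤ B := by
  have key : ∃ B : ℝ, ∀ x ∈ closure D, x ∈ D → |f x| ≤ B := by
    refine hb.isCompact_closure.induction_on (p := fun s => ∃ B : ℝ, ∀ x ∈ s, x ∈ D → |f x| ≤ B)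
      ⟨0, fun x hx => hx.elim⟩ (fun s t hst ⟨B, hB⟩ => ⟨B, fun x hx => hB x (hst hx)⟩) ?_ ?_
    · rintro s t ⟨B, hB⟩ ⟨B', hB'⟩
      refine ⟨max B B', fun x hx hxD => ?_⟩
      rcases hx with hx | hx
      · exact (hB x hx hxD).trans (le_max_left _ _)
      · exact (hB' x hx hxD).trans (le_max_right _ _)
    · intro x hx
      -- at interior points the limit exists by continuity
      obtain ⟨l, hl⟩ : ∃ l : ℝ, Tendsto f (𝓝[D] x) (𝓝 l) := by
        by_cases hxD : x ∈ D
        · exact ⟨f x, hf x hxD⟩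
        · exact hlim x (by rw [hD.frontier_eq]; exact ⟨hx, hxD⟩)
      have hev : ∀ᶠ y in 𝓝[D] x, |f y| < |l| + 1 :=
        hl.abs.eventually (gt_mem_nhds (lt_add_one _))
      refine ⟨{y | y ∈ D → |f y| < |l| + 1}, mem_nhdsWithin_of_mem_nhds ?_, |l| + 1,
        fun y hy hyD => (hy hyD).le⟩
      exact eventually_nhdsWithin_iff.1 hev
  obtain ⟨B, hB⟩ := key
  exact ⟨B, fun x hx => hB x (subset_closure hx) hx⟩

/-- Mean value inequality for a function differentiable off a countable set. -/
lemma abs_sub_le_of_hasDerivAt_off_countable {g g' : ℝ → ℝ} {r B : ℝ} (hr : 0 ≤ r) {s : Set ℝ}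
    (hs : s.Countable) (hg : ContinuousOn g (Icc 0 r))
    (hd : ∀ t ∈ Ioo 0 r \ s, HasDerivAt g (g' t) t) (hB : ∀ t ∈ Ioo 0 r \ s, |g' t| ≤ B) :
    |g r - g 0| ≤ B * r := by
  have hd' : ∀ t ∈ Ioo 0 r \ s, HasDerivAt g (deriv g t) t := fun t ht =>
    (hd t ht).differentiableAt.hasDerivAt
  have hB' : ∀ᵐ t ∂volume, t ∈ Ioc (0 : ℝ) r → ‖deriv g t‖ ≤ B := by
    filter_upwards [(hs.union (countable_singleton r)).ae_notMem volume] with t ht htr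
    simp only [mem_union, mem_singleton_iff, not_or] at ht
    have hmem : t ∈ Ioo 0 r \ s := ⟨⟨htr.1, lt_of_le_of_ne htr.2 ht.2⟩, ht.1⟩
    rw [(hd t hmem).deriv]
    exact hB t hmem
  have hint : IntervalIntegrable (deriv g) volume 0 r := by
    rw [intervalIntegrable_iff_integrableOn_Ioc_of_le hr]
    exact Measure.integrableOn_of_bounded (M := B) (by simp)
      (measurable_deriv g).aestronglyMeasurable ((ae_restrict_iff' measurableSet_Ioc).2 hB')
  rw [← integral_eq_of_hasDerivAt_off_countable_of_le g _ hr hs hg hd' hint]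
  have := intervalIntegral.norm_integral_le_of_norm_le_const_ae (a := 0) (b := r) (C := B)
    (f := deriv g) (by rwa [uIoc_of_le hr])
  simpa [abs_of_nonneg hr] using this

/-- The points over the mesh lines `s = m / 2 ^ n` and `t = m / 2 ^ n`. -/
def meshLines (n : ℕ) : Set Plane :=
  {x | (∃ m : ℕ, 2 ^ n * x 0 = m) ∨ ∃ m : ℕ, 2 ^ n * x 1 = m * x 0}

variable {n : ℕ} {B : ℝ}

/-- Along a segment parallel to an axis that meets the mesh lines in countably many points only,
the variation of `f` is controlled by the bound of the gradient off the mesh lines. -/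
lemma abs_sub_le_along_axis (hf : ContinuousOn f triangle)
    (hB : ∀ x ∈ triangle, x ∉ meshLines n →
      DifferentiableAt ℝ f x ∧ ∀ j, |partialDeriv j f x| ≤ B) (j : Fin 2) {r : ℝ} (hr : 0 ≤ r)
    (hseg : ∀ t ∈ Icc 0 r, x + t • EuclideanSpace.single j (1 : ℝ) ∈ triangle)
    (hcount : {t : ℝ | x + t • EuclideanSpace.single j (1 : ℝ) ∈ meshLines n}.Countable) :
    |f (x + r • EuclideanSpace.single j (1 : ℝ)) - f x| ≤ B * r := by
  set c : ℝ → Plane := fun t => x + t • EuclideanSpace.single j (1 : ℝ) with hc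
  have hcd : ∀ t, HasDerivAt c (EuclideanSpace.single j (1 : ℝ)) t := fun t => by
    have h := ((hasDerivAt_id t).smul_const (EuclideanSpace.single j (1 : ℝ) : Plane)).const_add x
    rw [one_smul] at h
    exact h
  have hcc : Continuous c := continuous_iff_continuousAt.2 fun t => (hcd t).continuousAt
  have h := abs_sub_le_of_hasDerivAt_off_countable (g := fun t => f (c t))
    (g' := fun t => partialDeriv j f (c t)) hr hcount
    (hf.comp hcc.continuousOn hseg)
    (fun t ht => (hB _ (hseg t (Ioo_subset_Icc_self ht.1)) ht.2).1.hasFDerivAt.comp_hasDerivAt t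
      (hcd t))
    (fun t ht => (hB _ (hseg t (Ioo_subset_Icc_self ht.1)) ht.2).2 j)
  simpa [hc] using h

lemma eq_add_smul_single_zero (u u' v : ℝ) : (!₂[u', v] : Plane) =
    !₂[u, v] + (u' - u) • EuclideanSpace.single 0 (1 : ℝ) := by
  ext i
  fin_cases i <;> simp

lemma eq_add_smul_single_one (u v v' : ℝ) : (!₂[u, v'] : Plane) =
    !₂[u, v] + (v' - v) • EuclideanSpace.single 1 (1 : ℝ) := by
  ext i
  fin_cases i <;> simp

lemma mem_triangle_mk {u v : ℝ} : (!₂[u, v] : Plane) ∈ triangle ↔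
    0 < u ∧ u < 1 ∧ 0 < v ∧ v < u := by
  simp [triangle]

/-- A horizontal segment in the triangle crosses each mesh line at most once, since `v > 0` on
it. -/
lemma abs_sub_le_horizontal (hf : ContinuousOn f triangle)
    (hB : ∀ x ∈ triangle, x ∉ meshLines n →
      DifferentiableAt ℝ f x ∧ ∀ j, |partialDeriv j f x| ≤ B) {u u' v : ℝ} (huu' : u ≤ u')
    (h : !₂[u, v] ∈ triangle) (h' : !₂[u', v] ∈ triangle) :
    |f !₂[u', v] - f !₂[u, v]| ≤ B * (u' - u) := by
  rw [mem_triangle_mk] at h h'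
  have hn : (2 : ℝ) ^ n ≠ 0 := by positivity
  rw [eq_add_smul_single_zero u u' v]
  refine abs_sub_le_along_axis hf hB 0 (sub_nonneg.2 huu') (fun t ht => ?_) ?_
  · have := eq_add_smul_single_zero u (u + t) v
    rw [add_sub_cancel_left] at this
    rw [← this, mem_triangle_mk]
    have h1 := ht.1
    have h2 := ht.2
    exact ⟨by linarith, by linarith, h.2.2.1, by linarith⟩
  · refine ((countable_range fun m : ℕ => (m : ℝ) / 2 ^ n - u).union
      (countable_range fun m : ℕ => 2 ^ n * v / (m : ℝ) - u)).mono fun t ht => ?_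
    simp only [meshLines, mem_ofPred_eq] at ht
    rcases ht with ⟨m, hm⟩ | ⟨m, hm⟩
    · left
      refine ⟨m, ?_⟩
      simp at hm
      simp only
      rw [← hm]
      field_simp
      ring
    · right
      refine ⟨m, ?_⟩
      simp at hm
      have hm0 : (m : ℝ) ≠ 0 := by
        rintro h0
        rw [h0, zero_mul] at hm
        exact mul_ne_zero hn h.2.2.1.ne' hm
      simp only
      rw [hm]
      field_simp
      ring

lemma abs_sub_le_vertical_of_notMem (hf : ContinuousOn f triangle)
    (hB : ∀ x ∈ triangle, x ∉ meshLines n →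
      DifferentiableAt ℝ f x ∧ ∀ j, |partialDeriv j f x| ≤ B) {u v v' : ℝ} (hvv' : v ≤ v')
    (h : !₂[u, v] ∈ triangle) (h' : !₂[u, v'] ∈ triangle)
    (hu : u ∉ range fun m : ℕ => (m : ℝ) / 2 ^ n) :
    |f !₂[u, v'] - f !₂[u, v]| ≤ B * (v' - v) := by
  rw [mem_triangle_mk] at h h'
  have hn : (2 : ℝ) ^ n ≠ 0 := by positivity
  rw [eq_add_smul_single_one u v v']
  refine abs_sub_le_along_axis hf hB 1 (sub_nonneg.2 hvv') (fun t ht => ?_) ?_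
  · have := eq_add_smul_single_one u v (v + t)
    rw [add_sub_cancel_left] at this
    rw [← this, mem_triangle_mk]
    have h1 := ht.1
    have h2 := ht.2
    exact ⟨by linarith, by linarith, by linarith, by linarith⟩
  · refine (countable_range fun m : ℕ => (m : ℝ) * u / 2 ^ n - v).mono fun t ht => ?_
    simp only [meshLines, mem_ofPred_eq] at ht
    rcases ht with ⟨m, hm⟩ | ⟨m, hm⟩
    · refine (hu ⟨m, ?_⟩).elim
      simp at hm
      simp only
      rw [← hm]
      field_simp
    · refine ⟨m, ?_⟩
      simp at hm
      simp only
      rw [← hm]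
      field_simp
      ring

/-- A vertical segment may lie on a mesh line; it is then a limit of segments that do not. -/
lemma abs_sub_le_vertical (hf : ContinuousOn f triangle)
    (hB : ∀ x ∈ triangle, x ∉ meshLines n →
      DifferentiableAt ℝ f x ∧ ∀ j, |partialDeriv j f x| ≤ B) {u v v' : ℝ} (hvv' : v ≤ v')
    (h : !₂[u, v] ∈ triangle) (h' : !₂[u, v'] ∈ triangle) :
    |f !₂[u, v'] - f !₂[u, v]| ≤ B * (v' - v) := by
  have hcont : ∀ w : ℝ, Continuous fun s : ℝ => (!₂[s, w] : Plane) := fun w => by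
    refine (PiLp.continuous_toLp 2 _).comp (continuous_pi fun j => ?_)
    fin_cases j
    · exact continuous_id
    · exact continuous_const
  have hfc : ∀ w : ℝ, !₂[u, w] ∈ triangle → ContinuousAt (fun s : ℝ => f !₂[s, w]) u :=
    fun w hw => ContinuousAt.comp (f := fun s : ℝ => (!₂[s, w] : Plane)) (g := f)
      (hf.continuousAt (isOpen_triangle.mem_nhds hw)) (hcont w).continuousAt
  have hlim : Tendsto (fun s : ℝ => |f !₂[s, v'] - f !₂[s, v]|) (𝓝 u)
      (𝓝 |f !₂[u, v'] - f !₂[u, v]|) := ((hfc v' h').sub (hfc v h)).abs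
  have hdense : ∃ᶠ s in 𝓝 u, s ∈ (range fun m : ℕ => (m : ℝ) / 2 ^ n)ᶜ :=
    mem_closure_iff_frequently.1 ((countable_range _).dense_compl ℝ u)
  have hev : ∀ w : ℝ, !₂[u, w] ∈ triangle → ∀ᶠ s in 𝓝 u, !₂[s, w] ∈ triangle := fun w hw =>
    (hcont w).continuousAt.eventually (isOpen_triangle.mem_nhds hw)
  refine le_of_tendsto_of_frequently hlim ?_
  refine (hdense.and_eventually ((hev v h).and (hev v' h'))).mono fun s hs => ?_
  exact abs_sub_le_vertical_of_notMem hf hB hvv' hs.2.1 hs.2.2 hs.1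

/-- A continuous function on the triangle with bounded gradient off the mesh lines is Lipschitz. Two
points are joined by a horizontal and a vertical segment inside the triangle, via the corner
with the larger first coordinate. -/
lemma exists_lipschitzOnWith_triangle (hf : ContinuousOn f triangle)
    (hB : ∀ x ∈ triangle, x ∉ meshLines n →
      DifferentiableAt ℝ f x ∧ ∀ j, |partialDeriv j f x| ≤ B) :
    ∃ L : NNReal, LipschitzOnWith L f triangle := by
  have hmk : ∀ x : Plane, x = !₂[x 0, x 1] := fun x => by
    ext i
    fin_cases i <;> simp
  have key : ∀ x ∈ triangle, ∀ y ∈ triangle, x 0 ≤ y 0 → |f x - f y| ≤ 2 * |B| * ‖x - y‖ := by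
    intro x hx y hy hxy
    have hx' := hx
    have hy' := hy
    rw [hmk x] at hx'
    rw [hmk y] at hy'
    rw [mem_triangle_mk] at hx' hy'
    have hz : !₂[y 0, x 1] ∈ triangle :=
      mem_triangle_mk.2 ⟨hy'.1, hy'.2.1, hx'.2.2.1, hx'.2.2.2.trans_le hxy⟩
    have h0 : |f !₂[y 0, x 1] - f x| ≤ |B| * ‖x - y‖ := by
      have := abs_sub_le_horizontal hf hB hxy (hmk x ▸ hx) hz
      rw [← hmk x] at this
      refine this.trans (mul_le_mul (le_abs_self B) ?_ (sub_nonneg.2 hxy) (abs_nonneg _))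
      have := abs_coord_le_norm (x - y) 0
      rw [PiLp.sub_apply, abs_sub_comm] at this
      exact (le_abs_self _).trans this
    have h1 : |f !₂[y 0, x 1] - f y| ≤ |B| * ‖x - y‖ := by
      have hc := abs_coord_le_norm (x - y) 1
      rw [PiLp.sub_apply] at hc
      rcases le_total (x 1) (y 1) with hle | hle
      · have := abs_sub_le_vertical hf hB hle hz (hmk y ▸ hy)
        rw [← hmk y, abs_sub_comm] at this
        rw [abs_sub_comm] at hc
        exact this.trans (mul_le_mul (le_abs_self B) ((le_abs_self _).trans hc)
          (sub_nonneg.2 hle) (abs_nonneg _))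
      · have := abs_sub_le_vertical hf hB hle (hmk y ▸ hy) hz
        rw [← hmk y] at this
        exact this.trans (mul_le_mul (le_abs_self B) ((le_abs_self _).trans hc)
          (sub_nonneg.2 hle) (abs_nonneg _))
    calc |f x - f y| = |-(f !₂[y 0, x 1] - f x) + (f !₂[y 0, x 1] - f y)| := by congr 1; ring
      _ ≤ |-(f !₂[y 0, x 1] - f x)| + |f !₂[y 0, x 1] - f y| := abs_add_le _ _
      _ ≤ 2 * |B| * ‖x - y‖ := by rw [abs_neg]; linarith
  refine ⟨Real.toNNReal (2 * |B|), LipschitzOnWith.of_dist_le_mul fun x hx y hy => ?_⟩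
  rw [Real.coe_toNNReal _ (by positivity), Real.dist_eq, dist_eq_norm]
  rcases le_total (x 0) (y 0) with h | h
  · exact key x hx y hy h
  · rw [abs_sub_comm, norm_sub_rev]
    exact key y hy x hx h

lemma exists_mem_cell (hx : x ∈ triangle) (h : x ∉ meshLines n) :
    ∃ a < 2 ^ n, ∃ b < 2 ^ n, x ∈ cell n a b := by
  obtain ⟨h1, h2, h3, h4⟩ := hx
  have hn : (0 : ℝ) < 2 ^ n := by positivity
  simp only [meshLines, mem_ofPred_eq, not_or, not_exists] at h
  obtain ⟨hs, ht⟩ := h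
  have a1 := Nat.floor_le (show 0 ≤ 2 ^ n * x 0 by positivity)
  have a2 := Nat.lt_floor_add_one (2 ^ n * x 0)
  have b1 := Nat.floor_le (show 0 ≤ 2 ^ n * x 1 / x 0 by positivity)
  have b2 := Nat.lt_floor_add_one (2 ^ n * x 1 / x 0)
  set a := ⌊2 ^ n * x 0⌋₊
  set b := ⌊2 ^ n * x 1 / x 0⌋₊
  rw [le_div_iff₀ h1] at b1
  rw [div_lt_iff₀ h1] at b2
  refine ⟨a, ?_, b, ?_, lt_of_le_of_ne a1 fun e => hs a e.symm, a2,
    lt_of_le_of_ne b1 fun e => ht b e.symm, b2⟩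
  · have : (a : ℝ) < 2 ^ n := by nlinarith
    exact_mod_cast this
  · have : (b : ℝ) < 2 ^ n := by
      by_contra! hle
      nlinarith
    exact_mod_cast this

/-- The derivatives of order at most `p` of the geometry map are Lipschitz on the triangle; for
those of order `p` this is one order more than the hypothesis `hF` provides. -/
lemma exists_lipschitzOnWith_multiDeriv {p : ℕ} {F : Plane → Plane}
    (hG : IsNurbsMap p n (F ∘ collapse)) {i : Fin 2}
    (hF : ContDiffOnClosure p triangle fun x => F x i) {α : ℕ × ℕ} (hα : α.1 + α.2 ≤ p) :
    ∃ L : NNReal, LipschitzOnWith L (multiDeriv α fun x => F x i) triangle := by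
  obtain ⟨l, hl⟩ := hF.2 α hα 0 zero_mem_frontier_triangle
  have hcell : ∀ ab : Fin (2 ^ n) × Fin (2 ^ n), ∃ B : ℝ, ∀ x ∈ cell n ab.1 ab.2,
      DifferentiableAt ℝ (multiDeriv α fun x => F x i) x ∧
      ∀ j, |partialDeriv j (multiDeriv α fun x => F x i) x| ≤ B := fun ab =>
    exists_bound_partialDeriv_cell hG α i hl ab.1.2 ab.2.2
  choose B hB using hcell
  obtain ⟨M, hM⟩ := Finite.bddAbove_range B
  refine exists_lipschitzOnWith_triangle (n := n) (B := M)
    (contDiffOn_multiDeriv (k := 0) isOpen_triangle hF.1 (by omega)).continuousOn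
    fun x hx hxn => ?_
  obtain ⟨a, ha, b, hb, hab⟩ := exists_mem_cell hx hxn
  obtain ⟨h1, h2⟩ := hB (⟨a, ha⟩, ⟨b, hb⟩) x hab
  exact ⟨h1, fun j => (h2 j).trans (hM ⟨_, rfl⟩)⟩

/-- A derivative of order `p - q` of the geometry map belongs to `W^{q+1,∞}`. -/
lemma isMultiplier_multiDeriv {p : ℕ} {F : Plane → Plane} (hG : IsNurbsMap p n (F ∘ collapse))
    {i : Fin 2} (hF : ContDiffOnClosure p triangle fun x => F x i) {α : ℕ × ℕ} {q : ℕ}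
    (hα : α.1 + α.2 + q = p) :
    IsMultiplier triangle (q + 1) (multiDeriv α fun x => F x i) := by
  have hbdd : ∀ β : ℕ × ℕ, β.1 + β.2 ≤ p →
      ∃ B : ℝ, ∀ x ∈ triangle, |multiDeriv β (fun x => F x i) x| ≤ B := fun β hβ =>
    exists_bound_of_tendsto_frontier isOpen_triangle isBounded_triangle
      (contDiffOn_multiDeriv (k := 0) isOpen_triangle hF.1 (by omega)).continuousOn (hF.2 β hβ)
  induction q generalizing α with
  | zero =>
    obtain ⟨L, hL⟩ := exists_lipschitzOnWith_multiDeriv hG hF (α := α) (by omega)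
    refine ⟨hbdd α (by omega), ⟨L, hL⟩, fun j => ⟨_, EventuallyEq.rfl,
      (measurable_partialDeriv j _).aestronglyMeasurable, L, ?_⟩⟩
    exact (ae_restrict_iff' isOpen_triangle.measurableSet).2 (Eventually.of_forall fun x hx =>
      abs_partialDeriv_le_of_lipschitzOnWith isOpen_triangle hL j hx)
  | succ q ih =>
    refine ⟨hbdd α (by omega), exists_lipschitzOnWith_multiDeriv hG hF (by omega),
      fun j => ⟨multiDeriv (α + unitIndex j) fun x => F x i, ?_, ih ?_⟩⟩
    · filter_upwards [self_mem_ae_restrict isOpen_triangle.measurableSet] with x hx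
      exact multiDeriv_add_unitIndex isOpen_triangle hF.1 (by omega) j hx
    · have := unitIndex_order j
      simp only [Prod.fst_add, Prod.snd_add]
      omega

end Triangle

end IGA

theorem mainTheorem4 (p : ℕ) (hp : 1 ≤ p) (F : IGA.Plane → IGA.Plane)
    (hG : ∃ n : ℕ, IGA.IsNurbsMap p n (F ∘ IGA.collapse))
    (hF : ∀ i : Fin 2, IGA.ContDiffOnClosure p IGA.triangle (fun x => F x i))
    (c : ℝ) (hc : 0 < c) (hdet : ∀ x ∈ IGA.triangle, c < (fderiv ℝ F x).det) :
    ∃ C : ℝ, 0 < C ∧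
      ∀ φ : IGA.Plane → ℝ, IGA.MemSobolev (p + 1) (F '' IGA.triangle) φ →
        IGA.MemSobolev (p + 1) IGA.triangle (φ ∘ F) ∧
        ∀ k : ℕ, k ≤ p + 1 →
          (1 / C) * IGA.sobolevNorm k (F '' IGA.triangle) φ
              ≤ IGA.sobolevNorm k IGA.triangle (φ ∘ F) ∧
          IGA.sobolevNorm k IGA.triangle (φ ∘ F)
              ≤ C * IGA.sobolevNorm k (F '' IGA.triangle) φ := by
  open IGA in
  obtain ⟨n, hG⟩ := hG
  obtain ⟨q, rfl⟩ := Nat.exists_eq_add_of_le' hp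
  have hA : ∀ i j, IsMultiplier triangle (q + 1) (partialDeriv i fun y => F y j) := fun i j => by
    rw [← multiDeriv_unitIndex]
    exact isMultiplier_multiDeriv hG (hF j) (by rw [unitIndex_order]; omega)
  have hF1 : ContDiffOn ℝ 1 F triangle :=
    contDiffOn_euclidean.2 fun i => (hF i).1.of_le (by exact_mod_cast hp)
  have hd : ∀ x ∈ triangle, DifferentiableAt ℝ F x := fun x hx =>
    (hF1.contDiffAt (isOpen_triangle.mem_nhds hx)).differentiableAt one_ne_zero
  obtain ⟨C, hT⟩ := exists_isTransport isOpen_triangle convex_triangle isBounded_triangle hF1 hA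
    hc hdet
  have hK := isMultiplier_inverseJacobian isOpen_triangle hd hA hc hdet
  -- the orders `0, …, p + 1`, with `p = q + 1`; the constants for all of them are summed below
  have hR : ∀ k : Fin (q + 1 + 2), ∃ R : ℝ, 0 ≤ R ∧ ∀ φ, MemSobolev k (F '' triangle) φ →
      MemSobolev k triangle (φ ∘ F) ∧
      sobolevNorm k triangle (φ ∘ F) ≤ R * sobolevNorm k (F '' triangle) φ ∧
      sobolevNorm k (F '' triangle) φ ≤ R * sobolevNorm k triangle (φ ∘ F) := fun k => by
    obtain ⟨B, -, hB⟩ := hT.exists_derivSum_comp_le hA hK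
      (fun x hx => sum_inverseJacobian_mul (hd x hx) (hc.trans (hdet x hx)).ne')
      (k := k) (by omega)
    exact hT.exists_sobolevNorm_comp hB
  choose R hR0 hR using hR
  have hle : ∀ k, R k ≤ 1 + ∑ k, R k := fun k => by
    have := Finset.single_le_sum (fun k _ => hR0 k) (Finset.mem_univ k)
    linarith
  have hC : 0 < 1 + ∑ k, R k := by
    have := Finset.sum_nonneg fun k (_ : k ∈ Finset.univ) => hR0 k
    linarith
  refine ⟨1 + ∑ k, R k, hC, fun φ hφ => ⟨(hR (Fin.last _) φ hφ).1, fun k hk => ?_⟩⟩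
  obtain ⟨-, h1, h2⟩ := hR ⟨k, by omega⟩ φ (hφ.mono hk)
  constructor
  · rw [one_div, inv_mul_le_iff₀ hC]
    exact h2.trans (mul_le_mul_of_nonneg_right (hle _) (Real.sqrt_nonneg _))
  · exact h1.trans (mul_le_mul_of_nonneg_right (hle _) (Real.sqrt_nonneg _))
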